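/- **Setting.** Let $\mathbb C^{\mathbb Z}_{cpt}$ be the space of finitely supported functions $\mathbb Z\to\mathbb C$ with its standard basis $(e_i)_{i\in\mathbb Z}$ and inner product $\langle e_i,e_j\rangle=\delta_{ij}$; put $\mathbb C_p^q=\mathrm{span}\{e_i: p\le i<q\}$ and $\mathbb C_{-\infty}^q=\mathrm{span}\{e_i: i<q\}$, let $I_0$ be the orthogonal projection onto $\mathbb C_{-\infty}^0$, and let $s_k$ be the shift $e_i\mapsto e_{i+k}$. Let $BU\times\mathbb Z$ be the set of Hermitian operators $P$ on $\mathbb C^{\mathbb Z}_{cpt}$ with spectrum in $\{0,1\}$ (equivalently $P^2=P$) such that $P-I_0$ has finite rank. It is filtered by $(BU\times\mathbb Z)_{-N}^N=\{P:\mathbb C_{-\infty}^{-N}\subseteq \mathrm{Im}\,P\subseteq\mathbb C_{-\infty}^N\}$, and a map from a compact manifold $M$ (possibly with boundary or corners), or from $M\times[0,1]$, to $BU\times\mathbb Z$ is smooth if it takes values in some $(BU\times\mathbb Z)_{-N}^N$ and its matrix entries are smooth. For a smooth homotopy $\Gamma_t:M\times[0,1]\to BU\times\mathbb Z$ put $$CS(\Gamma_t)=\int_{t\in[0,1]}Ch(\Gamma_t)\in\Omega^{odd}(M),\qquad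 Ch(P)=\mathrm{Tr}\sum_{n\ge0}\frac1{(2\pi i)^n}\frac1{n!}P(dP)^{2n}.$$ Smooth maps $P_0,P_1:M\to BU\times\mathbb Z$ are $CS$-equivalent if there is a smooth homotopy $\Gamma_t$ from $P_0$ to $P_1$ with $CS(\Gamma_t)$ exact; $\hat K^0(M)$ is the set of $CS$-equivalence classes. For smooth $P,Q:M\to BU\times\mathbb Z$ choose integers $p,q,m,n$ with $\mathrm{Im}\,P(x)=\mathbb C_{-\infty}^p\oplus V(x)$, $V(x)\subseteq\mathbb C_p^q$, and $\mathrm{Im}\,Q(x)=\mathbb C_{-\infty}^m\oplus W(x)$, $W(x)\subseteq\mathbb C_m^n$, for all $x\in M$. Then $(P\oplus Q)(x)$ is the orthogonal projection onto $\mathbb C_{-\infty}^{p+m}\oplus s_m(V(x))\oplus s_q(W(x))$, and $P^\perp(x)$ is the orthogonal projection onto $\mathbb C_{-\infty}^{-q}\oplus s_{-p-q}(V(x)^\perp)$, with $V(x)^\perp$ the orthogonal complement of $V(x)$ in $\mathbb C_p^q$. The shuffle sum is $P\boxplus Q=\rho^{-1}(P\oplus_{ext}Q)\rho$, where $P\oplus_{ext}Q$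 acts diagonally on $\mathbb C^{\mathbb Z}_{cpt}\oplus\mathbb C^{\mathbb Z}_{cpt}$ and $\rho:\mathbb C^{\mathbb Z}_{cpt}\to\mathbb C^{\mathbb Z}_{cpt}\oplus\mathbb C^{\mathbb Z}_{cpt}$ sends $e_{2k}$ to $e_k$ in the first and $e_{2k+1}$ to $e_k$ in the second summand. **Theorem.** Let $M$ be a compact smooth manifold and let $P,Q:M\to BU\times\mathbb Z$ be smooth. The following hold for all admissible choices of the integers in the definitions of $\oplus$ and $^\perp$ (in particular for the largest $p,m$ and the least $q,n$). 1. $P\oplus Q$ and $P\boxplus Q$ are smooth maps $M\to BU\times\mathbb Z$. There are smooth homotopies from $P\oplus Q$ to $Q\oplus P$, from $P\boxplus Q$ to $Q\boxplus P$, and from $P\oplus Q$ to $P\boxplus Q$, each with $CS(\Gamma_t)=0$. In particular $P\oplus Q$ and $P\boxplus Q$ are $CS$-equivalent. 2. $P^\perp$ is a smooth map $M\to BU\times\mathbb Z$, and there is a smooth homotopy from $P\oplus P^\perp$ to the constant map $I_0$ with $CS(\Gamma_t)=0$. 3. Let $k\ne\ell$ be integers and let $\tau$ be the operator on $\mathbb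 C^{\mathbb Z}_{cpt}$ that exchanges $e_k$ and $e_\ell$ and fixes the other basis vectors. There is a map $\Gamma:(BU\times\mathbb Z)\times[0,1]\to BU\times\mathbb Z$ with $\Gamma(P)_0=P$ and $\Gamma(P)_1=\tau P\tau^{-1}$ for all $P\in BU\times\mathbb Z$ such that, for every smooth map $P$ from a compact manifold $M$ to $BU\times\mathbb Z$, $\Gamma(P)_t$ is a smooth homotopy on $M\times[0,1]$ with $CS(\Gamma(P)_t)=0$. In particular $P$ is $CS$-equivalent to $\tau P\tau^{-1}$. 4. $CS$-equivalence is an equivalence relation. The set $\hat K^0(M)$ is an abelian group with $[P]+[Q]=[P\oplus Q]=[P\boxplus Q]$, identity $[I_0]$ and $-[P]=[P^\perp]$, and with the pullbacks $f^*[P]=[P\circ f]$ along smooth maps $f$ it is a contravariant functor from compact smooth manifolds to abelian groups. -/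

import Mathlib

open scoped Manifold ContDiff
open CategoryTheory

universe u

noncomputable section

namespace KTheory

/-! ### Operators on the space of compactly supported sequences `ℤ → ℂ` -/

/-- The space `ℂ^ℤ_cpt`, the span of the basis vectors `e_i`, `i ∈ ℤ`. -/
abbrev V : Type := ℤ →₀ ℂ

/-- The inner product with `⟨e_i, e_j⟩ = δ_{ij}`. -/
def inn (x y : V) : ℂ := x.sum fun i a => (starRingEnd ℂ) a * y i

/-- `ℂ_{-∞}^q`, the span of the `e_i` with `i < q`. -/
def below (q : ℤ) : Submodule ℂ V := Finsupp.supported ℂ ℂ (Set.Iio q)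

/-- `ℂ_p^q`, the span of the `e_i` with `p ≤ i < q`. -/
def between (p q : ℤ) : Submodule ℂ V := Finsupp.supported ℂ ℂ (Set.Ico p q)

/-- The operator that relabels the basis, `e_i ↦ e_{σ i}`. -/
def relabel (σ : ℤ ≃ ℤ) : Module.End ℂ V := (Finsupp.domLCongr σ : V ≃ₗ[ℂ] V).toLinearMap

/-- The shift `s_k`, `e_i ↦ e_{i+k}`. -/
def shift (k : ℤ) : Module.End ℂ V := relabel (Equiv.addRight k)

/-- The orthogonal projection `I_0` onto `ℂ_{-∞}^0`. -/
def I0op : Module.End ℂ V :=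
  (below 0).subtype ∘ₗ Finsupp.restrictDom ℂ ℂ (Set.Iio (0 : ℤ))

/-- The space `BU × ℤ`: Hermitian operators `P` on `ℂ^ℤ_cpt` with spectrum in `{0, 1}`, that is,
with `P² = P`, such that `P - I_0` has finite rank. -/
@[ext] structure BUZ where
  op : Module.End ℂ V
  hermitian : ∀ x y, inn (op x) y = inn x (op y)
  idem : op * op = op
  finite_rank : FiniteDimensional ℂ (LinearMap.range (op - I0op))

lemma I0op_apply (x : V) (i : ℤ) : I0op x i = if i < 0 then x i else 0 := by
  change Finsupp.filter (· ∈ Set.Iio (0 : ℤ)) x i = _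
  simp [Finsupp.filter_apply]

lemma inn_eq (x y : V) (s : Finset ℤ) (hs : x.support ⊆ s) :
    inn x y = ∑ i ∈ s, (starRingEnd ℂ) (x i) * y i := by
  unfold inn
  exact Finsupp.sum_of_support_subset _ hs _ (by simp)

/-- `I_0` as a point of `BU × ℤ`. -/
def I0 : BUZ where
  op := I0op
  hermitian x y := by
    have hs : (I0op x).support ⊆ x.support := by
      intro i hi
      simp only [Finsupp.mem_support_iff, I0op_apply] at hi ⊢
      grind
    rw [inn_eq _ _ _ hs, inn_eq _ _ _ (Finset.Subset.refl x.support)]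
    refine Finset.sum_congr rfl fun i _ => ?_
    simp only [I0op_apply]
    split_ifs <;> simp
  idem := by
    refine LinearMap.ext fun x => Finsupp.ext fun i => ?_
    simp only [Module.End.mul_apply, I0op_apply]
    split_ifs <;> rfl
  finite_rank := by
    rw [sub_self (G := V →ₗ[ℂ] V) I0op, LinearMap.range_zero]
    infer_instance

/-- The matrix entry `⟨e_i, P e_j⟩`. -/
def BUZ.entry (P : BUZ) (i j : ℤ) : ℂ := P.op (Finsupp.single j 1) i

/-- The condition `ℂ_{-∞}^p ⊆ Im P ⊆ ℂ_{-∞}^q`, defining the stage `(BU × ℤ)_p^q`. -/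
def BUZ.InStage (P : BUZ) (p q : ℤ) : Prop :=
  below p ≤ LinearMap.range P.op ∧ LinearMap.range P.op ≤ below q

/-! ### The shuffle sum `⊞` -/

/-- The relabeling `2k ↦ k` in the first, `2k + 1 ↦ k` in the second copy of `ℤ`. -/
def shuffleEquiv : ℤ ≃ ℤ ⊕ ℤ where
  toFun i := if i % 2 = 0 then Sum.inl (i / 2) else Sum.inr (i / 2)
  invFun := Sum.elim (fun k => 2 * k) (fun k => 2 * k + 1)
  left_inv i := by
    dsimp only
    split_ifs with h
    · simp only [Sum.elim_inl]; omega
    · simp only [Sum.elim_inr]; omega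
  right_inv := by
    rintro (k | k)
    · have h : (2 * k) / 2 = k := by omega
      simp [h]
    · have h1 : (2 * k + 1) / 2 = k := by omega
      have h2 : (2 * k + 1) % 2 = 1 := by omega
      simp [h1, h2]

/-- The shuffle isomorphism `ρ_sh : ℂ^ℤ_cpt → ℂ^ℤ_cpt ⊕ ℂ^ℤ_cpt`. -/
def shuffle : V ≃ₗ[ℂ] V × V :=
  (Finsupp.domLCongr shuffleEquiv).trans (Finsupp.sumFinsuppLEquivProdFinsupp ℂ)

/-- The operator `ρ_sh⁻¹ ∘ (A ⊕ B) ∘ ρ_sh`. -/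
def boxplusOp (A B : Module.End ℂ V) : Module.End ℂ V :=
  shuffle.symm.toLinearMap ∘ₗ (A.prodMap B) ∘ₗ shuffle.toLinearMap

lemma shuffle_fst (x : V) (k : ℤ) : (shuffle x).1 k = x (2 * k) := by
  simp [shuffle, shuffleEquiv, Finsupp.domLCongr_apply, Finsupp.domCongr_apply]

lemma shuffle_snd (x : V) (k : ℤ) : (shuffle x).2 k = x (2 * k + 1) := by
  simp [shuffle, shuffleEquiv, Finsupp.domLCongr_apply, Finsupp.domCongr_apply]

lemma shuffle_boxplusOp (A B : Module.End ℂ V) (x : V) :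
    shuffle (boxplusOp A B x) = (A (shuffle x).1, B (shuffle x).2) := by
  simp [boxplusOp]

lemma inn_shuffle (x y : V) :
    inn x y = inn (shuffle x).1 (shuffle y).1 + inn (shuffle x).2 (shuffle y).2 := by
  induction x using Finsupp.induction_linear with
  | zero => simp [inn]
  | add f g hf hg =>
    have hadd : ∀ a b c : V, inn (a + b) c = inn a c + inn b c := by
      intro a b c
      unfold inn
      exact Finsupp.sum_add_index' (by simp) (by intros; simp [add_mul])
    rw [hadd, hf, hg, map_add, Prod.fst_add, Prod.snd_add, hadd, hadd]
    ring
  | single i a =>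
    have hsub : ∀ (j : ℤ) (b : ℂ) (z : V), inn (Finsupp.single j b) z
        = (starRingEnd ℂ) b * z j := by
      intro j b z
      simp [inn]
    rcases Int.even_or_odd' i with ⟨k, rfl | rfl⟩
    · have h1 : (shuffle (Finsupp.single (2 * k) a)).1 = Finsupp.single k a := by
        ext j
        rw [shuffle_fst, Finsupp.single_apply, Finsupp.single_apply]
        simp
      have h2 : (shuffle (Finsupp.single (2 * k) a)).2 = 0 := by
        ext j
        rw [shuffle_snd, Finsupp.single_apply, if_neg (by omega)]
        rfl
      rw [h1, h2, hsub, hsub, shuffle_fst]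
      simp [inn]
    · have h1 : (shuffle (Finsupp.single (2 * k + 1) a)).2 = Finsupp.single k a := by
        ext j
        rw [shuffle_snd, Finsupp.single_apply, Finsupp.single_apply]
        simp
      have h2 : (shuffle (Finsupp.single (2 * k + 1) a)).1 = 0 := by
        ext j
        rw [shuffle_fst, Finsupp.single_apply, if_neg (by omega)]
        rfl
      rw [h1, h2, hsub, hsub, shuffle_snd]
      simp [inn]

lemma boxplusOp_I0op : boxplusOp I0op I0op = I0op := by
  refine LinearMap.ext fun x => shuffle.injective ?_
  rw [shuffle_boxplusOp]
  refine Prod.ext (Finsupp.ext fun k => ?_) (Finsupp.ext fun k => ?_)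
  · simp only [I0op_apply, shuffle_fst]
    congr 1
    exact propext (by omega)
  · simp only [I0op_apply, shuffle_snd]
    congr 1
    exact propext (by omega)

/-- The shuffle block sum `⊞ : (BU × ℤ) × (BU × ℤ) → BU × ℤ`. -/
def boxplus (P Q : BUZ) : BUZ where
  op := boxplusOp P.op Q.op
  hermitian x y := by
    rw [inn_shuffle, shuffle_boxplusOp, inn_shuffle x, shuffle_boxplusOp, P.hermitian, Q.hermitian]
  idem := by
    refine LinearMap.ext fun x => shuffle.injective ?_
    rw [Module.End.mul_apply, shuffle_boxplusOp, shuffle_boxplusOp]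
    refine Prod.ext ?_ ?_
    · exact LinearMap.congr_fun P.idem _
    · exact LinearMap.congr_fun Q.idem _
  finite_rank := by
    have h : boxplusOp P.op Q.op - I0op
        = shuffle.symm.toLinearMap ∘ₗ ((P.op - I0op).prodMap (Q.op - I0op)) ∘ₗ
          shuffle.toLinearMap := by
      refine LinearMap.ext fun x => shuffle.injective ?_
      conv_lhs => rw [← boxplusOp_I0op]
      rw [LinearMap.sub_apply, map_sub, shuffle_boxplusOp, shuffle_boxplusOp]
      simp
    have hfin : FiniteDimensional ℂ
        (LinearMap.range ((P.op - I0op).prodMap (Q.op - I0op))) := by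
      rw [LinearMap.range_prodMap]
      exact Module.Finite.iff_fg.2
        ((Module.Finite.iff_fg.1 P.finite_rank).prod (Module.Finite.iff_fg.1 Q.finite_rank))
    rw [h, LinearMap.range_comp, LinearMap.range_comp_of_range_eq_top _
      (LinearEquiv.range shuffle)]
    infer_instance

/-! ### Differential forms -/

section Forms

variable {E : Type*} [NormedAddCommGroup E] [NormedSpace ℝ E] {H : Type*} [TopologicalSpace H]
  (I : ModelWithCorners ℝ E H) {M : Type*} [TopologicalSpace M] [ChartedSpace H M]

/-- The expression of a `k`-form `β` on `M` in the preferred chart at `x₀`, as a `k`-form on the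
model vector space (meaningful on the target of the chart). -/
def formInChart {k : ℕ} (β : ∀ x : M, TangentSpace I x [⋀^Fin k]→L[ℝ] ℂ) (x₀ : M) (y : E) :
    E [⋀^Fin k]→L[ℝ] ℂ :=
  (β ((extChartAt I x₀).symm y)).compContinuousLinearMap
    (mfderivWithin 𝓘(ℝ, E) I (extChartAt I x₀).symm (Set.range I) y)

/-- Smoothness of a differential form. -/
def IsSmoothForm {k : ℕ} (β : ∀ x : M, TangentSpace I x [⋀^Fin k]→L[ℝ] ℂ) : Prop :=
  ∀ x₀ : M, ContDiffOn ℝ ∞ (formInChart I β x₀) (extChartAt I x₀).target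

/-- The exterior derivative `dβ` of a `k`-form. -/
def extD {k : ℕ} (β : ∀ x : M, TangentSpace I x [⋀^Fin k]→L[ℝ] ℂ) (x : M) :
    TangentSpace I x [⋀^Fin (k + 1)]→L[ℝ] ℂ :=
  (extDerivWithin (formInChart I β x) (Set.range I) (extChartAt I x x)).compContinuousLinearMap
    (mfderiv I 𝓘(ℝ, E) (extChartAt I x) x)

/-- A `(k+1)`-form, given by its values on tuples of tangent vectors, is exact if it is `dβ` for
some smooth `k`-form `β`. -/
def IsExact {k : ℕ} (α : ∀ x : M, (Fin (k + 1) → TangentSpace I x) → ℂ) : Prop :=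
  ∃ β : ∀ x : M, TangentSpace I x [⋀^Fin k]→L[ℝ] ℂ,
    IsSmoothForm I β ∧ ∀ x v, extD I β x v = α x v

/-! ### Smooth maps to `BU × ℤ` and Chern forms -/

/-- Smoothness on `s` of a map to `BU × ℤ`: it takes values in one of the stages
`(BU × ℤ)_{-N}^N` and is smooth as a map to the complex matrices. -/
def IsSmoothOn (P : M → BUZ) (s : Set M) : Prop :=
  (∃ N : ℕ, ∀ x ∈ s, (P x).InStage (-(N : ℤ)) N) ∧
    ∀ i j : ℤ, ContMDiffOn I 𝓘(ℝ, ℂ) ∞ (fun x => (P x).entry i j) s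

/-- Smooth maps `M → BU × ℤ`. -/
def IsSmooth (P : M → BUZ) : Prop := IsSmoothOn I P Set.univ

/-- The block of `P` on `ℂ_{-N}^N`. -/
def blockAt (N : ℕ) (P : BUZ) :
    Matrix (Finset.Ico (-(N : ℤ)) N) (Finset.Ico (-(N : ℤ)) N) ℂ :=
  Matrix.of fun i j => P.entry i j

/-- The value `dP(w)` of the matrix-valued 1-form `dP` on `ℂ_{-N}^N`, for a map defined on `s`. -/
def dBlock (N : ℕ) (P : M → BUZ) (s : Set M) (x : M) (w : TangentSpace I x) :
    Matrix (Finset.Ico (-(N : ℤ)) N) (Finset.Ico (-(N : ℤ)) N) ℂ :=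
  Matrix.of fun i j => (mfderivWithin I 𝓘(ℝ, ℂ) (fun y => (P y).entry i j) s x w : ℂ)

/-- The component of degree `2n` (used for `n ≥ 1`) of the Chern form of a map `P` from `s` to
the stage `(BU × ℤ)_{-N}^N`, that is, `(2πi)^{-n} (1/n!) Tr (P (dP)^{2n})`, where
`(dP)^{2n}(w_1, …, w_{2n}) = ∑_σ sgn(σ) dP(w_{σ 1}) ⋯ dP(w_{σ 2n})`. -/
def chern (N n : ℕ) (P : M → BUZ) (s : Set M) (x : M) (w : Fin (2 * n) → TangentSpace I x) : ℂ :=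
  1 / (2 * Real.pi * Complex.I) ^ n * (1 / (n.factorial : ℂ)) *
    ∑ σ : Equiv.Perm (Fin (2 * n)), ((Equiv.Perm.sign σ : ℤ) : ℂ) *
      (blockAt N (P x) *
        (List.ofFn fun i => dBlock I N P s x (w (σ i))).prod).trace

/-! ### Homotopies and Chern–Simons forms -/

/-- `M × [0, 1]`, as a subset of the manifold `M × ℝ`. -/
def cylinder (M : Type*) : Set (M × ℝ) := Set.univ ×ˢ Set.Icc 0 1

/-- `Γ` restricts to a smooth homotopy `M × [0, 1] → BU × ℤ` from `P` to `Q`. -/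
def IsHomotopy (Γ : M × ℝ → BUZ) (P Q : M → BUZ) : Prop :=
  IsSmoothOn (I.prod 𝓘(ℝ, ℝ)) Γ (cylinder M) ∧
    (∀ x, Γ (x, 0) = P x) ∧ ∀ x, Γ (x, 1) = Q x

/-- The least `N` such that `Γ` maps `M × [0, 1]` to `(BU × ℤ)_{-N}^N`. (Every larger `N`
gives the same forms of positive degree.) -/
def stage (Γ : M × ℝ → BUZ) : ℕ :=
  sInf {N : ℕ | ∀ y ∈ cylinder M, (Γ y).InStage (-(N : ℤ)) N}

/-- The component of degree `2n+1` of the Chern–Simons form `CS(Γ_t) = ∫_{t ∈ [0, 1]} Ch(Γ_t)`: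
the component of degree `2n+2` of the Chern form of `Γ` on `M × [0, 1]`, integrated over the
fibre `[0, 1]`. -/
def CS (Γ : M × ℝ → BUZ) (n : ℕ) (x : M) (v : Fin (2 * n + 1) → TangentSpace I x) : ℂ :=
  ∫ t in (0 : ℝ)..1,
    chern (I.prod 𝓘(ℝ, ℝ)) (stage Γ) (n + 1) Γ (cylinder M) (x, t)
      (Fin.cons (((0, 1) : E × ℝ)) (fun i => ((v i, 0) : E × ℝ)) : Fin (2 * n + 2) → E × ℝ)

/-- `P` and `Q` are connected by a smooth homotopy whose Chern–Simons form vanishes. -/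
def CSZeroHomotopic (P Q : M → BUZ) : Prop :=
  ∃ Γ : M × ℝ → BUZ, IsHomotopy I Γ P Q ∧ ∀ n x v, CS I Γ n x v = 0

/-- `P` and `Q` are `CS`-equivalent: they are connected by a smooth homotopy whose Chern–Simons
form is exact (in each degree). -/
def CSEquiv (P Q : M → BUZ) : Prop :=
  ∃ Γ : M × ℝ → BUZ, IsHomotopy I Γ P Q ∧ ∀ n, IsExact I (CS I Γ n)

end Forms

/-! ### The block sum `⊕` and the inverse `P^⊥` -/

/-- `R = P ⊕ Q` for maps `P, Q, R : M → BU × ℤ`: with respect to bounds `p, q` for `P` and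
`m, n` for `Q`, uniform on `M` (for instance the largest `p, m` and the least `q, n`), `R(x)` is
the projection onto `ℂ_{-∞}^{p+m} ⊕ s_m(V) ⊕ s_q(W)`, where `Im P(x) = ℂ_{-∞}^p ⊕ V`,
`V ⊆ ℂ_p^q`, and `Im Q(x) = ℂ_{-∞}^m ⊕ W`, `W ⊆ ℂ_m^n`. -/
def IsBlockSum {M : Type*} (P Q R : M → BUZ) : Prop :=
  ∃ p q m n : ℤ, (∀ x, (P x).InStage p q) ∧ (∀ x, (Q x).InStage m n) ∧
    ∀ x, LinearMap.range (R x).op = below (p + m)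
      ⊔ (LinearMap.range (P x).op ⊓ between p q).map (shift m)
      ⊔ (LinearMap.range (Q x).op ⊓ between m n).map (shift q)

/-- `R = P^⊥` for maps `P, R : M → BU × ℤ`: with respect to bounds `p, q` for `P`, uniform on
`M`, `R(x)` is the projection onto `ℂ_{-∞}^{-q} ⊕ s_{-p-q}(V^⊥)`, where
`Im P(x) = ℂ_{-∞}^p ⊕ V` and `V^⊥` is the orthogonal complement of `V` in `ℂ_p^q`. -/
def IsPerp {M : Type*} (P R : M → BUZ) : Prop :=
  ∃ p q : ℤ, (∀ x, (P x).InStage p q) ∧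
    ∀ x, ∃ Vperp : Submodule ℂ V,
      (∀ w, w ∈ Vperp ↔ w ∈ between p q ∧
        ∀ v ∈ LinearMap.range (P x).op ⊓ between p q, inn v w = 0) ∧
      LinearMap.range (R x).op = below (-q) ⊔ Vperp.map (shift (-p - q))

/-! ### Compact manifolds and `CS`-classes -/

/-- Compact smooth manifolds (boundary and corners allowed). -/
structure CompactMfd where
  E : Type u
  H : Type u
  M : Type u
  [normedE : NormedAddCommGroup E]
  [spaceE : NormedSpace ℝ E]
  [finE : FiniteDimensional ℝ E]
  [topH : TopologicalSpace H]
  I : ModelWithCorners ℝ E H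
  [topM : TopologicalSpace M]
  [charted : ChartedSpace H M]
  [smooth : IsManifold I ∞ M]
  [t2 : T2Space M]
  [compact : CompactSpace M]

attribute [instance] CompactMfd.normedE CompactMfd.spaceE CompactMfd.finE CompactMfd.topH
  CompactMfd.topM CompactMfd.charted CompactMfd.smooth CompactMfd.t2 CompactMfd.compact

/-- The category of compact smooth manifolds and smooth maps. -/
instance : Category CompactMfd.{u} where
  Hom X Y := ContMDiffMap X.I Y.I X.M Y.M ∞
  id _ := ContMDiffMap.id
  comp f g := g.comp f

/-- `Map(X, BU × ℤ)`. -/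
def Maps (X : CompactMfd.{u}) : Type u := {P : X.M → BUZ // IsSmooth X.I P}

/-- The pullback `P ∘ f`. -/
def Maps.pullback {X Y : CompactMfd.{u}} (f : X ⟶ Y) (P : Maps Y) : Maps X where
  val x := P.1 (f.1 x)
  property := ⟨P.2.1.imp fun _ h x _ => h _ trivial, fun i j =>
    (contMDiffOn_univ.1 (P.2.2 i j)).comp_contMDiffOn f.2.contMDiffOn⟩

/-- The set of `CS`-equivalence classes of maps `X → BU × ℤ`. -/
def KHat (X : CompactMfd.{u}) : Type u := Quot fun P Q : Maps X => CSEquiv X.I P.1 Q.1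

/-- The class `[P]`. -/
def KHat.mk {X : CompactMfd.{u}} (P : Maps X) : KHat X := Quot.mk _ P

end KTheory

end

open KTheory

noncomputable section

namespace KTheory

/-! ### The inner product -/

/-! All vanishing statements rest on one symmetry of traces. The Chern–Simons form integrates
alternating sums of traces `Tr (Γ dΓ ⋯ dΓ)` with one factor `∂_t Γ` and `2n+1` spatial factors. If
an involution `ε` commutes with `Γ` and passes each factor `dΓ(w_i)` up to a scalar `c_i` with `∏
c_i = -1`, then inserting `ε² = 1` and moving one `ε` around the trace shows that the trace equals
its negative (`altTrace_eq_zero`, `CS_eq_zero_of_involution`). This is applied in two ways.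

Moving by isometries: `Γ_t = U_t P U_t*` for a path of isometries, where `P` vanishes on a set `B`
of basis vectors and `D` is the projection onto the remaining ones. If the path is horizontal, that
is, `D U* U' D = 0`, then `ε = 2 U D U* - 1` commutes with `Γ` and with its spatial derivatives and
anticommutes with `∂_t Γ` (`IsoPath.isHomotopy_act`). Rotating `e_a` into `e_b` is horizontal as
soon as `P e_b = 0`. Such a free vector is produced by `shiftPath`, which pushes all `e_i` with `i ≥
K` to `e_{i+1}` by infinitely many rotations, the far ones before the near ones. With `e_K` free,
three rotations exchange `e_k` and `e_l`, and the shift is then undone (`isHomotopy_swapPath`).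
Since transpositions generate the finitely supported permutations, conjugation by any of these is a
homotopy with zero form (`CSZeroHomotopic.conj`). Both `P ⊕ Q` and `Q ⊞ P` are conjugates of `P ⊞ Q`
by such permutations (`IsBlockSum.exists_conj`, `boxplus_comm_conj`), which settles commutativity
and the comparison of the two sums.

Cancelling the complement: inside `P ⊞ P^⊥` the complement of `P` is rotated from the odd into the
even labels, where it fills up `P` to a constant flag. Here the reflection `2P - 1`, placed in both
summands, commutes with `Γ` and `∂_t Γ`, and anticommutes with every spatial derivative because `P²
= P`; the number of these is odd (`isHomotopy_tiltPath`). The remaining sum of opposite flags is a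
version of `I_0`.

For the group structure, Chern–Simons forms add under concatenation, change sign under reversal,
pull back along smooth maps and add under `⊞` (`isHomotopy_trans`, `isHomotopy_symm`,
`isHomotopy_comp`, `isHomotopy_boxplus`), while exact forms are closed under sums, negation and
pullback (`IsExact.comp`). Associativity comes from `⊕`, which is strictly associative for suitable
bounds (`IsBlockSum.assoc`). -/

lemma inn_single_left (i : ℤ) (a : ℂ) (y : V) :
    inn (Finsupp.single i a) y = (starRingEnd ℂ) a * y i := by
  simp [inn]

lemma inn_add_left (x y z : V) : inn (x + y) z = inn x z + inn y z :=
  Finsupp.sum_add_index' (by simp) (by intros; simp [add_mul])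

lemma inn_add_right (x y z : V) : inn x (y + z) = inn x y + inn x z := by
  simp [inn, mul_add, Finsupp.sum_add]

lemma inn_zero_left (y : V) : inn 0 y = 0 := by simp [inn]

lemma inn_zero_right (y : V) : inn y 0 = 0 := by simp [inn]

lemma inn_smul_left (c : ℂ) (x y : V) : inn (c • x) y = (starRingEnd ℂ) c * inn x y := by
  induction x using Finsupp.induction_linear with
  | zero => simp [inn_zero_left]
  | add f g hf hg => rw [smul_add, inn_add_left, hf, hg, inn_add_left, mul_add]
  | single i a => rw [Finsupp.smul_single, inn_single_left, inn_single_left]; simp [mul_assoc]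

lemma inn_smul_right (c : ℂ) (x y : V) : inn x (c • y) = c * inn x y := by
  simp only [inn, Finsupp.mul_sum, Finsupp.smul_apply, smul_eq_mul]
  exact Finsupp.sum_congr fun i _ => by ring

lemma inn_neg_right (x y : V) : inn x (-y) = -inn x y := by
  rw [← neg_one_smul ℂ, inn_smul_right, neg_one_mul]

lemma inn_sub_right (x y z : V) : inn x (y - z) = inn x y - inn x z := by
  rw [sub_eq_add_neg, inn_add_right, inn_neg_right, sub_eq_add_neg]

lemma inn_sub_left (x y z : V) : inn (x - y) z = inn x z - inn y z := by
  rw [sub_eq_add_neg, inn_add_left, ← neg_one_smul ℂ, inn_smul_left]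
  simp [sub_eq_add_neg]

lemma inn_single_right (x : V) (i : ℤ) (a : ℂ) :
    inn x (Finsupp.single i a) = (starRingEnd ℂ) (x i) * a := by
  induction x using Finsupp.induction_linear with
  | zero => simp [inn_zero_left]
  | add f g hf hg => rw [inn_add_left, hf, hg]; simp [add_mul]
  | single j b =>
    rw [inn_single_left, Finsupp.single_apply, Finsupp.single_apply]
    by_cases h : i = j
    · simp [h]
    · simp [h, Ne.symm h]

lemma inn_conj (x y : V) : (starRingEnd ℂ) (inn x y) = inn y x := by
  induction x using Finsupp.induction_linear with
  | zero => simp [inn_zero_left, inn_zero_right]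
  | add f g hf hg => rw [inn_add_left, map_add, hf, hg, inn_add_right]
  | single i a => rw [inn_single_left, inn_single_right]; simp [mul_comm]

lemma eq_of_inn_eq {x y : V} (h : ∀ z, inn z x = inn z y) : x = y := by
  ext i
  simpa [inn_single_left] using h (Finsupp.single i 1)

/-- Two endomorphisms that are formal adjoints of each other. -/
def IsAdj (A B : Module.End ℂ V) : Prop := ∀ x y, inn (A x) y = inn x (B y)

lemma IsAdj.symm {A B : Module.End ℂ V} (h : IsAdj A B) : IsAdj B A := fun x y => by
  rw [← inn_conj, ← h, inn_conj]

lemma IsAdj.mul {A B A' B' : Module.End ℂ V} (h : IsAdj A B) (h' : IsAdj A' B') :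
    IsAdj (A * A') (B' * B) := fun x y => by
  simp only [Module.End.mul_apply, h _ _, h' _ _]

lemma IsAdj.add {A B A' B' : Module.End ℂ V} (h : IsAdj A B) (h' : IsAdj A' B') :
    IsAdj (A + A') (B + B') := fun x y => by
  simp only [LinearMap.add_apply, inn_add_left, inn_add_right, h _ _, h' _ _]

lemma IsAdj.sub {A B A' B' : Module.End ℂ V} (h : IsAdj A B) (h' : IsAdj A' B') :
    IsAdj (A - A') (B - B') := fun x y => by
  simp only [LinearMap.sub_apply, inn_sub_left, inn_sub_right, h _ _, h' _ _]

lemma isAdj_of_entries {A B : Module.End ℂ V}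
    (h : ∀ i j, (starRingEnd ℂ) (A (Finsupp.single i 1) j) = B (Finsupp.single j 1) i) :
    IsAdj A B := by
  intro x y
  induction x using Finsupp.induction_linear with
  | zero => simp [inn_zero_left]
  | add f g hf hg => rw [map_add, inn_add_left, inn_add_left, hf, hg]
  | single i a =>
    induction y using Finsupp.induction_linear with
    | zero => simp [inn_zero_right]
    | add f g hf hg => rw [map_add, inn_add_right, inn_add_right, hf, hg]
    | single j b =>
      have hA : A (Finsupp.single i a) = a • A (Finsupp.single i 1) := by
        rw [← map_smul, Finsupp.smul_single, smul_eq_mul, mul_one]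
      have hB : B (Finsupp.single j b) = b • B (Finsupp.single j 1) := by
        rw [← map_smul, Finsupp.smul_single, smul_eq_mul, mul_one]
      rw [inn_single_right, inn_single_left, hA, hB]
      simp only [Finsupp.smul_apply, smul_eq_mul, map_mul, h]
      ring

/-! ### Relabeling -/

lemma relabel_single (σ : ℤ ≃ ℤ) (i : ℤ) (a : ℂ) :
    relabel σ (Finsupp.single i a) = Finsupp.single (σ i) a := by
  simp [relabel, Finsupp.domLCongr_apply, Finsupp.domCongr_apply]

lemma relabel_apply (σ : ℤ ≃ ℤ) (x : V) (i : ℤ) : relabel σ x i = x (σ.symm i) := by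
  simp [relabel, Finsupp.domLCongr_apply, Finsupp.domCongr_apply]

lemma relabel_mul (σ τ : Equiv.Perm ℤ) : relabel (σ * τ) = relabel σ * relabel τ := by
  refine LinearMap.ext fun x => Finsupp.ext fun i => ?_
  rw [Module.End.mul_apply, relabel_apply, relabel_apply, relabel_apply]
  rfl

lemma relabel_one : relabel (1 : Equiv.Perm ℤ) = 1 := by
  refine LinearMap.ext fun x => Finsupp.ext fun i => ?_
  rw [relabel_apply]
  rfl

lemma relabel_inv_mul (σ : Equiv.Perm ℤ) : relabel σ⁻¹ * relabel σ = 1 := by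
  rw [← relabel_mul, inv_mul_cancel, relabel_one]

lemma isAdj_relabel (σ : Equiv.Perm ℤ) : IsAdj (relabel σ) (relabel σ⁻¹) := by
  refine isAdj_of_entries fun i j => ?_
  rw [relabel_single, relabel_single, Finsupp.single_apply, Finsupp.single_apply]
  by_cases h : σ i = j
  · simp [← h]
  · rw [if_neg h, if_neg, map_zero]
    rintro rfl
    simp at h

/-! ### Entries and stages -/

lemma BUZ.isAdj (P : BUZ) : IsAdj P.op P.op := P.hermitian

lemma BUZ.idem_apply (P : BUZ) (x : V) : P.op (P.op x) = P.op x :=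
  LinearMap.congr_fun P.idem x

lemma BUZ.mem_range (P : BUZ) (x : V) : x ∈ LinearMap.range P.op ↔ P.op x = x :=
  ⟨by rintro ⟨y, rfl⟩; exact P.idem_apply y, fun h => ⟨x, h⟩⟩

lemma BUZ.entry_conj (P : BUZ) (i j : ℤ) : (starRingEnd ℂ) (P.entry i j) = P.entry j i := by
  have h := P.hermitian (Finsupp.single j 1) (Finsupp.single i 1)
  rw [inn_single_left, inn_single_right] at h
  simpa [BUZ.entry] using h

lemma end_ext {A B : Module.End ℂ V}
    (h : ∀ i, A (Finsupp.single i 1) = B (Finsupp.single i 1)) : A = B :=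
  Finsupp.lhom_ext' fun i => LinearMap.ext_ring (h i)

lemma BUZ.ext_entry {P Q : BUZ} (h : ∀ i j, P.entry i j = Q.entry i j) : P = Q :=
  BUZ.ext (end_ext fun j => Finsupp.ext fun i => h i j)

/-- Hermitian projections are determined by their ranges. -/
lemma BUZ.ext_range {P Q : BUZ} (h : LinearMap.range P.op = LinearMap.range Q.op) : P = Q := by
  refine BUZ.ext (LinearMap.ext fun x => eq_of_inn_eq fun y => ?_)
  have h1 : Q.op (P.op y) = P.op y := (Q.mem_range _).1 (h ▸ ⟨y, rfl⟩)
  have h2 : P.op (Q.op x) = Q.op x := (P.mem_range _).1 (h ▸ ⟨x, rfl⟩)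
  rw [← P.hermitian, ← h1, Q.hermitian, P.hermitian, h2]

lemma mem_below {q : ℤ} {x : V} : x ∈ below q ↔ ∀ i, q ≤ i → x i = 0 := by
  rw [below, Finsupp.mem_supported']
  simp

lemma mem_between {p q : ℤ} {x : V} : x ∈ between p q ↔ ∀ i, (i < p ∨ q ≤ i) → x i = 0 := by
  rw [between, Finsupp.mem_supported']
  refine forall_congr' fun i => ?_
  simp only [Set.mem_Ico, not_and_or, not_le, not_lt]

lemma single_mem_below {q i : ℤ} (h : i < q) (a : ℂ) : Finsupp.single i a ∈ below q := by
  rw [mem_below]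
  intro j hj
  rw [Finsupp.single_apply, if_neg (by omega)]

lemma below_le_iff {q : ℤ} {W : Submodule ℂ V} :
    below q ≤ W ↔ ∀ i < q, Finsupp.single i (1 : ℂ) ∈ W := by
  rw [below, Finsupp.supported_eq_span_single, Submodule.span_le]
  constructor
  · exact fun h i hi => h ⟨i, hi, rfl⟩
  · rintro h _ ⟨i, hi, rfl⟩
    exact h i hi

lemma between_le_iff {p q : ℤ} {W : Submodule ℂ V} :
    between p q ≤ W ↔ ∀ i, p ≤ i → i < q → Finsupp.single i (1 : ℂ) ∈ W := by
  rw [between, Finsupp.supported_eq_span_single, Submodule.span_le]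
  constructor
  · exact fun h i hi hi' => h ⟨i, ⟨hi, hi'⟩, rfl⟩
  · rintro h _ ⟨i, hi, rfl⟩
    exact h i hi.1 hi.2

/-- The upper bound dualizes because `P` is self-adjoint: the range avoids the label `i` exactly
when `P` kills `e_i`. Stages can thus be checked on basis vectors. -/
lemma BUZ.inStage_iff (P : BUZ) (p q : ℤ) :
    P.InStage p q ↔ (∀ i < p, P.op (Finsupp.single i 1) = Finsupp.single i 1) ∧
      ∀ i, q ≤ i → P.op (Finsupp.single i 1) = 0 := by
  refine and_congr ?_ ?_
  · rw [below_le_iff]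
    exact forall_congr' fun i => forall_congr' fun _ => P.mem_range _
  · constructor
    · intro h i hi
      ext j
      have h1 : P.entry i j = 0 := mem_below.1 (h ⟨_, rfl⟩) i hi
      have h2 := P.entry_conj i j
      rw [h1, map_zero] at h2
      exact h2.symm
    · rintro h _ ⟨x, rfl⟩
      rw [mem_below]
      intro i hi
      have h1 := P.hermitian (Finsupp.single i 1) x
      rw [h i hi, inn_zero_left, inn_single_left] at h1
      simpa using h1.symm

lemma BUZ.InStage.op_low {P : BUZ} {p q : ℤ} (h : P.InStage p q) {i : ℤ} (hi : i < p) :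
    P.op (Finsupp.single i 1) = Finsupp.single i 1 := ((P.inStage_iff p q).1 h).1 i hi

lemma BUZ.InStage.op_high {P : BUZ} {p q : ℤ} (h : P.InStage p q) {i : ℤ} (hi : q ≤ i) :
    P.op (Finsupp.single i 1) = 0 := ((P.inStage_iff p q).1 h).2 i hi

lemma BUZ.InStage.entry_low {P : BUZ} {p q : ℤ} (h : P.InStage p q) {i j : ℤ}
    (hi : i < p ∨ j < p) : P.entry i j = if i = j then 1 else 0 := by
  have key : ∀ i j, j < p → P.entry i j = if i = j then 1 else 0 := fun i j hj => by
    rw [BUZ.entry, h.op_low hj, Finsupp.single_apply]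
    simp [eq_comm]
  rcases hi with hi | hj
  · rw [← P.entry_conj, key _ _ hi]
    by_cases hij : i = j
    · simp [hij]
    · rw [if_neg hij, if_neg (Ne.symm hij), map_zero]
  · exact key _ _ hj

lemma BUZ.InStage.entry_high {P : BUZ} {p q : ℤ} (h : P.InStage p q) {i j : ℤ}
    (hi : q ≤ i ∨ q ≤ j) : P.entry i j = 0 := by
  have key : ∀ i j, q ≤ j → P.entry i j = 0 := fun i j hj => by
    rw [BUZ.entry, h.op_high hj, Finsupp.zero_apply]
  rcases hi with hi | hj
  · rw [← P.entry_conj, key _ _ hi, map_zero]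
  · exact key _ _ hj

lemma BUZ.InStage.le {P : BUZ} {p q : ℤ} (h : P.InStage p q) : p ≤ q := by
  by_contra hlt
  have h1 := h.op_low (i := q) (by omega)
  rw [h.op_high le_rfl] at h1
  have h2 := DFunLike.congr_fun h1 q
  rw [Finsupp.single_eq_same] at h2
  exact zero_ne_one h2

lemma BUZ.InStage.mono {P : BUZ} {p q p' q' : ℤ} (h : P.InStage p q) (hp : p' ≤ p)
    (hq : q ≤ q') : P.InStage p' q' := by
  rw [BUZ.inStage_iff]
  exact ⟨fun i hi => h.op_low (by omega), fun i hi => h.op_high (by omega)⟩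

lemma I0op_single (i : ℤ) (a : ℂ) :
    I0op (Finsupp.single i a) = if i < 0 then Finsupp.single i a else 0 := by
  ext j
  rw [I0op_apply, Finsupp.single_apply]
  by_cases hij : i = j
  · subst hij
    by_cases hi : i < 0 <;> simp [hi]
  · by_cases hi : i < 0 <;> simp [hi, hij]

/-- An endomorphism that kills all but finitely many basis vectors has finite rank. -/
lemma finiteDimensional_range (T : Module.End ℂ V) (S : Set ℤ) (hS : S.Finite)
    (h : ∀ i ∉ S, T (Finsupp.single i 1) = 0) : FiniteDimensional ℂ (LinearMap.range T) := by
  have hfin : ((fun i => T (Finsupp.single i 1)) '' S).Finite := hS.image _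
  have : FiniteDimensional ℂ (Submodule.span ℂ ((fun i => T (Finsupp.single i 1)) '' S)) :=
    FiniteDimensional.span_of_finite ℂ hfin
  refine Submodule.finiteDimensional_of_le
    (S₂ := Submodule.span ℂ ((fun i => T (Finsupp.single i 1)) '' S)) ?_
  rintro _ ⟨x, rfl⟩
  induction x using Finsupp.induction_linear with
  | zero => simp
  | add f g hf hg => rw [map_add]; exact add_mem hf hg
  | single i a =>
    have ha : T (Finsupp.single i a) = a • T (Finsupp.single i 1) := by
      rw [← map_smul, Finsupp.smul_single, smul_eq_mul, mul_one]
    rw [ha]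
    refine Submodule.smul_mem _ _ ?_
    by_cases hi : i ∈ S
    · exact Submodule.subset_span ⟨i, hi, rfl⟩
    · rw [h i hi]; exact zero_mem _

/-- A Hermitian projection that agrees with `I_0` on all but finitely many basis vectors. -/
def BUZ.ofStage (A : Module.End ℂ V) (hA : IsAdj A A) (hi : A * A = A) (p q : ℤ)
    (hp : ∀ i < p, A (Finsupp.single i 1) = Finsupp.single i 1)
    (hq : ∀ i, q ≤ i → A (Finsupp.single i 1) = 0) : BUZ where
  op := A
  hermitian := hA
  idem := hi
  finite_rank := by
    refine finiteDimensional_range _ (Set.Ico (min p 0) (max q 0)) (Set.finite_Ico _ _) ?_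
    intro i hi
    rw [Set.mem_Ico, not_and_or, not_le, not_lt] at hi
    change A _ - I0op _ = 0
    rw [I0op_single]
    rcases hi with hi | hi
    · rw [hp i (by omega), if_pos (by omega), sub_self]
    · rw [hq i (by omega), if_neg (by omega), sub_self]

lemma BUZ.ofStage_inStage (A : Module.End ℂ V) (hA hi p q hp hq) :
    (BUZ.ofStage A hA hi p q hp hq).InStage p q :=
  (BUZ.inStage_iff _ _ _).2 ⟨hp, hq⟩

lemma I0_inStage : I0.InStage 0 0 := by
  rw [BUZ.inStage_iff]
  refine ⟨fun i hi => ?_, fun i hi => ?_⟩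
  · change I0op _ = _
    rw [I0op_single, if_pos hi]
  · change I0op _ = _
    rw [I0op_single, if_neg (by omega)]

/-! ### Conjugation by finitely supported permutations -/

/-- The conjugate of `P` by a finitely supported permutation of the basis. -/
def BUZ.conj (σ : Equiv.Perm ℤ) (h : {i | σ i ≠ i}.Finite) (P : BUZ) : BUZ where
  op := relabel σ * P.op * relabel σ⁻¹
  hermitian := by
    have := ((isAdj_relabel σ).mul P.isAdj).mul (isAdj_relabel σ⁻¹)
    rwa [inv_inv, ← mul_assoc] at this
  idem := by
    have h1 := relabel_inv_mul σ
    calc relabel σ * P.op * relabel σ⁻¹ * (relabel σ * P.op * relabel σ⁻¹)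
        = relabel σ * P.op * (relabel σ⁻¹ * relabel σ) * P.op * relabel σ⁻¹ := by
          simp only [mul_assoc]
      _ = _ := by rw [h1, mul_one, mul_assoc (relabel σ), P.idem]
  finite_rank := by
    -- The second summand is nonzero only on the finitely many basis vectors moved by `σ`.
    have e : relabel σ * P.op * relabel σ⁻¹ - I0op = relabel σ * (P.op - I0op) * relabel σ⁻¹ +
        (relabel σ * I0op * relabel σ⁻¹ - I0op) := by
      rw [mul_sub (relabel σ), sub_mul (relabel σ * P.op)]
      exact (sub_add_sub_cancel (G := V →ₗ[ℂ] V) _ _ _).symm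
    have h1 : FiniteDimensional ℂ
        (LinearMap.range (relabel σ * (P.op - I0op) * relabel σ⁻¹)) := by
      have hP := P.finite_rank
      have : FiniteDimensional ℂ ((LinearMap.range (P.op - I0op)).map (relabel σ)) :=
        inferInstance
      refine Submodule.finiteDimensional_of_le
        (S₂ := (LinearMap.range (P.op - I0op)).map (relabel σ)) ?_
      rintro _ ⟨x, rfl⟩
      exact ⟨_, ⟨relabel σ⁻¹ x, rfl⟩, rfl⟩
    have h2 : FiniteDimensional ℂ
        (LinearMap.range (relabel σ * I0op * relabel σ⁻¹ - I0op)) := by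
      refine finiteDimensional_range _ _ h fun i hi => ?_
      have hi' : σ i = i := by simpa using hi
      have hi'' : σ⁻¹ i = i := by rw [Equiv.Perm.inv_eq_iff_eq, hi']
      change relabel σ (I0op (relabel σ⁻¹ _)) - I0op _ = 0
      rw [relabel_single, hi'', I0op_single]
      split_ifs
      · rw [relabel_single, hi', sub_self]
      · rw [map_zero, sub_self]
    rw [e]
    exact Submodule.finiteDimensional_of_le (LinearMap.range_add_le _ _)

lemma BUZ.conj_entry (σ : Equiv.Perm ℤ) (h) (P : BUZ) (i j : ℤ) :
    (P.conj σ h).entry i j = P.entry (σ⁻¹ i) (σ⁻¹ j) := by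
  change relabel σ (P.op (relabel σ⁻¹ _)) i = _
  rw [relabel_apply, relabel_single]
  rfl

/-! ### Entries of the shuffle sum -/

/-- In matrix terms the shuffle sum is block diagonal for the parity of the labels. Its stages, its
smoothness, its commutativity and its Chern form are all read off from this formula. -/
lemma boxplus_entry (P Q : BUZ) (i j : ℤ) : (boxplus P Q).entry i j =
    if i % 2 = 0 then (if j % 2 = 0 then P.entry (i / 2) (j / 2) else 0)
    else (if j % 2 = 0 then 0 else Q.entry (i / 2) (j / 2)) := by
  have h := shuffle_boxplusOp P.op Q.op (Finsupp.single j 1)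
  have h1 : (shuffle (Finsupp.single j (1 : ℂ))).1 =
      if j % 2 = 0 then Finsupp.single (j / 2) 1 else 0 := by
    ext k
    rw [shuffle_fst, Finsupp.single_apply]
    split_ifs with h1 h2 h2
    · rw [Finsupp.single_apply, if_pos (by omega)]
    · omega
    · rw [Finsupp.single_apply, if_neg (by omega)]
    · rfl
  have h2 : (shuffle (Finsupp.single j (1 : ℂ))).2 =
      if j % 2 = 0 then 0 else Finsupp.single (j / 2) 1 := by
    ext k
    rw [shuffle_snd, Finsupp.single_apply]
    split_ifs with h1 h2 h2
    · omega
    · rw [Finsupp.single_apply, if_pos (by omega)]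
    · rfl
    · rw [Finsupp.single_apply, if_neg (by omega)]
  rw [h1, h2] at h
  have e1 := fun k => congrArg (fun z : V × V => z.1 k) h
  have e2 := fun k => congrArg (fun z : V × V => z.2 k) h
  simp only [shuffle_fst, shuffle_snd] at e1 e2
  change boxplusOp P.op Q.op _ i = _
  by_cases hi : i % 2 = 0
  · have hi2 : 2 * (i / 2) = i := by omega
    rw [if_pos hi]
    have := e1 (i / 2)
    rw [hi2] at this
    rw [this]
    split_ifs
    · rfl
    · simp
  · have hi2 : 2 * (i / 2) + 1 = i := by omega
    rw [if_neg hi]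
    have := e2 (i / 2)
    rw [hi2] at this
    rw [this]
    split_ifs
    · simp
    · rfl

lemma BUZ.inStage_iff_entry (P : BUZ) (p q : ℤ) :
    P.InStage p q ↔ (∀ i j, j < p → P.entry i j = if i = j then 1 else 0) ∧
      ∀ i j, q ≤ j → P.entry i j = 0 := by
  refine ⟨fun h => ⟨fun i j hj => h.entry_low (Or.inr hj), fun i j hj =>
    h.entry_high (Or.inr hj)⟩, fun h => (P.inStage_iff p q).2 ⟨fun j hj => ?_, fun j hj => ?_⟩⟩
  · ext i
    have := h.1 i j hj
    rw [BUZ.entry] at this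
    rw [this, Finsupp.single_apply]
    simp [eq_comm]
  · ext i
    exact h.2 i j hj

lemma boxplus_inStage {P Q : BUZ} {p q m n : ℤ} (hP : P.InStage p q) (hQ : Q.InStage m n) :
    (boxplus P Q).InStage (2 * min p m) (2 * max q n) := by
  rw [BUZ.inStage_iff_entry]
  refine ⟨fun i j hj => ?_, fun i j hj => ?_⟩
  · rw [boxplus_entry]
    split_ifs with h1 h2 h3 h3 h3 h3 h3
    · rw [hP.entry_low (Or.inr (by omega)), if_pos (by omega)]
    · rw [hP.entry_low (Or.inr (by omega)), if_neg (by omega)]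
    · omega
    · rfl
    · omega
    · rfl
    · rw [hQ.entry_low (Or.inr (by omega)), if_pos (by omega)]
    · rw [hQ.entry_low (Or.inr (by omega)), if_neg (by omega)]
  · rw [boxplus_entry]
    split_ifs
    · exact hP.entry_high (Or.inr (by omega))
    · rfl
    · rfl
    · exact hQ.entry_high (Or.inr (by omega))

/-! ### Alternating traces of products of matrices -/

section AltTrace

variable {ι κ : Type*} [Fintype ι] [DecidableEq ι] [Fintype κ] [DecidableEq κ] {m : ℕ}

/-- `∑_σ sgn(σ) Tr (A B_{σ 1} ⋯ B_{σ m})`. -/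
def altTrace (A : Matrix ι ι ℂ) (B : Fin m → Matrix ι ι ℂ) : ℂ :=
  ∑ σ : Equiv.Perm (Fin m), ((Equiv.Perm.sign σ : ℤ) : ℂ) *
    (A * (List.ofFn fun i => B (σ i)).prod).trace

lemma mul_list_prod_of_comm (ε : Matrix ι ι ℂ) (c : Fin m → ℂ) (B : Fin m → Matrix ι ι ℂ)
    (hB : ∀ i, ε * B i = c i • (B i * ε)) (l : List (Fin m)) :
    ε * (l.map B).prod = (l.map c).prod • ((l.map B).prod * ε) := by
  induction l with
  | nil => simp
  | cons i l ih =>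
    rw [List.map_cons, List.prod_cons, List.map_cons, List.prod_cons, ← mul_assoc, hB,
      Matrix.smul_mul, mul_assoc, ih, Matrix.mul_smul, smul_smul, mul_assoc]

/-- The alternating trace vanishes in the presence of an involution that commutes with all
factors up to scalars whose product is `-1`. -/
lemma altTrace_eq_zero (A : Matrix ι ι ℂ) (B : Fin m → Matrix ι ι ℂ) (ε : Matrix ι ι ℂ)
    (hε : ε * ε = 1) (hA : ε * A = A * ε) (c : Fin m → ℂ)
    (hB : ∀ i, ε * B i = c i • (B i * ε)) (hc : ∏ i, c i = -1) : altTrace A B = 0 := by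
  refine Finset.sum_eq_zero fun σ _ => ?_
  -- Each permuted product contains every factor once, so the total scalar is `∏ c_i = -1` for every
  -- `σ`, and already the single traces vanish.
  have key : (A * (List.ofFn fun i => B (σ i)).prod).trace =
      -(A * (List.ofFn fun i => B (σ i)).prod).trace := by
    have h := mul_list_prod_of_comm ε (fun i => c (σ i)) (fun i => B (σ i)) (fun i => hB _)
      (List.finRange m)
    rw [← List.ofFn_eq_map, ← List.ofFn_eq_map, List.prod_ofFn,
      Equiv.prod_comp σ c, hc, neg_one_smul] at h
    set X := (List.ofFn fun i => B (σ i)).prod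
    calc (A * X).trace = (ε * ε * (A * X)).trace := by rw [hε, one_mul]
      _ = (ε * (A * X) * ε).trace := by rw [mul_assoc, Matrix.trace_mul_comm]
      _ = (A * (ε * X) * ε).trace := by rw [← mul_assoc ε A, hA, mul_assoc A ε]
      _ = -(A * X * (ε * ε)).trace := by
        rw [h, Matrix.mul_neg, Matrix.neg_mul, Matrix.trace_neg]
        simp only [mul_assoc]
      _ = _ := by rw [hε, mul_one]
  have : (A * (List.ofFn fun i => B (σ i)).prod).trace = 0 := by linear_combination key / 2
  rw [this, mul_zero]

lemma list_prod_smul (c : Fin m → ℂ) (B : Fin m → Matrix ι ι ℂ) (l : List (Fin m)) :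
    (l.map fun i => c i • B i).prod = (l.map c).prod • (l.map B).prod := by
  induction l with
  | nil => simp
  | cons i l ih =>
    simp only [List.map_cons, List.prod_cons, ih, Matrix.smul_mul, Matrix.mul_smul, smul_smul]
    rw [mul_comm]

/-- Each permutation uses every factor exactly once, so the scalars come out as a product. It serves
to scale the time slot alone, with all other scalars equal to `1`. -/
lemma altTrace_smul (A : Matrix ι ι ℂ) (c : Fin m → ℂ) (B : Fin m → Matrix ι ι ℂ) :
    altTrace A (fun i => c i • B i) = (∏ i, c i) * altTrace A B := by
  rw [altTrace, altTrace, Finset.mul_sum]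
  refine Finset.sum_congr rfl fun σ _ => ?_
  rw [List.ofFn_eq_map, list_prod_smul (fun i => c (σ i)) (fun i => B (σ i)), ← List.ofFn_eq_map,
    ← List.ofFn_eq_map, List.prod_ofFn, Equiv.prod_comp σ c, Matrix.mul_smul, Matrix.trace_smul,
    smul_eq_mul]
  ring

/-- The inner pairs `F * E` cancel. The list has to be nonempty: the empty product is `1`, whereas
`E * F` is in general only a projection. This is why the degree-zero part of the Chern form depends
on the block size and the higher parts do not. -/
lemma list_prod_conj (E : Matrix κ ι ℂ) (F : Matrix ι κ ℂ) (h : F * E = 1)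
    (B : Fin m → Matrix ι ι ℂ) (l : List (Fin m)) (hl : l ≠ []) :
    (l.map fun i => E * B i * F).prod = E * (l.map B).prod * F := by
  induction l with
  | nil => exact absurd rfl hl
  | cons i l ih =>
    rcases l with _ | ⟨j, l⟩
    · simp
    · rw [List.map_cons, List.prod_cons, ih (by simp), List.map_cons, List.prod_cons]
      calc E * B i * F * (E * (List.map B (j :: l)).prod * F)
          = E * B i * (F * E) * (List.map B (j :: l)).prod * F := by simp only [Matrix.mul_assoc]
        _ = _ := by
          rw [h, Matrix.mul_one, List.map_cons (l := j :: l), List.prod_cons (l := List.map B (j :: l))]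
          simp only [Matrix.mul_assoc]

lemma altTrace_conj (E : Matrix κ ι ℂ) (F : Matrix ι κ ℂ) (h : F * E = 1)
    (A : Matrix κ κ ℂ) (B : Fin (m + 1) → Matrix ι ι ℂ) :
    altTrace A (fun i => E * B i * F) = altTrace (F * A * E) B := by
  refine Finset.sum_congr rfl fun σ _ => ?_
  rw [List.ofFn_eq_map, list_prod_conj E F h (fun i => B (σ i)) _ (by simp), List.ofFn_eq_map]
  congr 1
  rw [← Matrix.mul_assoc, ← Matrix.mul_assoc, Matrix.trace_mul_comm]
  simp only [Matrix.mul_assoc]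

/-- The alternating trace only depends on the submatrices on a set of labels outside of which the
factors `B_i` vanish. -/
lemma altTrace_submatrix (g : ι → κ) (hg : Function.Injective g) (A : Matrix κ κ ℂ)
    (B : Fin (m + 1) → Matrix κ κ ℂ)
    (hB : ∀ i a b, (a ∉ Set.range g ∨ b ∉ Set.range g) → B i a b = 0) :
    altTrace A B = altTrace (A.submatrix g g) fun i => (B i).submatrix g g := by
  -- `E` and `F` are the inclusion of the labels in the image of `g` and the restriction to them.
  let E : Matrix κ ι ℂ := (1 : Matrix κ κ ℂ).submatrix id g
  let F : Matrix ι κ ℂ := (1 : Matrix κ κ ℂ).submatrix g id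
  have hX : ∀ X : Matrix κ κ ℂ, F * X * E = X.submatrix g g := fun X => by
    ext i j
    simp [E, F, Matrix.mul_apply, Matrix.one_apply]
  have hFE : F * E = 1 := by
    ext i j
    simp [E, F, Matrix.mul_apply, Matrix.one_apply, hg.eq_iff]
  have hB' : B = fun i => E * (B i).submatrix g g * F := by
    funext i
    ext a b
    simp only [E, F, Matrix.mul_apply, Matrix.submatrix_apply, Matrix.one_apply, id]
    by_cases ha : a ∈ Set.range g
    · by_cases hb : b ∈ Set.range g
      · obtain ⟨a, rfl⟩ := ha
        obtain ⟨b, rfl⟩ := hb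
        simp [hg.eq_iff]
      · rw [hB i a b (Or.inr hb)]
        refine (Finset.sum_eq_zero fun j _ => ?_).symm
        rw [if_neg (fun h => hb ⟨j, h⟩), mul_zero]
    · rw [hB i a b (Or.inl ha)]
      refine (Finset.sum_eq_zero fun j _ => ?_).symm
      rw [Finset.sum_eq_zero, zero_mul]
      intro j _
      rw [if_neg (fun h => ha ⟨j, h.symm⟩), zero_mul]
  conv_lhs => rw [hB']
  rw [altTrace_conj E F hFE, hX]

lemma list_prod_fromBlocks (B : Fin m → Matrix ι ι ℂ) (B' : Fin m → Matrix κ κ ℂ)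
    (l : List (Fin m)) : (l.map fun i => Matrix.fromBlocks (B i) 0 0 (B' i)).prod =
      Matrix.fromBlocks (l.map B).prod 0 0 (l.map B').prod := by
  induction l with
  | nil => simp [Matrix.fromBlocks_one]
  | cons i l ih => simp [ih, Matrix.fromBlocks_multiply]

lemma altTrace_fromBlocks (A : Matrix ι ι ℂ) (A' : Matrix κ κ ℂ) (B : Fin m → Matrix ι ι ℂ)
    (B' : Fin m → Matrix κ κ ℂ) :
    altTrace (Matrix.fromBlocks A 0 0 A') (fun i => Matrix.fromBlocks (B i) 0 0 (B' i)) =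
      altTrace A B + altTrace A' B' := by
  rw [altTrace, altTrace, altTrace, ← Finset.sum_add_distrib]
  refine Finset.sum_congr rfl fun σ _ => ?_
  rw [List.ofFn_eq_map, list_prod_fromBlocks (fun i => B (σ i)) (fun i => B' (σ i)),
    List.ofFn_eq_map, List.ofFn_eq_map, Matrix.fromBlocks_multiply]
  simp [mul_add, Matrix.trace, Matrix.diag]

end AltTrace

/-! ### Derivatives of complex and matrix valued functions -/

section Deriv

variable {E : Type*} [NormedAddCommGroup E] [NormedSpace ℝ E] {H : Type*} [TopologicalSpace H]
  {I : ModelWithCorners ℝ E H} {M : Type*} [TopologicalSpace M] [ChartedSpace H M]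
  {E' : Type*} [NormedAddCommGroup E'] [NormedSpace ℝ E'] {H' : Type*} [TopologicalSpace H']
  {I' : ModelWithCorners ℝ E' H'} {M' : Type*} [TopologicalSpace M'] [ChartedSpace H' M']
  {ι κ l : Type*}

variable (I) in
/-- The derivative of a complex valued function in the direction of a tangent vector. -/
def dS (f : M → ℂ) (s : Set M) (x : M) (w : TangentSpace I x) : ℂ :=
  (mfderivWithin I 𝓘(ℝ, ℂ) f s x w : ℂ)

lemma dS_congr {f g : M → ℂ} {s : Set M} {x : M} (w : TangentSpace I x) (hx : x ∈ s)
    (h : ∀ y ∈ s, f y = g y) : dS I f s x w = dS I g s x w :=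
  congrArg (fun L : E →L[ℝ] ℂ => L w) (mfderivWithin_congr_of_mem (I := I) (I' := 𝓘(ℝ, ℂ)) h hx)

lemma dS_congr_nhds {f g : M → ℂ} {s : Set M} {x : M} (w : TangentSpace I x) (hx : x ∈ s)
    (h : f =ᶠ[nhdsWithin x s] g) : dS I f s x w = dS I g s x w :=
  congrArg (fun L : E →L[ℝ] ℂ => L w)
    (Filter.EventuallyEq.mfderivWithin_eq_of_mem (I := I) (I' := 𝓘(ℝ, ℂ)) h hx)

lemma dS_const (c : ℂ) (s : Set M) (x : M) (w : TangentSpace I x) :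
    dS I (fun _ => c) s x w = 0 := by
  rw [dS, mfderivWithin_const]
  rfl

lemma dS_const_on {f : M → ℂ} {s : Set M} {x : M} (w : TangentSpace I x) (hx : x ∈ s) (c : ℂ)
    (h : ∀ y ∈ s, f y = c) : dS I f s x w = 0 := by
  rw [dS_congr w hx h, dS_const]

variable (I) in
/-- Differentiability of a complex valued function. -/
abbrev MD (f : M → ℂ) (s : Set M) (x : M) : Prop := MDifferentiableWithinAt I 𝓘(ℝ, ℂ) f s x

lemma dS_add {f g : M → ℂ} {s : Set M} {x : M} (hs : UniqueMDiffWithinAt I s x)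
    (hf : MD I f s x) (hg : MD I g s x) (w : TangentSpace I x) :
    dS I (fun y => f y + g y) s x w = dS I f s x w + dS I g s x w :=
  congrArg (fun L : E →L[ℝ] ℂ => L w)
    ((hf.hasMFDerivWithinAt.add hg.hasMFDerivWithinAt).mfderivWithin hs)

lemma dS_mul {f g : M → ℂ} {s : Set M} {x : M} (hs : UniqueMDiffWithinAt I s x)
    (hf : MD I f s x) (hg : MD I g s x) (w : TangentSpace I x) :
    dS I (fun y => f y * g y) s x w = dS I f s x w * g x + f x * dS I g s x w := by
  have h : dS I (fun y => f y * g y) s x w = f x * dS I g s x w + g x * dS I f s x w :=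
    congrArg (fun L : E →L[ℝ] ℂ => L w)
      ((hf.hasMFDerivWithinAt.mul hg.hasMFDerivWithinAt).mfderivWithin hs)
  rw [h]
  ring

lemma MD.mul {f g : M → ℂ} {s : Set M} {x : M} (hf : MD I f s x) (hg : MD I g s x) :
    MD I (fun y => f y * g y) s x := MDifferentiableWithinAt.mul hf hg

lemma MD.add {f g : M → ℂ} {s : Set M} {x : M} (hf : MD I f s x) (hg : MD I g s x) :
    MD I (fun y => f y + g y) s x := MDifferentiableWithinAt.add hf hg

lemma MD.sum {α : Type*} {t : Finset α} {f : α → M → ℂ} {s : Set M} {x : M}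
    (hf : ∀ a ∈ t, MD I (f a) s x) : MD I (fun y => ∑ a ∈ t, f a y) s x := by
  classical
  induction t using Finset.induction_on with
  | empty => simpa using mdifferentiableWithinAt_const
  | insert a t ha ih =>
    simp only [Finset.sum_insert ha]
    exact MD.add (hf a (Finset.mem_insert_self _ _))
      (ih fun b hb => hf b (Finset.mem_insert_of_mem hb))

lemma dS_sum {α : Type*} {t : Finset α} {f : α → M → ℂ} {s : Set M} {x : M}
    (hs : UniqueMDiffWithinAt I s x) (hf : ∀ a ∈ t, MD I (f a) s x) (w : TangentSpace I x) :
    dS I (fun y => ∑ a ∈ t, f a y) s x w = ∑ a ∈ t, dS I (f a) s x w := by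
  classical
  induction t using Finset.induction_on with
  | empty => simpa using dS_const 0 s x w
  | insert a t ha ih =>
    rw [Finset.sum_insert ha, ← ih fun b hb => hf b (Finset.mem_insert_of_mem hb)]
    rw [← dS_add hs (hf a (Finset.mem_insert_self _ _))
      (MD.sum fun b hb => hf b (Finset.mem_insert_of_mem hb))]
    congr 1
    funext y
    rw [Finset.sum_insert ha]

lemma dS_comp {f : M' → ℂ} {Φ : M → M'} {s : Set M} {s' : Set M'} {x : M}
    (hs : UniqueMDiffWithinAt I s x) (hf : MD I' f s' (Φ x))
    (hΦ : MDifferentiableWithinAt I I' Φ s x) (hm : Set.MapsTo Φ s s') (w : TangentSpace I x) :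
    dS I (fun y => f (Φ y)) s x w = dS I' f s' (Φ x) (mfderivWithin I I' Φ s x w) := by
  have := mfderivWithin_comp (I := I) (I' := I') (I'' := 𝓘(ℝ, ℂ)) x hf hΦ hm hs
  exact congrArg (fun L : E →L[ℝ] ℂ => L w) this

variable (I) in
/-- The entrywise derivative of a matrix valued function. -/
def dM (F : M → Matrix ι κ ℂ) (s : Set M) (x : M) (w : TangentSpace I x) : Matrix ι κ ℂ :=
  Matrix.of fun i j => dS I (fun y => F y i j) s x w

variable (I) in
/-- Entrywise differentiability of a matrix valued function. -/
def MDM (F : M → Matrix ι κ ℂ) (s : Set M) (x : M) : Prop :=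
  ∀ i j, MD I (fun y => F y i j) s x

lemma MDM.mul [Fintype κ] {F : M → Matrix ι κ ℂ} {G : M → Matrix κ l ℂ} {s : Set M} {x : M}
    (hF : MDM I F s x) (hG : MDM I G s x) : MDM I (fun y => F y * G y) s x := fun i j => by
  simp only [Matrix.mul_apply]
  exact MD.sum fun a _ => MD.mul (hF i a) (hG a j)

lemma dM_const (A : Matrix ι κ ℂ) (s : Set M) (x : M) (w : TangentSpace I x) :
    dM I (fun _ => A) s x w = 0 := by
  ext i j
  exact dS_const _ s x w

lemma dM_mul [Fintype κ] {F : M → Matrix ι κ ℂ} {G : M → Matrix κ l ℂ} {s : Set M} {x : M}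
    (hs : UniqueMDiffWithinAt I s x) (hF : MDM I F s x) (hG : MDM I G s x)
    (w : TangentSpace I x) :
    dM I (fun y => F y * G y) s x w = dM I F s x w * G x + F x * dM I G s x w := by
  ext i j
  simp only [dM, Matrix.of_apply, Matrix.mul_apply, Matrix.add_apply]
  rw [dS_sum hs fun a _ => MD.mul (hF i a) (hG a j), ← Finset.sum_add_distrib]
  exact Finset.sum_congr rfl fun a _ => dS_mul hs (hF i a) (hG a j) w

lemma dM_congr {F G : M → Matrix ι κ ℂ} {s : Set M} {x : M} (w : TangentSpace I x) (hx : x ∈ s)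
    (h : ∀ y ∈ s, F y = G y) : dM I F s x w = dM I G s x w := by
  ext i j
  exact dS_congr w hx fun y hy => by rw [h y hy]

lemma dM_comp {F : M' → Matrix ι κ ℂ} {Φ : M → M'} {s : Set M} {s' : Set M'} {x : M}
    (hs : UniqueMDiffWithinAt I s x) (hF : MDM I' F s' (Φ x))
    (hΦ : MDifferentiableWithinAt I I' Φ s x) (hm : Set.MapsTo Φ s s') (w : TangentSpace I x) :
    dM I (fun y => F (Φ y)) s x w = dM I' F s' (Φ x) (mfderivWithin I I' Φ s x w) := by
  ext i j
  exact dS_comp hs (hF i j) hΦ hm w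

end Deriv

/-! ### Chern forms in terms of alternating traces -/

section Chern

variable {E : Type*} [NormedAddCommGroup E] [NormedSpace ℝ E] {H : Type*} [TopologicalSpace H]
  {I : ModelWithCorners ℝ E H} {M : Type*} [TopologicalSpace M] [ChartedSpace H M]
  {ι : Type*} [Fintype ι] [DecidableEq ι]

variable (I) in
/-- The component of degree `2n` of the Chern form of a matrix valued map. -/
def chernM (n : ℕ) (F : M → Matrix ι ι ℂ) (s : Set M) (x : M)
    (w : Fin (2 * n) → TangentSpace I x) : ℂ :=
  1 / (2 * Real.pi * Complex.I) ^ n * (1 / (n.factorial : ℂ)) *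
    altTrace (F x) (fun i => dM I F s x (w i))

lemma chern_eq (N n : ℕ) (P : M → BUZ) (s : Set M) (x : M)
    (w : Fin (2 * n) → TangentSpace I x) :
    chern I N n P s x w = chernM I n (fun y => blockAt N (P y)) s x w := rfl

lemma chernM_eq_zero_of (n : ℕ) (F : M → Matrix ι ι ℂ) (s : Set M) (x : M)
    (w : Fin (2 * n) → TangentSpace I x) (h : altTrace (F x) (fun i => dM I F s x (w i)) = 0) :
    chernM I n F s x w = 0 := by
  rw [chernM, h, mul_zero]

/-- The matrix of entries of `P` with labels in the image of `g`. -/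
def blk (g : ι → ℤ) (P : BUZ) : Matrix ι ι ℂ := Matrix.of fun i j => P.entry (g i) (g j)

/-- The Chern form may be computed on any set of labels outside of which all matrix entries are
constant. -/
lemma chern_eq_chernM (g : ι → ℤ) (hg : Function.Injective g) (N n : ℕ)
    (hgN : ∀ i, -(N : ℤ) ≤ g i ∧ g i < N) (P : M → BUZ) (s : Set M) (x : M) (hx : x ∈ s)
    (hP : ∀ a b, (a ∉ Set.range g ∨ b ∉ Set.range g) → ∃ c, ∀ y ∈ s, (P y).entry a b = c)
    (w : Fin (2 * (n + 1)) → TangentSpace I x) :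
    chern I N (n + 1) P s x w = chernM I (n + 1) (fun y => blk g (P y)) s x w := by
  rw [chern_eq, chernM, chernM]
  congr 1
  -- Positive degree enters here: at least one factor `dP` occurs, and `dP` vanishes outside the
  -- chosen labels because the entries there are constant.
  have h := altTrace_submatrix (m := 2 * n + 1)
    (fun i => (⟨g i, Finset.mem_Ico.2 (hgN i)⟩ : Finset.Ico (-(N : ℤ)) N))
    (fun i j hij => hg (congrArg Subtype.val hij)) (blockAt N (P x))
    (fun i => dM I (fun y => blockAt N (P y)) s x (w i)) ?_
  · exact h
  · intro i a b hab
    obtain ⟨c, hc⟩ := hP a b (hab.imp (fun h ⟨j, hj⟩ => h ⟨j, Subtype.ext hj⟩)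
      (fun h ⟨j, hj⟩ => h ⟨j, Subtype.ext hj⟩))
    exact dS_const_on _ hx c hc

/-- The Chern form does not depend on the size of the block used to define it. -/
lemma chern_stage {N N' n : ℕ} (P : M → BUZ) (s : Set M) (x : M) (hx : x ∈ s)
    (hN : ∀ y ∈ s, (P y).InStage (-(N : ℤ)) N) (hN' : N ≤ N')
    (w : Fin (2 * (n + 1)) → TangentSpace I x) :
    chern I N' (n + 1) P s x w = chern I N (n + 1) P s x w := by
  rw [chern_eq_chernM (Subtype.val : Finset.Ico (-(N : ℤ)) N → ℤ) Subtype.val_injective N' n ?_ P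
    s x hx ?_ w]
  · rfl
  · rintro ⟨i, hi⟩
    rw [Finset.mem_Ico] at hi
    dsimp only
    omega
  · have aux : ∀ a, a ∉ Set.range (Subtype.val : Finset.Ico (-(N : ℤ)) N → ℤ) →
        a < -N ∨ (N : ℤ) ≤ a := fun a ha => by
      by_contra h
      exact ha ⟨⟨a, Finset.mem_Ico.2 (by omega)⟩, rfl⟩
    intro a b hab
    by_cases h : (a < -N ∨ b < -N)
    · exact ⟨_, fun y hy => (hN y hy).entry_low h⟩
    · exact ⟨0, fun y hy => (hN y hy).entry_high (by
        rcases hab with hab | hab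
        · have := aux a hab
          omega
        · have := aux b hab
          omega)⟩

end Chern

/-! ### The cylinder -/

section Cylinder

variable {E : Type*} [NormedAddCommGroup E] [NormedSpace ℝ E] {H : Type*} [TopologicalSpace H]
  {I : ModelWithCorners ℝ E H} {M : Type*} [TopologicalSpace M] [ChartedSpace H M]
  {E' : Type*} [NormedAddCommGroup E'] [NormedSpace ℝ E'] {H' : Type*} [TopologicalSpace H']
  {I' : ModelWithCorners ℝ E' H'} {M' : Type*} [TopologicalSpace M'] [ChartedSpace H' M']

omit [TopologicalSpace M] in
lemma mem_cylinder {p : M × ℝ} : p ∈ cylinder M ↔ p.2 ∈ Set.Icc (0 : ℝ) 1 := by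
  simp [cylinder]

variable (I) in
lemma uniqueMDiff_cylinder {p : M × ℝ} (hp : p ∈ cylinder M) :
    UniqueMDiffWithinAt (I.prod 𝓘(ℝ, ℝ)) (cylinder M) p :=
  (uniqueMDiffOn_univ.prod uniqueDiffOn_Icc_zero_one.uniqueMDiffOn) p hp

/-- A concatenated homotopy agrees with a reparametrized piece only near a given time, so Chern
forms have to be compared germwise. -/
lemma chern_congr_nhds {N n : ℕ} {P Q : M → BUZ} {s : Set M} {x : M} (hx : x ∈ s)
    (h : P =ᶠ[nhdsWithin x s] Q) (w : Fin (2 * n) → TangentSpace I x) :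
    chern I N n P s x w = chern I N n Q s x w := by
  have h1 : P x = Q x := h.self_of_nhdsWithin hx
  rw [chern_eq, chern_eq, chernM, chernM, h1]
  congr 2
  funext i
  ext a b
  exact dS_congr_nhds _ hx (h.mono fun y hy => congrArg (fun R : BUZ => R.entry a b) hy)

/-- Naturality of the Chern form. -/
lemma chern_comp {N n : ℕ} {P : M' → BUZ} {Φ : M → M'} {s : Set M} {s' : Set M'} {x : M}
    (hs : UniqueMDiffWithinAt I s x) (hP : ∀ i j, MD I' (fun y => (P y).entry i j) s' (Φ x))
    (hΦ : MDifferentiableWithinAt I I' Φ s x) (hm : Set.MapsTo Φ s s')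
    (w : Fin (2 * n) → TangentSpace I x) :
    chern I N n (fun y => P (Φ y)) s x w =
      chern I' N n P s' (Φ x) (fun i => mfderivWithin I I' Φ s x (w i)) := by
  rw [chern_eq, chern_eq, chernM, chernM]
  congr 2
  funext i
  exact dM_comp (F := fun y => blockAt N (P y)) hs (fun a b => hP a b) hΦ hm (w i)

lemma dM_smul {ι κ : Type*} (F : M → Matrix ι κ ℂ) (s : Set M) (x : M) (c : ℝ)
    (w : TangentSpace I x) : dM I F s x (c • w) = (c : ℂ) • dM I F s x w := by
  ext i j
  have : dS I (fun y => F y i j) s x (c • w) = c • dS I (fun y => F y i j) s x w :=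
    ContinuousLinearMap.map_smul (M₁ := E) (M₂ := ℂ) _ _ _
  simpa [dM] using this

/-- The scaled slot is the time direction. In the applications `c` is the speed of a
reparametrization of `[0, 1]`, or `0` for a constant homotopy. -/
lemma chern_cons_smul {N n : ℕ} (P : M → BUZ) (s : Set M) (x : M) (c : ℝ)
    (w : TangentSpace I x) (v : Fin (2 * n + 1) → TangentSpace I x) :
    chern I N (n + 1) P s x (Fin.cons (c • w) v : Fin (2 * n + 2) → TangentSpace I x) =
      c * chern I N (n + 1) P s x (Fin.cons w v : Fin (2 * n + 2) → TangentSpace I x) := by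
  rw [chern_eq, chern_eq, chernM, chernM, ← mul_left_comm]
  congr 1
  have h := altTrace_smul (m := 2 * n + 2) (blockAt N (P x))
    (Fin.cons (c : ℂ) (fun _ => 1) : Fin (2 * n + 2) → ℂ) (fun i => dM I (fun y => blockAt N (P y))
      s x ((Fin.cons w v : Fin (2 * n + 2) → TangentSpace I x) i))
  rw [Fin.prod_cons, Finset.prod_const_one, mul_one] at h
  refine Eq.trans ?_ h
  congr 2
  funext i
  refine Fin.cases ?_ (fun j => ?_) i
  · simp only [Fin.cons_zero]
    exact dM_smul _ _ _ _ _
  · simp only [Fin.cons_succ, one_smul]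

lemma IsSmoothOn.md {P : M → BUZ} {s : Set M} (h : IsSmoothOn I P s) {x : M} (hx : x ∈ s)
    (i j : ℤ) : MD I (fun y => (P y).entry i j) s x :=
  ((h.2 i j).mdifferentiableOn (by simp)) x hx

lemma IsSmooth.contMDiff {P : M → BUZ} (h : IsSmooth I P) (i j : ℤ) :
    ContMDiff I 𝓘(ℝ, ℂ) ∞ fun y => (P y).entry i j := contMDiffOn_univ.1 (h.2 i j)

lemma IsSmooth.exists_stage {P : M → BUZ} (h : IsSmooth I P) :
    ∃ N : ℕ, ∀ x, (P x).InStage (-(N : ℤ)) N := h.1.imp fun _ h x => h x trivial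

lemma isSmooth_iff {P : M → BUZ} : IsSmooth I P ↔ (∃ N : ℕ, ∀ x, (P x).InStage (-(N : ℤ)) N) ∧
    ∀ i j : ℤ, ContMDiff I 𝓘(ℝ, ℂ) ∞ fun y => (P y).entry i j :=
  ⟨fun h => ⟨h.exists_stage, h.contMDiff⟩,
    fun h => ⟨h.1.imp fun _ h x _ => h x, fun i j => contMDiffOn_univ.2 (h.2 i j)⟩⟩

lemma stage_spec {Γ : M × ℝ → BUZ} (h : IsSmoothOn (I.prod 𝓘(ℝ, ℝ)) Γ (cylinder M)) :
    ∀ y ∈ cylinder M, (Γ y).InStage (-(stage Γ : ℤ)) (stage Γ) :=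
  Nat.sInf_mem (s := {N : ℕ | ∀ y ∈ cylinder M, (Γ y).InStage (-(N : ℤ)) N}) h.1

variable (I) in
/-- The tuple of tangent vectors `∂_t, v_1, …, v_{2n+1}` of the cylinder. -/
def cylVec (n : ℕ) (x : M) (t : ℝ) (v : Fin (2 * n + 1) → TangentSpace I x) :
    Fin (2 * (n + 1)) → TangentSpace (I.prod 𝓘(ℝ, ℝ)) (x, t) :=
  (Fin.cons (((0, 1) : E × ℝ)) (fun i => ((v i, 0) : E × ℝ)) : Fin (2 * n + 2) → E × ℝ)

lemma CS_eq_integral (Γ : M × ℝ → BUZ) (n : ℕ) (x : M) (v : Fin (2 * n + 1) → TangentSpace I x) :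
    CS I Γ n x v = ∫ t in (0 : ℝ)..1,
      chern (I.prod 𝓘(ℝ, ℝ)) (stage Γ) (n + 1) Γ (cylinder M) (x, t) (cylVec I n x t v) := rfl

/-- The form is defined with the least stage, which is awkward for comparing different homotopies;
this allows any common stage instead. -/
lemma CS_eq_of_stage {Γ : M × ℝ → BUZ} {N : ℕ}
    (hN : ∀ y ∈ cylinder M, (Γ y).InStage (-(N : ℤ)) N) (n : ℕ) (x : M)
    (v : Fin (2 * n + 1) → TangentSpace I x) :
    CS I Γ n x v = ∫ t in (0 : ℝ)..1,
      chern (I.prod 𝓘(ℝ, ℝ)) N (n + 1) Γ (cylinder M) (x, t) (cylVec I n x t v) := by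
  rw [CS_eq_integral]
  refine intervalIntegral.integral_congr fun t ht => ?_
  rw [Set.uIcc_of_le zero_le_one] at ht
  have h1 : ∀ y ∈ cylinder M, (Γ y).InStage (-(stage Γ : ℤ)) (stage Γ) :=
    Nat.sInf_mem (s := {N : ℕ | ∀ y ∈ cylinder M, (Γ y).InStage (-(N : ℤ)) N}) ⟨N, hN⟩
  exact (chern_stage Γ (cylinder M) (x, t) (mem_cylinder.2 ht) h1
    (Nat.sInf_le hN : stage Γ ≤ N) _).symm

lemma CS_eq_zero_of {Γ : M × ℝ → BUZ} {N : ℕ}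
    (hN : ∀ y ∈ cylinder M, (Γ y).InStage (-(N : ℤ)) N) (n : ℕ) (x : M)
    (v : Fin (2 * n + 1) → TangentSpace I x)
    (h : ∀ t ∈ Set.Icc (0 : ℝ) 1, chern (I.prod 𝓘(ℝ, ℝ)) N (n + 1) Γ (cylinder M) (x, t)
      (cylVec I n x t v) = 0) : CS I Γ n x v = 0 := by
  rw [CS_eq_of_stage hN, ← intervalIntegral.integral_zero (E := ℂ) (a := 0) (b := 1)
    (μ := MeasureTheory.volume)]
  refine intervalIntegral.integral_congr fun t ht => ?_
  rw [Set.uIcc_of_le zero_le_one] at ht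
  exact h t ht

/-! ### Maps of cylinders -/

lemma mfderivWithin_prodMap_cylinder {f : M → M'} {φ : ℝ → ℝ} (hf : ContMDiff I I' ∞ f)
    (hφ : ContDiff ℝ ∞ φ) {x : M} {t : ℝ} (ht : t ∈ Set.Icc (0 : ℝ) 1) (v : E) (c : ℝ) :
    (mfderivWithin (I.prod 𝓘(ℝ, ℝ)) (I'.prod 𝓘(ℝ, ℝ)) (Prod.map f φ) (cylinder M) (x, t)
      ((v, c) : E × ℝ) : E' × ℝ) = ((mfderiv I I' f x v : E'), c * deriv φ t) := by
  have hf' : MDifferentiableAt I I' f x := (hf.mdifferentiable (by simp)) x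
  have hφ' : MDifferentiableAt 𝓘(ℝ, ℝ) 𝓘(ℝ, ℝ) φ t :=
    ((hφ.differentiable (by simp)) t).mdifferentiableAt
  rw [mfderivWithin_eq_mfderiv (uniqueMDiff_cylinder I (mem_cylinder.2 ht))
    (hf'.prodMap hφ'), mfderiv_prodMap (p := (x, t)) hf' hφ', mfderiv_eq_fderiv]
  refine Prod.ext rfl ?_
  have : fderiv ℝ φ t c = c * deriv φ t := by
    rw [fderiv_eq_smul_deriv, smul_eq_mul]
  exact this

/-- Chern forms under maps `f × φ` of cylinders. -/
lemma chern_prodMap {N n : ℕ} {Γ : M' × ℝ → BUZ}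
    (hΓ : IsSmoothOn (I'.prod 𝓘(ℝ, ℝ)) Γ (cylinder M')) {f : M → M'} {φ : ℝ → ℝ}
    (hf : ContMDiff I I' ∞ f) (hφ : ContDiff ℝ ∞ φ)
    (hm : Set.MapsTo φ (Set.Icc 0 1) (Set.Icc 0 1)) {x : M} {t : ℝ}
    (ht : t ∈ Set.Icc (0 : ℝ) 1) (v : Fin (2 * n + 1) → TangentSpace I x) :
    chern (I.prod 𝓘(ℝ, ℝ)) N (n + 1) (fun y => Γ (Prod.map f φ y)) (cylinder M) (x, t)
      (cylVec I n x t v) = deriv φ t * chern (I'.prod 𝓘(ℝ, ℝ)) N (n + 1) Γ (cylinder M') (f x, φ t)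
      (cylVec I' n (f x) (φ t) (fun i => mfderiv I I' f x (v i))) := by
  have hmaps : Set.MapsTo (Prod.map f φ) (cylinder M) (cylinder M') := fun y hy =>
    mem_cylinder.2 (hm (mem_cylinder.1 hy))
  have hx : (x, t) ∈ cylinder M := mem_cylinder.2 ht
  have hf' : MDifferentiableAt I I' f x := (hf.mdifferentiable (by simp)) x
  have hφ' : MDifferentiableAt 𝓘(ℝ, ℝ) 𝓘(ℝ, ℝ) φ t :=
    ((hφ.differentiable (by simp)) t).mdifferentiableAt
  rw [chern_comp (uniqueMDiff_cylinder I hx) (fun i j => hΓ.md (hmaps hx) i j)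
    (hf'.prodMap hφ').mdifferentiableWithinAt hmaps]
  have h := chern_cons_smul (I := I'.prod 𝓘(ℝ, ℝ)) (N := N) (n := n) Γ (cylinder M') (f x, φ t)
    (deriv φ t) ((0, 1) : E' × ℝ) (fun i => ((mfderiv I I' f x (v i), 0) : E' × ℝ))
  refine Eq.trans ?_ h
  congr 1
  funext i
  refine Fin.cases ?_ (fun j => ?_) i
  · refine (mfderivWithin_prodMap_cylinder hf hφ ht 0 1).trans ?_
    refine Prod.ext ?_ ?_
    · change (mfderiv I I' f x) (0 : E) = deriv φ t • (0 : E')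
      rw [smul_zero]
      exact map_zero _
    · change 1 * deriv φ t = deriv φ t * 1
      ring
  · refine (mfderivWithin_prodMap_cylinder hf hφ ht (v j) 0).trans ?_
    exact Prod.ext rfl (zero_mul _)

lemma IsSmoothOn.comp_prodMap {Γ : M' × ℝ → BUZ}
    (hΓ : IsSmoothOn (I'.prod 𝓘(ℝ, ℝ)) Γ (cylinder M')) {f : M → M'} {φ : ℝ → ℝ}
    (hf : ContMDiff I I' ∞ f) (hφ : ContDiff ℝ ∞ φ)
    (hm : Set.MapsTo φ (Set.Icc 0 1) (Set.Icc 0 1)) :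
    IsSmoothOn (I.prod 𝓘(ℝ, ℝ)) (fun y => Γ (Prod.map f φ y)) (cylinder M) := by
  have hmaps : Set.MapsTo (Prod.map f φ) (cylinder M) (cylinder M') := fun y hy =>
    mem_cylinder.2 (hm (mem_cylinder.1 hy))
  refine ⟨hΓ.1.imp fun N hN y hy => hN _ (hmaps hy), fun i j => ?_⟩
  exact (hΓ.2 i j).comp (hf.prodMap hφ.contMDiff).contMDiffOn hmaps

/-! ### Continuity in the time variable -/

/-- Continuity in time is needed to integrate, to substitute and to split integrals. On `{x} × [0,
1]` the single chart at `x` serves for all times, so the derivative is that of one function `h`,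
smooth on the product of the chart target and `[0, 1]`. -/
lemma continuousOn_dS [IsManifold I ∞ M] {F : M × ℝ → ℂ}
    (hF : ContMDiffOn (I.prod 𝓘(ℝ, ℝ)) 𝓘(ℝ, ℂ) ∞ F (cylinder M)) (x : M) (w : E × ℝ) :
    ContinuousOn (fun t : ℝ => dS (I.prod 𝓘(ℝ, ℝ)) F (cylinder M) (x, t) w) (Set.Icc 0 1) := by
  let h : E × ℝ → ℂ := fun q => F ((extChartAt I x).symm q.1, q.2)
  let T : Set (E × ℝ) := (extChartAt I x).target ×ˢ Set.Icc 0 1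
  have hT : UniqueDiffOn ℝ T := (uniqueDiffOn_extChartAt_target x).prod uniqueDiffOn_Icc_zero_one
  have hsm : ContDiffOn ℝ ∞ h T := by
    rw [← contMDiffOn_iff_contDiffOn]
    have h1 : ContMDiffOn 𝓘(ℝ, E × ℝ) I ∞ (fun q : E × ℝ => (extChartAt I x).symm q.1) T :=
      (contMDiffOn_extChartAt_symm x).comp contDiff_fst.contMDiff.contMDiffOn fun q hq => hq.1
    have h2 : ContMDiffOn 𝓘(ℝ, E × ℝ) 𝓘(ℝ, ℝ) ∞ (fun q : E × ℝ => q.2) T :=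
      contDiff_snd.contMDiff.contMDiffOn
    exact hF.comp (h1.prodMk h2) fun q hq => mem_cylinder.2 hq.2
  have hc := hsm.continuousOn_fderivWithin hT (by simp)
  have hc2 : ContinuousOn (fun t : ℝ => fderivWithin ℝ h T (extChartAt I x x, t) w)
      (Set.Icc 0 1) := by
    refine ContinuousOn.clm_apply (hc.comp (by fun_prop) fun t ht => ?_) continuousOn_const
    exact ⟨mem_extChartAt_target x, ht⟩
  refine hc2.congr fun t ht => ?_
  have hmd : MD (I.prod 𝓘(ℝ, ℝ)) F (cylinder M) (x, t) :=
    (hF.mdifferentiableOn (by simp)) _ (mem_cylinder.2 ht)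
  refine (congrArg (fun L : E × ℝ →L[ℝ] ℂ => L w) hmd.mfderivWithin).trans ?_
  have e1 : writtenInExtChartAt (I.prod 𝓘(ℝ, ℝ)) 𝓘(ℝ, ℂ) (x, t) F = h := by
    funext q
    simp only [writtenInExtChartAt, extChartAt_prod, extChartAt_model_space_eq_id]
    rfl
  have e2 : (extChartAt (I.prod 𝓘(ℝ, ℝ)) (x, t)) (x, t) = (extChartAt I x x, t) := by
    simp only [extChartAt_prod, extChartAt_model_space_eq_id]
    rfl
  rw [e1, e2]
  refine congrArg (fun L : E × ℝ →L[ℝ] ℂ => L w) (fderivWithin_congr_set ?_)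
  have e3 : (extChartAt (I.prod 𝓘(ℝ, ℝ)) (x, t)).symm ⁻¹' cylinder M ∩
      Set.range (I.prod 𝓘(ℝ, ℝ)) = Set.range I ×ˢ Set.Icc 0 1 := by
    ext q
    have e4 : ((extChartAt (I.prod 𝓘(ℝ, ℝ)) (x, t)).symm q).2 = q.2 := by
      rw [extChartAt_prod, extChartAt_model_space_eq_id]
      rfl
    rw [Set.mem_inter_iff, Set.mem_preimage, mem_cylinder, e4, ModelWithCorners.range_prod,
      Set.mem_prod, Set.mem_prod, modelWithCornersSelf_coe, Set.range_id]
    simp only [Set.mem_univ, and_true]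
    exact and_comm
  rw [e3]
  -- The manifold derivative is taken within `range I × [0, 1]`, that of `h` within the smaller set
  -- `T`; the two sets agree near the point.
  have h3 : (extChartAt I x).target ∈ nhdsWithin (extChartAt I x x) (Set.range I) :=
    extChartAt_target_mem_nhdsWithin x
  obtain ⟨u, hu, hu'⟩ := mem_nhdsWithin_iff_exists_mem_nhds_inter.1 h3
  have h4 : ∀ᶠ q : E × ℝ in nhds (extChartAt I x x, t), q.1 ∈ u :=
    continuousAt_fst.eventually hu
  filter_upwards [h4] with q hq
  refine propext ⟨fun hq' => ⟨hu' ⟨hq, hq'.1⟩, hq'.2⟩, fun hq' =>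
    ⟨extChartAt_target_subset_range x hq'.1, hq'.2⟩⟩

lemma continuousOn_altTrace {ι : Type*} [Fintype ι] [DecidableEq ι] {m : ℕ} {s : Set ℝ}
    {A : ℝ → Matrix ι ι ℂ} {B : Fin m → ℝ → Matrix ι ι ℂ} (hA : ContinuousOn A s)
    (hB : ∀ i, ContinuousOn (B i) s) :
    ContinuousOn (fun t => altTrace (A t) fun i => B i t) s := by
  have hprod : ∀ l : List (Fin m), ContinuousOn (fun t => (l.map fun i => B i t).prod) s := by
    intro l
    induction l with
    | nil => simpa using continuousOn_const
    | cons i l ih =>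
      simp only [List.map_cons, List.prod_cons]
      exact (hB i).mul ih
  refine continuousOn_finsetSum _ fun σ _ => continuousOn_const.mul ?_
  have h1 : ContinuousOn (fun t => A t * (List.ofFn fun i => B (σ i) t).prod) s := by
    refine hA.mul ?_
    refine (hprod ((List.finRange m).map σ)).congr fun t _ => ?_
    simp only [List.ofFn_eq_map, List.map_map, Function.comp_def]
  exact (Continuous.matrix_trace continuous_id).comp_continuousOn h1

lemma continuousOn_chern [IsManifold I ∞ M] {Γ : M × ℝ → BUZ}
    (hΓ : IsSmoothOn (I.prod 𝓘(ℝ, ℝ)) Γ (cylinder M)) (N n : ℕ) (x : M)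
    (v : Fin (2 * n + 1) → TangentSpace I x) :
    ContinuousOn (fun t : ℝ => chern (I.prod 𝓘(ℝ, ℝ)) N (n + 1) Γ (cylinder M) (x, t)
      (cylVec I n x t v)) (Set.Icc 0 1) := by
  refine continuousOn_const.mul ?_
  refine continuousOn_altTrace (A := fun t => blockAt N (Γ (x, t))) (B := fun i t =>
    dM (I.prod 𝓘(ℝ, ℝ)) (fun y => blockAt N (Γ y)) (cylinder M) (x, t) (cylVec I n x t v i)) ?_ ?_
  · refine continuousOn_pi.2 fun i => continuousOn_pi.2 fun j => ?_
    exact (hΓ.2 i j).continuousOn.comp (by fun_prop) fun t ht => mem_cylinder.2 ht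
  · intro k
    refine continuousOn_pi.2 fun i => continuousOn_pi.2 fun j => ?_
    exact continuousOn_dS (hΓ.2 i j) x
      ((Fin.cons (((0, 1) : E × ℝ)) (fun i => ((v i, 0) : E × ℝ)) : Fin (2 * n + 2) → E × ℝ) k)

end Cylinder

/-! ### Constant, reversed and concatenated homotopies -/

section Homotopy

variable {E : Type*} [NormedAddCommGroup E] [NormedSpace ℝ E] {H : Type*} [TopologicalSpace H]
  {I : ModelWithCorners ℝ E H} {M : Type*} [TopologicalSpace M] [ChartedSpace H M]
  {E' : Type*} [NormedAddCommGroup E'] [NormedSpace ℝ E'] {H' : Type*} [TopologicalSpace H']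
  {I' : ModelWithCorners ℝ E' H'} {M' : Type*} [TopologicalSpace M'] [ChartedSpace H' M']

lemma isSmoothOn_fst {P : M → BUZ} (hP : IsSmooth I P) :
    IsSmoothOn (I.prod 𝓘(ℝ, ℝ)) (fun y : M × ℝ => P y.1) (cylinder M) := by
  obtain ⟨N, hN⟩ := hP.exists_stage
  exact ⟨⟨N, fun y _ => hN _⟩, fun i j =>
    ((hP.contMDiff i j).comp contMDiff_fst).contMDiffOn⟩

lemma dS_time_fst {f : M → ℂ} (hf : MDifferentiable I 𝓘(ℝ, ℂ) f) {x : M} {t : ℝ}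
    (ht : t ∈ Set.Icc (0 : ℝ) 1) (v : E) (c : ℝ) :
    dS (I.prod 𝓘(ℝ, ℝ)) (fun y : M × ℝ => f y.1) (cylinder M) (x, t) ((v, c) : E × ℝ) =
      dS I f Set.univ x v := by
  have hu := uniqueMDiff_cylinder I (mem_cylinder.2 ht : (x, t) ∈ cylinder M)
  exact (dS_comp (I' := I) (s' := Set.univ) hu (hf x).mdifferentiableWithinAt
    mdifferentiableWithinAt_fst (Set.mapsTo_univ _ _) _).trans
    (congrArg (fun L : E × ℝ →L[ℝ] E => dS I f Set.univ x (L (v, c))) (mfderivWithin_fst hu))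

lemma dS_zero (f : M → ℂ) (s : Set M) (x : M) : dS I f s x 0 = 0 :=
  map_zero (mfderivWithin I 𝓘(ℝ, ℂ) f s x)

/-- The constant homotopy. -/
lemma isHomotopy_refl {P : M → BUZ} (hP : IsSmooth I P) :
    IsHomotopy I (fun y => P y.1) P P ∧ ∀ n x v, CS I (fun y => P y.1) n x v = 0 := by
  refine ⟨⟨isSmoothOn_fst hP, fun _ => rfl, fun _ => rfl⟩, fun n x v => ?_⟩
  obtain ⟨N, hN⟩ := hP.exists_stage
  refine CS_eq_zero_of (N := N) (fun y _ => hN _) n x v fun t ht => ?_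
  -- The entries do not depend on time, so `∂_t` may be replaced by `0 • ∂_t` without changing any
  -- factor, and the scalar `0` comes out.
  have h := chern_cons_smul (I := I.prod 𝓘(ℝ, ℝ)) (N := N) (n := n) (fun y : M × ℝ => P y.1)
    (cylinder M) (x, t) 0 ((0, 1) : E × ℝ) (fun i => ((v i, 0) : E × ℝ))
  rw [Complex.ofReal_zero, zero_mul] at h
  rw [← h, chern_eq, chern_eq, chernM, chernM]
  congr 2
  funext i
  refine Fin.cases ?_ (fun j => rfl) i
  ext a b
  have h1 := dS_time_fst (((hP.contMDiff a b).mdifferentiable (by simp))) (x := x) ht 0 1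
  have h2 := dS_zero (I := I.prod 𝓘(ℝ, ℝ)) (fun y : M × ℝ => (P y.1).entry a b)
    (cylinder M) (x, t)
  have e : ((0 : ℝ) • ((0, 1) : E × ℝ)) = 0 := zero_smul _ _
  refine (h1.trans (dS_zero _ _ _)).trans ?_
  change _ = dS (I.prod 𝓘(ℝ, ℝ)) (fun y : M × ℝ => (P y.1).entry a b) (cylinder M) (x, t)
    ((0 : ℝ) • ((0, 1) : E × ℝ))
  rw [e]
  exact h2.symm

/-- The reversed homotopy. -/
lemma isHomotopy_symm {Γ : M × ℝ → BUZ} {P Q : M → BUZ} (h : IsHomotopy I Γ P Q) :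
    IsHomotopy I (fun y => Γ (y.1, 1 - y.2)) Q P ∧
      ∀ n x v, CS I (fun y => Γ (y.1, 1 - y.2)) n x v = -CS I Γ n x v := by
  have hφ : ContDiff ℝ ∞ fun t : ℝ => 1 - t := by fun_prop
  have hm : Set.MapsTo (fun t : ℝ => 1 - t) (Set.Icc 0 1) (Set.Icc 0 1) := fun t ht =>
    ⟨by linarith [ht.2], by linarith [ht.1]⟩
  have hs := IsSmoothOn.comp_prodMap (I := I) h.1 contMDiff_id hφ hm
  refine ⟨⟨hs, fun x => ?_, fun x => ?_⟩, fun n x v => ?_⟩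
  · simpa using h.2.2 x
  · simpa using h.2.1 x
  · have hst := stage_spec h.1
    rw [CS_eq_of_stage (Γ := fun y : M × ℝ => Γ (y.1, 1 - y.2)) (N := stage Γ)
      (fun y hy => hst _ (mem_cylinder.2 (hm (mem_cylinder.1 hy)))), CS_eq_integral]
    have key : ∀ t ∈ Set.uIcc (0 : ℝ) 1, chern (I.prod 𝓘(ℝ, ℝ)) (stage Γ) (n + 1)
        (fun y : M × ℝ => Γ (y.1, 1 - y.2)) (cylinder M) (x, t) (cylVec I n x t v) =
        (fun s => -chern (I.prod 𝓘(ℝ, ℝ)) (stage Γ) (n + 1) Γ (cylinder M) (x, s)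
          (cylVec I n x s v)) (1 - t) := by
      intro t ht
      rw [Set.uIcc_of_le zero_le_one] at ht
      have := chern_prodMap (I := I) (N := stage Γ) (n := n) h.1 contMDiff_id hφ hm (x := x) ht v
      have hd : deriv (fun t : ℝ => 1 - t) t = -1 := by
        rw [deriv_const_sub]
        simp
      rw [hd, mfderiv_id] at this
      refine this.trans ?_
      simp only [Complex.ofReal_neg, Complex.ofReal_one, neg_one_mul]
      rfl
    rw [intervalIntegral.integral_congr key, intervalIntegral.integral_comp_sub_left (fun s =>
      -chern (I.prod 𝓘(ℝ, ℝ)) (stage Γ) (n + 1) Γ (cylinder M) (x, s) (cylVec I n x s v)) 1]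
    simp

/-- The concatenation of two paths, reparametrized so as to be constant around `t = 1/2`. -/
def catPath {α : Type*} (a b : ℝ → α) (t : ℝ) : α :=
  if t < 1 / 2 then a (Real.smoothTransition (3 * t)) else b (Real.smoothTransition (3 * t - 2))

lemma catPath_zero {α : Type*} (a b : ℝ → α) : catPath a b 0 = a 0 := by
  simp [catPath]

lemma catPath_one {α : Type*} (a b : ℝ → α) : catPath a b 1 = b 1 := by
  have h : Real.smoothTransition (3 * 1 - 2) = 1 :=
    Real.smoothTransition.one_of_one_le (by norm_num)
  rw [catPath, if_neg (by norm_num), h]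

/-- The formula stays valid beyond `1/2`: for times between `1/3` and `2/3` both pieces rest at the
common value `a 1 = b 0`. This overlap with `catPath_right` makes the concatenation smooth at the
joint. -/
lemma catPath_left {α : Type*} {a b : ℝ → α} (h : a 1 = b 0) {t : ℝ} (ht : t < 2 / 3) :
    catPath a b t = a (Real.smoothTransition (3 * t)) := by
  rw [catPath]
  split_ifs with h1
  · rfl
  · rw [Real.smoothTransition.zero_of_nonpos (by linarith),
      Real.smoothTransition.one_of_one_le (by linarith), h]

lemma catPath_right {α : Type*} {a b : ℝ → α} (h : a 1 = b 0) {t : ℝ} (ht : 1 / 3 < t) :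
    catPath a b t = b (Real.smoothTransition (3 * t - 2)) := by
  rw [catPath]
  split_ifs with h1
  · rw [Real.smoothTransition.zero_of_nonpos (x := 3 * t - 2) (by linarith),
      Real.smoothTransition.one_of_one_le (by linarith), h]
  · rfl

/-- Integration by substitution. No monotonicity of `φ` is required, since only its values at the
two ends matter. -/
lemma integral_reparam {g : ℝ → ℂ} (hg : ContinuousOn g (Set.Icc 0 1)) {φ : ℝ → ℝ}
    (hφ : ContDiff ℝ ∞ φ) (hm : ∀ t, φ t ∈ Set.Icc (0 : ℝ) 1) (a b : ℝ) (ha : φ a = 0)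
    (hb : φ b = 1) :
    ∫ t in a..b, ((deriv φ t : ℝ) : ℂ) * g (φ t) = ∫ t in (0 : ℝ)..1, g t := by
  have h := intervalIntegral.integral_deriv_smul_comp'' (a := a) (b := b) (f := φ)
    (f' := deriv φ) (g := g) hφ.continuous.continuousOn
    (fun t _ => ((hφ.differentiable (by simp)) t).hasDerivAt.hasDerivWithinAt)
    (hφ.continuous_deriv (by simp)).continuousOn
    (hg.mono (by rintro _ ⟨t, _, rfl⟩; exact hm t))
  rw [ha, hb] at h
  rw [← h]
  simp

lemma contDiff_reparam (a b : ℝ) : ContDiff ℝ ∞ fun t : ℝ => Real.smoothTransition (a * t - b) :=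
  Real.smoothTransition.contDiff.comp (by fun_prop)

lemma smoothTransition_mem (x : ℝ) : Real.smoothTransition x ∈ Set.Icc (0 : ℝ) 1 :=
  ⟨Real.smoothTransition.nonneg x, Real.smoothTransition.le_one x⟩

lemma chern_reparam {N n : ℕ} {Γ Δ : M × ℝ → BUZ}
    (hΓ : IsSmoothOn (I.prod 𝓘(ℝ, ℝ)) Γ (cylinder M)) {φ : ℝ → ℝ} (hφ : ContDiff ℝ ∞ φ)
    (hm : ∀ t, φ t ∈ Set.Icc (0 : ℝ) 1) {x : M} {t : ℝ} (ht : t ∈ Set.Icc (0 : ℝ) 1)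
    (hΔ : Δ =ᶠ[nhdsWithin (x, t) (cylinder M)] fun y => Γ (y.1, φ y.2))
    (v : Fin (2 * n + 1) → TangentSpace I x) :
    chern (I.prod 𝓘(ℝ, ℝ)) N (n + 1) Δ (cylinder M) (x, t) (cylVec I n x t v) =
      deriv φ t * chern (I.prod 𝓘(ℝ, ℝ)) N (n + 1) Γ (cylinder M) (x, φ t)
        (cylVec I n x (φ t) v) := by
  refine (chern_congr_nhds (mem_cylinder.2 ht) hΔ _).trans ?_
  have := chern_prodMap (I := I) (N := N) (n := n) hΓ contMDiff_id hφ (fun t _ => hm t)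
    (x := x) ht v
  rw [mfderiv_id] at this
  exact this

lemma integral_chern_reparam [IsManifold I ∞ M] {N n : ℕ} {Γ Δ : M × ℝ → BUZ}
    (hΓ : IsSmoothOn (I.prod 𝓘(ℝ, ℝ)) Γ (cylinder M)) {φ : ℝ → ℝ} (hφ : ContDiff ℝ ∞ φ)
    (hm : ∀ t, φ t ∈ Set.Icc (0 : ℝ) 1) {x : M} {a b : ℝ} (ha : 0 ≤ a) (hab : a ≤ b) (hb : b ≤ 1)
    (ha0 : φ a = 0) (hb1 : φ b = 1)
    (hΔ : ∀ t, a ≤ t → t ≤ b →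
      Δ =ᶠ[nhdsWithin (x, t) (cylinder M)] fun y => Γ (y.1, φ y.2))
    (v : Fin (2 * n + 1) → TangentSpace I x) :
    ∫ t in a..b, chern (I.prod 𝓘(ℝ, ℝ)) N (n + 1) Δ (cylinder M) (x, t) (cylVec I n x t v) =
      ∫ t in (0 : ℝ)..1, chern (I.prod 𝓘(ℝ, ℝ)) N (n + 1) Γ (cylinder M) (x, t)
        (cylVec I n x t v) := by
  rw [← integral_reparam (continuousOn_chern hΓ N n x v) hφ hm a b ha0 hb1]
  refine intervalIntegral.integral_congr fun t ht => ?_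
  rw [Set.uIcc_of_le hab] at ht
  exact chern_reparam hΓ hφ hm ⟨ha.trans ht.1, ht.2.trans hb⟩ (hΔ t ht.1 ht.2) v

lemma catPath_left_nhds {Γ Γ' : M × ℝ → BUZ} (h : ∀ x, Γ (x, 1) = Γ' (x, 0)) {y : M × ℝ}
    (hy : y.2 < 2 / 3) (s : Set (M × ℝ)) :
    (fun z : M × ℝ => catPath (fun t => Γ (z.1, t)) (fun t => Γ' (z.1, t)) z.2) =ᶠ[nhdsWithin y s]
      fun z => Γ (z.1, Real.smoothTransition (3 * z.2 - 0)) := by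
  refine Filter.Eventually.filter_mono nhdsWithin_le_nhds ?_
  filter_upwards [(isOpen_lt continuous_snd continuous_const).mem_nhds hy] with z hz
  rw [sub_zero]
  exact catPath_left (a := fun t => Γ (z.1, t)) (b := fun t => Γ' (z.1, t)) (h z.1) hz

lemma catPath_right_nhds {Γ Γ' : M × ℝ → BUZ} (h : ∀ x, Γ (x, 1) = Γ' (x, 0)) {y : M × ℝ}
    (hy : 1 / 3 < y.2) (s : Set (M × ℝ)) :
    (fun z : M × ℝ => catPath (fun t => Γ (z.1, t)) (fun t => Γ' (z.1, t)) z.2) =ᶠ[nhdsWithin y s]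
      fun z => Γ' (z.1, Real.smoothTransition (3 * z.2 - 2)) := by
  refine Filter.Eventually.filter_mono nhdsWithin_le_nhds ?_
  filter_upwards [(isOpen_lt continuous_const continuous_snd).mem_nhds hy] with z hz
  exact catPath_right (a := fun t => Γ (z.1, t)) (b := fun t => Γ' (z.1, t)) (h z.1) hz

omit [TopologicalSpace M] in
lemma catPath_inStage {Γ Γ' : M × ℝ → BUZ} {N : ℕ}
    (hN : ∀ y ∈ cylinder M, (Γ y).InStage (-(N : ℤ)) N)
    (hN' : ∀ y ∈ cylinder M, (Γ' y).InStage (-(N : ℤ)) N) (y : M × ℝ) :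
    (catPath (fun t => Γ (y.1, t)) (fun t => Γ' (y.1, t)) y.2).InStage (-(N : ℤ)) N := by
  rw [catPath]
  split_ifs
  · exact hN _ (mem_cylinder.2 (smoothTransition_mem _))
  · exact hN' _ (mem_cylinder.2 (smoothTransition_mem _))

lemma exists_common_stage {Γ Γ' : M × ℝ → BUZ}
    (hΓ : IsSmoothOn (I.prod 𝓘(ℝ, ℝ)) Γ (cylinder M))
    (hΓ' : IsSmoothOn (I.prod 𝓘(ℝ, ℝ)) Γ' (cylinder M)) :
    ∃ N : ℕ, (∀ y ∈ cylinder M, (Γ y).InStage (-(N : ℤ)) N) ∧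
      ∀ y ∈ cylinder M, (Γ' y).InStage (-(N : ℤ)) N := by
  obtain ⟨N, hN⟩ := hΓ.1
  obtain ⟨N', hN'⟩ := hΓ'.1
  exact ⟨max N N', fun y hy => (hN y hy).mono (by omega) (by omega),
    fun y hy => (hN' y hy).mono (by omega) (by omega)⟩

lemma isSmoothOn_catPath {Γ Γ' : M × ℝ → BUZ}
    (hΓ : IsSmoothOn (I.prod 𝓘(ℝ, ℝ)) Γ (cylinder M))
    (hΓ' : IsSmoothOn (I.prod 𝓘(ℝ, ℝ)) Γ' (cylinder M)) (h : ∀ x, Γ (x, 1) = Γ' (x, 0)) :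
    IsSmoothOn (I.prod 𝓘(ℝ, ℝ))
      (fun y => catPath (fun t => Γ (y.1, t)) (fun t => Γ' (y.1, t)) y.2) (cylinder M) := by
  obtain ⟨N, hN, hN'⟩ := exists_common_stage hΓ hΓ'
  refine ⟨⟨N, fun y _ => catPath_inStage hN hN' y⟩, fun i j y hy => ?_⟩
  by_cases hy2 : y.2 < 2 / 3
  · have hs := (IsSmoothOn.comp_prodMap (I := I) hΓ contMDiff_id (contDiff_reparam 3 0)
      (fun t _ => smoothTransition_mem _)).2 i j y hy
    have hn := catPath_left_nhds h hy2 (cylinder M)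
    exact hs.congr_of_eventuallyEq (hn.mono fun z hz => congrArg (fun S : BUZ => S.entry i j) hz)
      (congrArg (fun S : BUZ => S.entry i j) (hn.self_of_nhdsWithin hy))
  · have hs := (IsSmoothOn.comp_prodMap (I := I) hΓ' contMDiff_id (contDiff_reparam 3 2)
      (fun t _ => smoothTransition_mem _)).2 i j y hy
    have hn := catPath_right_nhds h (y := y) (by linarith) (cylinder M)
    exact hs.congr_of_eventuallyEq (hn.mono fun z hz => congrArg (fun S : BUZ => S.entry i j) hz)
      (congrArg (fun S : BUZ => S.entry i j) (hn.self_of_nhdsWithin hy))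

/-- Concatenation of homotopies; the Chern–Simons forms add up. -/
lemma isHomotopy_trans [IsManifold I ∞ M] {Γ Γ' : M × ℝ → BUZ} {P Q R : M → BUZ}
    (h : IsHomotopy I Γ P Q) (h' : IsHomotopy I Γ' Q R) :
    IsHomotopy I (fun y => catPath (fun t => Γ (y.1, t)) (fun t => Γ' (y.1, t)) y.2) P R ∧
      ∀ n x v, CS I (fun y => catPath (fun t => Γ (y.1, t)) (fun t => Γ' (y.1, t)) y.2) n x v =
        CS I Γ n x v + CS I Γ' n x v := by
  have hmid : ∀ x, Γ (x, 1) = Γ' (x, 0) := fun x => by rw [h.2.2, h'.2.1]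
  have hs := isSmoothOn_catPath h.1 h'.1 hmid
  refine ⟨⟨hs, fun x => (catPath_zero _ _).trans (h.2.1 x),
    fun x => (catPath_one _ _).trans (h'.2.2 x)⟩, fun n x v => ?_⟩
  obtain ⟨N, hN, hN'⟩ := exists_common_stage h.1 h'.1
  rw [CS_eq_of_stage (fun y _ => catPath_inStage hN hN' y), CS_eq_of_stage hN, CS_eq_of_stage hN']
  have hint := fun a b (ha : a ∈ Set.Icc (0 : ℝ) 1) (hb : b ∈ Set.Icc (0 : ℝ) 1) =>
    ((continuousOn_chern hs N n x v).mono
      (Set.uIcc_subset_Icc ha hb)).intervalIntegrable (μ := MeasureTheory.volume)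
  rw [← intervalIntegral.integral_add_adjacent_intervals
    (hint 0 (1 / 2) (by norm_num) (by norm_num)) (hint (1 / 2) 1 (by norm_num) (by norm_num)),
    integral_chern_reparam h.1 (contDiff_reparam 3 0) (fun t => smoothTransition_mem _) le_rfl
      (by norm_num) (by norm_num) (by simp) (Real.smoothTransition.one_of_one_le (by norm_num))
      (fun t _ ht => catPath_left_nhds hmid (y := (x, t)) (by dsimp only; linarith) _) v,
    integral_chern_reparam h'.1 (contDiff_reparam 3 2) (fun t => smoothTransition_mem _)
      (by norm_num) (by norm_num) le_rfl (Real.smoothTransition.zero_of_nonpos (by norm_num))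
      (Real.smoothTransition.one_of_one_le (by norm_num))
      (fun t ht _ => catPath_right_nhds hmid (y := (x, t)) (by dsimp only; linarith) _) v]

/-- The pullback of a homotopy. -/
lemma isHomotopy_comp {Γ : M' × ℝ → BUZ} {P Q : M' → BUZ} (h : IsHomotopy I' Γ P Q) {f : M → M'}
    (hf : ContMDiff I I' ∞ f) :
    IsHomotopy I (fun y => Γ (f y.1, y.2)) (fun x => P (f x)) (fun x => Q (f x)) ∧
      ∀ n x (v : Fin (2 * n + 1) → TangentSpace I x), CS I (fun y => Γ (f y.1, y.2)) n x v =
        CS I' Γ n (f x) (fun i => mfderiv I I' f x (v i)) := by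
  have hm : Set.MapsTo (id : ℝ → ℝ) (Set.Icc 0 1) (Set.Icc 0 1) := fun t ht => ht
  have hs := IsSmoothOn.comp_prodMap (I := I) h.1 hf contDiff_id hm
  refine ⟨⟨hs, fun x => h.2.1 _, fun x => h.2.2 _⟩, fun n x v => ?_⟩
  have hst := stage_spec h.1
  rw [CS_eq_of_stage (Γ := fun y : M × ℝ => Γ (f y.1, y.2)) (N := stage Γ)
      (fun y hy => hst _ (mem_cylinder.2 (mem_cylinder.1 hy))), CS_eq_integral]
  refine intervalIntegral.integral_congr fun t ht => ?_
  rw [Set.uIcc_of_le zero_le_one] at ht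
  have := chern_prodMap (I := I) (N := stage Γ) (n := n) h.1 hf contDiff_id hm (x := x) ht v
  rw [deriv_id, Complex.ofReal_one, one_mul] at this
  exact this

/-- `P` and `Q` are `CS`-zero-homotopic: reflexivity. -/
lemma CSZeroHomotopic.refl {P : M → BUZ} (hP : IsSmooth I P) : CSZeroHomotopic I P P :=
  ⟨_, isHomotopy_refl hP⟩

lemma CSZeroHomotopic.symm {P Q : M → BUZ} (h : CSZeroHomotopic I P Q) :
    CSZeroHomotopic I Q P := by
  obtain ⟨Γ, hΓ, h0⟩ := h
  obtain ⟨h1, h2⟩ := isHomotopy_symm hΓ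
  exact ⟨_, h1, fun n x v => by rw [h2, h0, neg_zero]⟩

lemma CSZeroHomotopic.trans [IsManifold I ∞ M] {P Q R : M → BUZ} (h : CSZeroHomotopic I P Q)
    (h' : CSZeroHomotopic I Q R) : CSZeroHomotopic I P R := by
  obtain ⟨Γ, hΓ, h0⟩ := h
  obtain ⟨Γ', hΓ', h0'⟩ := h'
  obtain ⟨h1, h2⟩ := isHomotopy_trans hΓ hΓ'
  exact ⟨_, h1, fun n x v => by rw [h2, h0, h0', add_zero]⟩

end Homotopy

/-! ### Pullbacks of alternating maps -/

section Alternating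

variable {E F X : Type*} [NormedAddCommGroup E] [NormedSpace ℝ E] [NormedAddCommGroup F]
  [NormedSpace ℝ F] [NormedAddCommGroup X] [NormedSpace ℝ X] {k : ℕ}

/-- Alternatization as a continuous linear map. -/
def alternatizationL : ContinuousMultilinearMap ℝ (fun _ : Fin k => E) ℂ →L[ℝ] E [⋀^Fin k]→L[ℝ] ℂ :=
  LinearMap.mkContinuous
    { toFun := fun f => ContinuousMultilinearMap.alternatization f
      map_add' := fun f g => map_add _ _ _
      map_smul' := fun c f => by
        ext v
        simp [ContinuousMultilinearMap.alternatization_apply_apply, Finset.mul_sum,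
          mul_left_comm, Units.smul_def] }
    (k.factorial : ℝ) fun f => by
      refine ContinuousAlternatingMap.opNorm_le_bound _ (by positivity) fun v => ?_
      simp only [LinearMap.coe_mk, AddHom.coe_mk,
        ContinuousMultilinearMap.alternatization_apply_apply]
      refine (norm_sum_le _ _).trans ?_
      have : ∀ σ ∈ (Finset.univ : Finset (Equiv.Perm (Fin k))),
          ‖Equiv.Perm.sign σ • f (v ∘ σ)‖ ≤ ‖f‖ * ∏ i, ‖v i‖ := by
        intro σ _
        have h1 : ‖Equiv.Perm.sign σ • f (v ∘ σ)‖ = ‖f (v ∘ σ)‖ := by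
          rcases Int.units_eq_one_or (Equiv.Perm.sign σ) with h | h <;> rw [h] <;> simp
        rw [h1, ← Equiv.prod_comp σ fun i => ‖v i‖]
        exact f.le_opNorm _
      refine (Finset.sum_le_card_nsmul _ _ _ this).trans ?_
      rw [Finset.card_univ, Fintype.card_perm, Fintype.card_fin, nsmul_eq_mul, mul_assoc]

lemma alternatizationL_coe (g : E [⋀^Fin k]→L[ℝ] ℂ) :
    alternatizationL g.toContinuousMultilinearMap = (k.factorial : ℝ) • g := by
  ext v
  change ContinuousMultilinearMap.alternatization g.toContinuousMultilinearMap v = _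
  rw [ContinuousMultilinearMap.alternatization_apply_apply]
  have : ∀ σ ∈ (Finset.univ : Finset (Equiv.Perm (Fin k))),
      Equiv.Perm.sign σ • g.toContinuousMultilinearMap (v ∘ σ) = g v := by
    intro σ _
    have h : g.toContinuousMultilinearMap (v ∘ σ) = Equiv.Perm.sign σ • g v :=
      g.toAlternatingMap.map_perm v σ
    rw [h, smul_smul, Int.units_mul_self, one_smul]
  rw [Finset.sum_congr rfl this]
  simp [Fintype.card_perm]

lemma contDiff_alternatizationL :
    ContDiff ℝ ∞ (alternatizationL : ContinuousMultilinearMap ℝ (fun _ : Fin k => E) ℂ → _) :=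
  ContinuousLinearMap.contDiff _

/-- The pullback is written as `1/k!` times the alternatization of the multilinear pullback. The
latter is continuous multilinear in the copies of `L` and linear in `g`, so joint smoothness
follows. -/
lemma ContDiffWithinAt.compContinuousLinearMap {g : X → F [⋀^Fin k]→L[ℝ] ℂ} {L : X → E →L[ℝ] F}
    {s : Set X} {x : X} (hg : ContDiffWithinAt ℝ ∞ g s x) (hL : ContDiffWithinAt ℝ ∞ L s x) :
    ContDiffWithinAt ℝ ∞ (fun y => (g y).compContinuousLinearMap (L y)) s x := by
  have e : (fun y => (g y).compContinuousLinearMap (L y)) = fun y => ((k.factorial : ℝ)⁻¹) •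
      alternatizationL (ContinuousMultilinearMap.compContinuousLinearMapContinuousMultilinear ℝ
        (fun _ : Fin k => E) (fun _ => F) ℂ (fun _ => L y)
        (ContinuousAlternatingMap.toContinuousMultilinearMapCLM ℝ (g y))) := by
    funext y
    have h := alternatizationL_coe ((g y).compContinuousLinearMap (L y))
    rw [eq_inv_smul_iff₀ (by positivity), ← h]
    rfl
  rw [e]
  refine ContDiffWithinAt.const_smul _ ?_
  refine contDiff_alternatizationL.comp_contDiffWithinAt ?_
  refine ContDiffWithinAt.clm_apply ?_ ?_
  · exact (ContinuousMultilinearMap.contDiff _).comp_contDiffWithinAt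
      (contDiffWithinAt_pi.2 fun _ => hL)
  · exact (ContinuousAlternatingMap.toContinuousMultilinearMapCLM
      (F := ℂ) ℝ).contDiff.comp_contDiffWithinAt hg

end Alternating

/-! ### Exact forms -/

section Exact

variable {E : Type*} [NormedAddCommGroup E] [NormedSpace ℝ E] {H : Type*} [TopologicalSpace H]
  {I : ModelWithCorners ℝ E H} {M : Type*} [TopologicalSpace M] [ChartedSpace H M]
  {E' : Type*} [NormedAddCommGroup E'] [NormedSpace ℝ E'] {H' : Type*} [TopologicalSpace H']
  {I' : ModelWithCorners ℝ E' H'} {M' : Type*} [TopologicalSpace M'] [ChartedSpace H' M']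
  {k : ℕ}

lemma formInChart_zero (x₀ : M) : formInChart (k := k) I (fun _ => 0) x₀ = fun _ => 0 := rfl

lemma IsExact.zero : IsExact (k := k) I (fun (_ : M) _ => 0) := by
  refine ⟨fun _ => 0, fun x₀ => ?_, fun x v => ?_⟩
  · rw [formInChart_zero]
    exact contDiffOn_const
  · rw [extD, formInChart_zero, extDerivWithin]
    have h : fderivWithin ℝ (fun _ : E => (0 : E [⋀^Fin k]→L[ℝ] ℂ)) (Set.range I)
        (extChartAt I x x) = 0 := by rw [fderivWithin_fun_const]; rfl
    rw [h]
    change ContinuousAlternatingMap.alternatizeUncurryFin _ _ = _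
    rw [ContinuousAlternatingMap.alternatizeUncurryFin_apply]
    exact Finset.sum_eq_zero fun i _ => smul_zero _

/-- Smoothness of forms is stated on chart targets, while `extD` differentiates within `range I`;
near points of the target these are the same. -/
lemma IsSmoothForm.contDiffWithinAt {β : ∀ x : M, TangentSpace I x [⋀^Fin k]→L[ℝ] ℂ}
    (hβ : IsSmoothForm I β) (x₀ : M) {y : E} (hy : y ∈ (extChartAt I x₀).target) :
    ContDiffWithinAt ℝ ∞ (formInChart I β x₀) (Set.range I) y :=
  (hβ x₀ y hy).mono_of_mem_nhdsWithin (by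
    have h := extChartAt_target_mem_nhdsWithin' (I := I) ((extChartAt I x₀).map_target hy)
    rwa [(extChartAt I x₀).right_inv hy] at h)

lemma IsExact.add {α α' : ∀ x : M, (Fin (k + 1) → TangentSpace I x) → ℂ} (h : IsExact I α)
    (h' : IsExact I α') : IsExact I (fun x v => α x v + α' x v) := by
  obtain ⟨β, hβ, hd⟩ := h
  obtain ⟨β', hβ', hd'⟩ := h'
  have e : ∀ x₀, formInChart I (fun x => β x + β' x) x₀ =
      fun y => formInChart I β x₀ y + formInChart I β' x₀ y := fun x₀ => rfl
  refine ⟨fun x => β x + β' x, fun x₀ => ?_, fun x v => ?_⟩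
  · rw [e]
    exact (hβ x₀).add (hβ' x₀)
  · have hx := mem_extChartAt_target (I := I) x
    change extD I _ x v = α x v + α' x v
    rw [← hd, ← hd', extD, e, extDerivWithin_fun_add
      (I.uniqueDiffOn _ (extChartAt_target_subset_range x hx))
      ((hβ.contDiffWithinAt x hx).differentiableWithinAt (by simp))
      ((hβ'.contDiffWithinAt x hx).differentiableWithinAt (by simp))]
    rfl

lemma IsExact.neg {α : ∀ x : M, (Fin (k + 1) → TangentSpace I x) → ℂ} (h : IsExact I α) :
    IsExact I (fun x v => -α x v) := by
  obtain ⟨β, hβ, hd⟩ := h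
  have e : ∀ x₀, formInChart I (fun x => (-1 : ℝ) • β x) x₀ =
      fun y => (-1 : ℝ) • formInChart I β x₀ y := fun x₀ => rfl
  refine ⟨fun x => (-1 : ℝ) • β x, fun x₀ => ?_, fun x v => ?_⟩
  · rw [e]
    exact (hβ x₀).const_smul _
  · have hx := mem_extChartAt_target (I := I) x
    change extD I _ x v = -α x v
    rw [← hd, extD, e, extDerivWithin_fun_smul _ _
      (I.uniqueDiffOn _ (extChartAt_target_subset_range x hx))]
    change (-1 : ℝ) • extD I β x v = _
    simp

/-- The pullback of a differential form. -/
def pullForm (I : ModelWithCorners ℝ E H) (I' : ModelWithCorners ℝ E' H') (f : M → M')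
    (β : ∀ x : M', TangentSpace I' x [⋀^Fin k]→L[ℝ] ℂ) (x : M) :
    TangentSpace I x [⋀^Fin k]→L[ℝ] ℂ :=
  (β (f x)).compContinuousLinearMap (mfderiv I I' f x)

variable [IsManifold I ∞ M] [IsManifold I' ∞ M']

lemma contDiffWithinAt_chart {f : M → M'} (hf : ContMDiff I I' ∞ f) (x₀ : M) (z₀ : M') {y : E}
    (hy : y ∈ (extChartAt I x₀).target)
    (hz : f ((extChartAt I x₀).symm y) ∈ (extChartAt I' z₀).source) :
    ContDiffWithinAt ℝ ∞ (extChartAt I' z₀ ∘ f ∘ (extChartAt I x₀).symm) (Set.range I) y := by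
  rw [extChartAt_source] at hz
  rw [← contMDiffWithinAt_iff_contDiffWithinAt]
  exact (contMDiffAt_extChartAt' hz).comp_contMDiffWithinAt y
    (hf.contMDiffAt.comp_contMDiffWithinAt y (contMDiffWithinAt_extChartAt_symm_range x₀ hy))

lemma fderivWithin_chart {f : M → M'} (hf : ContMDiff I I' ∞ f) (x₀ : M) (z₀ : M') {y : E}
    (hy : y ∈ (extChartAt I x₀).target)
    (hz : f ((extChartAt I x₀).symm y) ∈ (extChartAt I' z₀).source) (v : E) :
    fderivWithin ℝ (extChartAt I' z₀ ∘ f ∘ (extChartAt I x₀).symm) (Set.range I) y v =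
      mfderiv I' 𝓘(ℝ, E') (extChartAt I' z₀) (f ((extChartAt I x₀).symm y))
        (mfderiv I I' f ((extChartAt I x₀).symm y)
          (mfderivWithin 𝓘(ℝ, E) I (extChartAt I x₀).symm (Set.range I) y v)) := by
  have hu : UniqueMDiffWithinAt 𝓘(ℝ, E) (Set.range I) y :=
    (I.uniqueDiffOn _ (extChartAt_target_subset_range x₀ hy)).uniqueMDiffWithinAt
  have : IsManifold I 1 M := .of_le (n := ∞) (by simp)
  have : IsManifold I' 1 M' := .of_le (n := ∞) (by simp)
  have hz' := hz
  rw [extChartAt_source] at hz'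
  have h1 := (mdifferentiableWithinAt_extChartAt_symm (I := I) hy).hasMFDerivWithinAt
  have h2 := (hf.mdifferentiable (by simp) ((extChartAt I x₀).symm y)).hasMFDerivAt
  have h3 := (mdifferentiableAt_extChartAt (I := I') hz').hasMFDerivAt
  have h := (h3.comp_hasMFDerivWithinAt y (h2.comp_hasMFDerivWithinAt y h1)).mfderivWithin hu
  rw [← mfderivWithin_eq_fderivWithin]
  exact DFunLike.congr_fun h v

/-- In coordinates the pullback of a form is the pullback along the coordinate expression of `f`:
the derivative of the chart at `z₀` and that of its inverse cancel. -/
lemma formInChart_pullForm {f : M → M'} (hf : ContMDiff I I' ∞ f)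
    (β : ∀ x : M', TangentSpace I' x [⋀^Fin k]→L[ℝ] ℂ) (x₀ : M) (z₀ : M') {y : E}
    (hy : y ∈ (extChartAt I x₀).target)
    (hz : f ((extChartAt I x₀).symm y) ∈ (extChartAt I' z₀).source) :
    formInChart I (pullForm I I' f β) x₀ y =
      (formInChart I' β z₀ ((extChartAt I' z₀ ∘ f ∘ (extChartAt I x₀).symm) y)).compContinuousLinearMap
        (fderivWithin ℝ (extChartAt I' z₀ ∘ f ∘ (extChartAt I x₀).symm) (Set.range I) y) := by
  have : IsManifold I' 1 M' := .of_le (n := ∞) (by simp)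
  ext v
  let b : M' → E' [⋀^Fin k]→L[ℝ] ℂ := β
  have e := (extChartAt I' z₀).left_inv hz
  have hc := mfderivWithin_extChartAt_symm_comp_mfderiv_extChartAt' (I := I') hz
  change b (f ((extChartAt I x₀).symm y)) _ = b ((extChartAt I' z₀).symm _) _
  simp only [Function.comp_apply]
  rw [e]
  congr 1
  funext i
  exact ((congrArg (mfderivWithin 𝓘(ℝ, E') I' (extChartAt I' z₀).symm (Set.range I')
    (extChartAt I' z₀ (f ((extChartAt I x₀).symm y)))) (fderivWithin_chart hf x₀ z₀ hy hz (v i))).trans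
    (DFunLike.congr_fun hc _)).symm

omit [IsManifold I' ∞ M'] in
lemma eventually_chart {f : M → M'} (hf : Continuous f) (x₀ : M) (z₀ : M') {y : E}
    (hy : y ∈ (extChartAt I x₀).target)
    (hz : f ((extChartAt I x₀).symm y) ∈ (extChartAt I' z₀).source) :
    ∀ᶠ y' in nhdsWithin y (Set.range I), y' ∈ (extChartAt I x₀).target ∧
      f ((extChartAt I x₀).symm y') ∈ (extChartAt I' z₀).source := by
  refine Filter.Eventually.and (extChartAt_target_mem_nhdsWithin_of_mem hy) ?_
  have h := (contMDiffWithinAt_extChartAt_symm_range (I := I) (n := ∞) x₀ hy).continuousWithinAt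
  exact (hf.continuousAt.comp_continuousWithinAt h).preimage_mem_nhdsWithin
    ((isOpen_extChartAt_source z₀).mem_nhds hz)

lemma IsSmoothForm.pullForm {f : M → M'} (hf : ContMDiff I I' ∞ f)
    {β : ∀ x : M', TangentSpace I' x [⋀^Fin k]→L[ℝ] ℂ} (hβ : IsSmoothForm I' β) :
    IsSmoothForm I (pullForm I I' f β) := by
  intro x₀ y hy
  refine ContDiffWithinAt.mono (t := (extChartAt I x₀).target) (s := Set.range I) ?_
    (extChartAt_target_subset_range x₀)
  have hr := extChartAt_target_subset_range x₀ hy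
  -- Smoothness is local, so the chart of the target manifold may be chosen anew for each point `y`.
  set z₀ := f ((extChartAt I x₀).symm y) with hz₀
  have hz : f ((extChartAt I x₀).symm y) ∈ (extChartAt I' z₀).source := mem_extChartAt_source z₀
  have hF := contDiffWithinAt_chart hf x₀ z₀ hy hz
  refine ContDiffWithinAt.congr_of_eventuallyEq (ContDiffWithinAt.compContinuousLinearMap
    (ContDiffWithinAt.comp (t := Set.range I') y
      (hβ.contDiffWithinAt z₀ ((extChartAt I' z₀).map_source hz)) hF ?_)
      (hF.fderivWithin_right I.uniqueDiffOn (by simp) hr)) ?_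
    (formInChart_pullForm hf β x₀ z₀ hy hz)
  · intro w _
    exact ⟨_, rfl⟩
  · filter_upwards [eventually_chart hf.continuous x₀ z₀ hy hz] with w hw
    exact formInChart_pullForm hf β x₀ z₀ hw.1 hw.2

/-- Naturality of the exterior derivative, reduced through `formInChart_pullForm` to
`extDerivWithin_pullback` on the model spaces. -/
lemma extD_pullForm {f : M → M'} (hf : ContMDiff I I' ∞ f)
    {β : ∀ x : M', TangentSpace I' x [⋀^Fin k]→L[ℝ] ℂ} (hβ : IsSmoothForm I' β) (x : M)
    (v : Fin (k + 1) → TangentSpace I x) :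
    extD I (KTheory.pullForm I I' f β) x v =
      extD I' β (f x) (fun i => mfderiv I I' f x (v i)) := by
  have : IsManifold I 1 M := .of_le (n := ∞) (by simp)
  have hx := mem_extChartAt_target (I := I) x
  have hr := extChartAt_target_subset_range x hx
  have e := (extChartAt I x).left_inv (mem_extChartAt_source (I := I) x)
  have hz : f ((extChartAt I x).symm (extChartAt I x x)) ∈ (extChartAt I' (f x)).source := by
    rw [e]; exact mem_extChartAt_source _
  have hF := contDiffWithinAt_chart hf x (f x) hx hz
  have heq : formInChart I (KTheory.pullForm I I' f β) x
      =ᶠ[nhdsWithin (extChartAt I x x) (Set.range I)] fun y =>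
      (formInChart I' β (f x) ((extChartAt I' (f x) ∘ f ∘ (extChartAt I x).symm) y)).compContinuousLinearMap
        (fderivWithin ℝ (extChartAt I' (f x) ∘ f ∘ (extChartAt I x).symm) (Set.range I) y) := by
    filter_upwards [eventually_chart hf.continuous x (f x) hx hz] with w hw
    exact formInChart_pullForm hf β x (f x) hw.1 hw.2
  have eF : (extChartAt I' (f x) ∘ f ∘ (extChartAt I x).symm) (extChartAt I x x) =
      extChartAt I' (f x) (f x) := by
    simp only [Function.comp_apply, e]
  have hd : DifferentiableWithinAt ℝ (formInChart I' β (f x)) (Set.range I')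
      ((extChartAt I' (f x) ∘ f ∘ (extChartAt I x).symm) (extChartAt I x x)) := by
    rw [eF]
    exact (hβ.contDiffWithinAt (f x) (mem_extChartAt_target _)).differentiableWithinAt (by simp)
  rw [extD, heq.extDerivWithin_eq_of_mem hr, extDerivWithin_pullback hd hF
    (by rw [minSmoothness_of_isRCLikeNormedField]; exact WithTop.coe_le_coe.2 le_top)
    I.uniqueDiffOn (I.range_subset_closure_interior hr) hr (fun w _ => ⟨_, rfl⟩), eF, extD]
  change extDerivWithin _ _ _ _ = extDerivWithin _ _ _ _
  congr 1
  funext i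
  change fderivWithin ℝ _ _ _ (mfderiv I 𝓘(ℝ, E) _ _ (v i)) = mfderiv I' 𝓘(ℝ, E') _ _ _
  have hc := DFunLike.congr_fun (mfderivWithin_extChartAt_symm_comp_mfderiv_extChartAt' (I := I)
    (mem_extChartAt_source (I := I) x)) (v i)
  refine (fderivWithin_chart hf x (f x) hx hz _).trans ?_
  -- Going to the chart and back returns `x` only up to a propositional equality, on which the
  -- tangent space depends; it is therefore eliminated for a general `x'`.
  have h2 : ∀ (x' : M), x' = x → ∀ w w' : E, w = w' →
      (mfderiv I' 𝓘(ℝ, E') (extChartAt I' (f x)) (f x') (mfderiv I I' f x' w) : E') =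
      mfderiv I' 𝓘(ℝ, E') (extChartAt I' (f x)) (f x) (mfderiv I I' f x w') := by
    rintro _ rfl _ _ rfl; rfl
  exact h2 _ e _ _ hc

lemma IsExact.comp {α : ∀ x : M', (Fin (k + 1) → TangentSpace I' x) → ℂ} (h : IsExact I' α)
    {f : M → M'} (hf : ContMDiff I I' ∞ f) :
    IsExact I (fun x v => α (f x) (fun i => mfderiv I I' f x (v i))) := by
  obtain ⟨β, hβ, hd⟩ := h
  exact ⟨pullForm I I' f β, hβ.pullForm hf, fun x v => by
    rw [extD_pullForm hf hβ]; exact hd _ _⟩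

omit [IsManifold I ∞ M] in
lemma CSZeroHomotopic.csEquiv {P Q : M → BUZ} (h : CSZeroHomotopic I P Q) : CSEquiv I P Q := by
  obtain ⟨Γ, hΓ, h0⟩ := h
  refine ⟨Γ, hΓ, fun n => ?_⟩
  have e : CS I Γ n = fun _ _ => 0 := funext fun x => funext fun v => h0 n x v
  rw [e]
  exact IsExact.zero

omit [IsManifold I ∞ M] in
lemma CSEquiv.refl {P : M → BUZ} (hP : IsSmooth I P) : CSEquiv I P P :=
  (CSZeroHomotopic.refl hP).csEquiv

omit [IsManifold I ∞ M] in
lemma CSEquiv.symm {P Q : M → BUZ} (h : CSEquiv I P Q) : CSEquiv I Q P := by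
  obtain ⟨Γ, hΓ, h0⟩ := h
  obtain ⟨h1, h2⟩ := isHomotopy_symm hΓ
  refine ⟨_, h1, fun n => ?_⟩
  have e := funext fun x => funext fun v => h2 n x v
  exact e ▸ (h0 n).neg

lemma CSEquiv.trans {P Q R : M → BUZ} (h : CSEquiv I P Q) (h' : CSEquiv I Q R) :
    CSEquiv I P R := by
  obtain ⟨Γ, hΓ, h0⟩ := h
  obtain ⟨Γ', hΓ', h0'⟩ := h'
  obtain ⟨h1, h2⟩ := isHomotopy_trans hΓ hΓ'
  refine ⟨_, h1, fun n => ?_⟩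
  have e := funext fun x => funext fun v => h2 n x v
  exact e ▸ (h0 n).add (h0' n)

lemma CSEquiv.comp {P Q : M' → BUZ} (h : CSEquiv I' P Q) {f : M → M'} (hf : ContMDiff I I' ∞ f) :
    CSEquiv I (fun x => P (f x)) (fun x => Q (f x)) := by
  obtain ⟨Γ, hΓ, h0⟩ := h
  obtain ⟨h1, h2⟩ := isHomotopy_comp hΓ hf
  refine ⟨_, h1, fun n => ?_⟩
  have e := funext fun x => funext fun v => h2 n x v
  exact e ▸ (h0 n).comp hf

end Exact

/-! ### Stages -/

lemma end_apply_eq_sum (A : Module.End ℂ V) (x : V) (S : Finset ℤ) (hS : ∀ i ∉ S, x i = 0) :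
    A x = ∑ i ∈ S, x i • A (Finsupp.single i 1) := by
  have hs : x.support ⊆ S := fun i hi => by
    by_contra h
    exact (Finsupp.mem_support_iff.1 hi) (hS i h)
  conv_lhs => rw [← Finsupp.sum_single x, Finsupp.sum_of_support_subset _ hs _ (by simp), map_sum]
  refine Finset.sum_congr rfl fun i _ => ?_
  rw [← map_smul, Finsupp.smul_single, smul_eq_mul, mul_one]

/-- The finite-dimensional range of `P - I_0` is spanned by finitely many finitely supported
vectors, so outside a window the rows of `P` are those of `I_0`. Hermitian symmetry gives the same
for the columns. -/
lemma BUZ.exists_stage (P : BUZ) : ∃ N : ℕ, P.InStage (-(N : ℤ)) N := by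
  have hfg : (LinearMap.range (P.op - I0op)).FG := Module.Finite.iff_fg.1 P.finite_rank
  obtain ⟨T, hT⟩ := hfg
  have hN : ∃ N : ℕ, ∀ x ∈ T, ∀ i : ℤ, (i < -N ∨ (N : ℤ) ≤ i) → x i = 0 := by
    refine ⟨(T.sup fun x => x.support.sup fun i => i.natAbs) + 1, fun x hx i hi => ?_⟩
    by_contra h
    have h1 := Finset.le_sup (f := fun i : ℤ => i.natAbs) (Finsupp.mem_support_iff.2 h)
    have h2 := Finset.le_sup (f := fun x : V => x.support.sup fun i => i.natAbs) hx
    omega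
  obtain ⟨N, hN⟩ := hN
  have hle : LinearMap.range (P.op - I0op) ≤ between (-N) N := by
    rw [← hT, Submodule.span_le]
    exact fun x hx => mem_between.2 fun i hi => hN x hx i hi
  have key : ∀ i j : ℤ, (i < -N ∨ (N : ℤ) ≤ i) → P.entry i j = I0.entry i j := fun i j hi => by
    have h := mem_between.1 (hle ⟨Finsupp.single j 1, rfl⟩) i hi
    rw [LinearMap.sub_apply, Finsupp.sub_apply, sub_eq_zero] at h
    exact h
  have key' : ∀ i j : ℤ, (j < -N ∨ (N : ℤ) ≤ j) → P.entry i j = I0.entry i j := fun i j hj => by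
    rw [← P.entry_conj, key j i hj, I0.entry_conj]
  refine ⟨N, (P.inStage_iff_entry _ _).2 ⟨fun i j hj => ?_, fun i j hj => ?_⟩⟩
  · rw [key' i j (Or.inl hj), I0_inStage.entry_low (Or.inr (by omega))]
  · rw [key' i j (Or.inr hj), I0_inStage.entry_high (Or.inr (by omega))]

lemma BUZ.InStage.op_eq_sum {P : BUZ} {p q : ℤ} (h : P.InStage p q) {x : V}
    (hx : ∀ i < p, x i = 0) :
    P.op x = ∑ j ∈ Finset.Ico p q, x j • P.op (Finsupp.single j 1) := by
  rw [end_apply_eq_sum P.op x (x.support ∪ Finset.Ico p q) fun i hi => by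
    rw [Finset.mem_union, not_or] at hi
    exact Finsupp.notMem_support_iff.1 hi.1]
  refine (Finset.sum_subset Finset.subset_union_right fun i _ hi => ?_).symm
  rw [Finset.mem_Ico, not_and_or, not_le, not_lt] at hi
  rcases hi with hi | hi
  · rw [hx i hi, zero_smul]
  · rw [h.op_high hi, smul_zero]

/-! ### Paths of isometries -/

/-- A smooth path of isometries `e_i ↦ v_i(t)` of `ℂ^ℤ_cpt` fixing all `e_i` with `i` small. -/
structure IsoPath where
  col : ℝ → ℤ → V
  dcol : ℝ → ℤ → V
  -- The vector `row t a` is the image of `e_a` under the adjoint. It is part of the data because a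
  -- matrix with finite columns may have infinite rows, while the adjoint must again act on finitely
  -- supported sequences.
  row : ℝ → ℤ → V
  adj : ∀ t a i, row t a i = (starRingEnd ℂ) (col t i a)
  orth : ∀ t i j, inn (col t i) (col t j) = if i = j then 1 else 0
  low : ℤ
  col_low : ∀ t, ∀ i < low, col t i = Finsupp.single i 1
  -- The bound is uniform in `t`, so that a moved `P` remains in one stage throughout the homotopy.
  bound : ∀ N : ℤ, ∃ N' : ℕ, ∀ t, ∀ i < N, col t i ∈ below N'
  hasDeriv : ∀ t i a, HasDerivAt (fun t => col t i a) (dcol t i a) t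
  smooth : ∀ i a, ContDiff ℝ ∞ fun t => col t i a

namespace IsoPath

variable (𝓐 : IsoPath)

/-- The isometry at time `t`. -/
def map (t : ℝ) : Module.End ℂ V := Finsupp.linearCombination ℂ (𝓐.col t)

/-- The adjoint of the isometry at time `t`. -/
def adjMap (t : ℝ) : Module.End ℂ V := Finsupp.linearCombination ℂ (𝓐.row t)

lemma map_single (t : ℝ) (i : ℤ) : 𝓐.map t (Finsupp.single i 1) = 𝓐.col t i := by
  simp [map]

lemma adjMap_single (t : ℝ) (i : ℤ) : 𝓐.adjMap t (Finsupp.single i 1) = 𝓐.row t i := by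
  simp [adjMap]

lemma isAdj (t : ℝ) : IsAdj (𝓐.map t) (𝓐.adjMap t) :=
  isAdj_of_entries fun i j => by rw [map_single, adjMap_single, 𝓐.adj]

lemma adjMap_mul_map (t : ℝ) : 𝓐.adjMap t * 𝓐.map t = 1 := by
  refine end_ext fun j => Finsupp.ext fun i => ?_
  have h : inn (Finsupp.single i 1) (𝓐.adjMap t (𝓐.map t (Finsupp.single j 1))) =
      if i = j then 1 else 0 := by
    rw [← 𝓐.isAdj t, map_single, map_single, 𝓐.orth]
  rw [inn_single_left, map_one, one_mul] at h
  rw [Module.End.mul_apply, h, Module.End.one_apply, Finsupp.single_apply]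
  simp [eq_comm]

lemma adjMap_map (t : ℝ) (x : V) : 𝓐.adjMap t (𝓐.map t x) = x :=
  LinearMap.congr_fun (𝓐.adjMap_mul_map t) x

/-- Since `U e_i = e_i` and `U* U = 1`, also `U* e_i = e_i`. Hence the other columns have no
component along `e_i`. -/
lemma row_low (t : ℝ) {i : ℤ} (hi : i < 𝓐.low) : 𝓐.row t i = Finsupp.single i 1 := by
  have h := 𝓐.adjMap_map t (Finsupp.single i 1)
  rwa [map_single, 𝓐.col_low t i hi, adjMap_single] at h

lemma col_apply_low (t : ℝ) {i a : ℤ} (ha : a < 𝓐.low) (hai : a ≠ i) : 𝓐.col t i a = 0 := by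
  have h := 𝓐.adj t a i
  rw [𝓐.row_low t ha, Finsupp.single_apply, if_neg hai] at h
  simpa using h.symm

variable {𝓐} in
lemma op_low {P : BUZ} {p q : ℤ} (h : P.InStage p q) (hp : p ≤ 𝓐.low) (t : ℝ) {i : ℤ}
    (hi : i < p) : (𝓐.map t * P.op * 𝓐.adjMap t) (Finsupp.single i 1) = Finsupp.single i 1 := by
  rw [Module.End.mul_apply, Module.End.mul_apply, adjMap_single, 𝓐.row_low t (by omega),
    h.op_low hi, map_single, 𝓐.col_low t i (by omega)]

variable {𝓐} in
-- The columns with labels below `q` have no component along `e_a`, so `U* e_a` is supported on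
-- labels `≥ q`, where `P` vanishes.
lemma op_high {P : BUZ} {p q N : ℤ} (h : P.InStage p q) (t : ℝ)
    (hb : ∀ i < q, 𝓐.col t i ∈ below N) {a : ℤ} (ha : N ≤ a) :
    (𝓐.map t * P.op * 𝓐.adjMap t) (Finsupp.single a 1) = 0 := by
  have hrow : ∀ i < q, 𝓐.row t a i = 0 := fun i hi => by
    rw [𝓐.adj, mem_below.1 (hb i hi) a ha, map_zero]
  rw [Module.End.mul_apply, Module.End.mul_apply, adjMap_single,
    h.op_eq_sum fun i hi => hrow i (lt_of_lt_of_le hi h.le), Finset.sum_eq_zero, map_zero]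
  intro j hj
  rw [hrow j (Finset.mem_Ico.1 hj).2, zero_smul]

/-- The action of a path of isometries on `BU × ℤ`. -/
def act (P : BUZ) (t : ℝ) : BUZ where
  op := 𝓐.map t * P.op * 𝓐.adjMap t
  hermitian := by
    have := ((𝓐.isAdj t).mul P.isAdj).mul (𝓐.isAdj t).symm
    rwa [← mul_assoc] at this
  idem := by
    calc 𝓐.map t * P.op * 𝓐.adjMap t * (𝓐.map t * P.op * 𝓐.adjMap t)
        = 𝓐.map t * P.op * (𝓐.adjMap t * 𝓐.map t) * P.op * 𝓐.adjMap t := by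
          simp only [mul_assoc]
      _ = 𝓐.map t * (P.op * P.op) * 𝓐.adjMap t := by
          rw [adjMap_mul_map]; simp only [mul_assoc, one_mul]
      _ = _ := by rw [P.idem]
  finite_rank := by
    obtain ⟨N, hN⟩ := P.exists_stage
    obtain ⟨N', hN'⟩ := 𝓐.bound N
    have hs : P.InStage (min (-N) 𝓐.low) N := hN.mono (min_le_left _ _) le_rfl
    have hadj := ((𝓐.isAdj t).mul P.isAdj).mul (𝓐.isAdj t).symm
    rw [← mul_assoc] at hadj
    refine finiteDimensional_range _ (Set.Ico (min (-N) 𝓐.low) (max N' 0)) (Set.finite_Ico _ _)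
      fun i hi => ?_
    rw [Set.mem_Ico, not_and_or, not_le, not_lt] at hi
    rw [LinearMap.sub_apply, I0op_single]
    rcases hi with hi | hi
    · rw [op_low hs (min_le_right _ _) t hi, if_pos (by omega), sub_self]
    · rw [op_high hs (N := max N' 0) t (fun j hj => ?_) hi,
        if_neg (by omega), sub_zero]
      exact mem_below.2 fun a ha => mem_below.1 (hN' t j hj) a (by omega)

variable {𝓐} in
lemma act_inStage {P : BUZ} {p q N : ℤ} (h : P.InStage p q) (hp : p ≤ 𝓐.low) (t : ℝ)
    (hb : ∀ i < q, 𝓐.col t i ∈ below N) : (𝓐.act P t).InStage p N :=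
  (BUZ.inStage_iff _ _ _).2 ⟨fun _ hi => op_low h hp t hi, fun _ hi => op_high h t hb hi⟩

variable {𝓐} in
-- The ranges of summation do not depend on `t` or on the point of `M`, so the entries of the moved
-- `P` are finite sums of products of smooth functions.
lemma act_entry {P : BUZ} {p q : ℤ} (h : P.InStage p q) (hp : p ≤ 𝓐.low) (t : ℝ) {a b : ℤ}
    (hb : p ≤ b) : (𝓐.act P t).entry a b =
      ∑ j ∈ Finset.Ico p q, (∑ i ∈ Finset.Ico p q, 𝓐.col t i a * P.entry i j) * 𝓐.row t b j := by
  have hrow : ∀ i < p, 𝓐.row t b i = 0 := fun i hi => by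
    rw [𝓐.adj, 𝓐.col_low t i (by omega), Finsupp.single_apply, if_neg (by omega), map_zero]
  change 𝓐.map t (P.op (𝓐.adjMap t (Finsupp.single b 1))) a = _
  rw [adjMap_single, h.op_eq_sum hrow, map_sum, Finsupp.finsetSum_apply]
  refine Finset.sum_congr rfl fun j hj => ?_
  rw [map_smul, Finsupp.smul_apply, smul_eq_mul, mul_comm]
  congr 1
  rw [Finset.mem_Ico] at hj
  rw [end_apply_eq_sum _ _ (Finset.Ico p q) fun i hi => ?_, Finsupp.finsetSum_apply]
  · refine Finset.sum_congr rfl fun i _ => ?_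
    rw [map_single, Finsupp.smul_apply, smul_eq_mul, mul_comm]
    rfl
  · rw [Finset.mem_Ico, not_and_or, not_le, not_lt] at hi
    change P.entry i j = 0
    rcases hi with hi | hi
    · rw [h.entry_low (Or.inl hi), if_neg (by omega)]
    · exact h.entry_high (Or.inl hi)

end IsoPath

/-! ### Vanishing of Chern-Simons forms -/

section Vanish

variable {E : Type*} [NormedAddCommGroup E] [NormedSpace ℝ E] {H : Type*} [TopologicalSpace H]
  {I : ModelWithCorners ℝ E H} {M : Type*} [TopologicalSpace M] [ChartedSpace H M]
  {ι κ : Type*}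

lemma ContMDiff.mul_complex {f g : M → ℂ} (hf : ContMDiff I 𝓘(ℝ, ℂ) ∞ f)
    (hg : ContMDiff I 𝓘(ℝ, ℂ) ∞ g) : ContMDiff I 𝓘(ℝ, ℂ) ∞ fun x => f x * g x :=
  (contDiff_fst.mul contDiff_snd : ContDiff ℝ ∞ fun p : ℂ × ℂ => p.1 * p.2).contMDiff.comp
    (hf.prodMk_space hg)

lemma dS_time_snd {f : ℝ → ℂ} {f' : ℂ} {x : M} {t : ℝ} (hf : HasDerivAt f f' t)
    (ht : t ∈ Set.Icc (0 : ℝ) 1) (v : E) (c : ℝ) :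
    dS (I.prod 𝓘(ℝ, ℝ)) (fun y : M × ℝ => f y.2) (cylinder M) (x, t) ((v, c) : E × ℝ) = c * f' := by
  have hu := uniqueMDiff_cylinder I (mem_cylinder.2 ht : (x, t) ∈ cylinder M)
  have hd : MDifferentiableAt 𝓘(ℝ, ℝ) 𝓘(ℝ, ℂ) f t := hf.differentiableAt.mdifferentiableAt
  refine (dS_comp (I' := 𝓘(ℝ, ℝ)) (s' := Set.univ) hu hd.mdifferentiableWithinAt
    mdifferentiableWithinAt_snd (Set.mapsTo_univ _ _) _).trans
    ((congrArg (fun L : E × ℝ →L[ℝ] ℝ => dS 𝓘(ℝ, ℝ) f Set.univ t (L (v, c)))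
      (mfderivWithin_snd hu)).trans ?_)
  change dS 𝓘(ℝ, ℝ) f Set.univ t c = _
  change (mfderivWithin 𝓘(ℝ, ℝ) 𝓘(ℝ, ℂ) f Set.univ t c : ℂ) = _
  rw [mfderivWithin_univ, mfderiv_eq_fderiv, hf.hasFDerivAt.fderiv]
  change c • f' = c * f'
  simp

variable (I) in
/-- The derivative of a matrix valued function on the cylinder in the direction `(v, c)`. -/
def dMc (G : M × ℝ → Matrix ι κ ℂ) (x : M) (t : ℝ) (v : E) (c : ℝ) : Matrix ι κ ℂ :=
  dM (I.prod 𝓘(ℝ, ℝ)) G (cylinder M) (x, t) ((v, c) : E × ℝ)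

variable (I) in
/-- The derivative of a matrix valued function on `M`. -/
def dMb (F : M → Matrix ι κ ℂ) (x : M) (v : E) : Matrix ι κ ℂ := dM I F Set.univ x v

lemma dMc_time {F : ℝ → Matrix ι κ ℂ} {F' : Matrix ι κ ℂ} {x : M} {t : ℝ}
    (hF : ∀ i j, HasDerivAt (fun t => F t i j) (F' i j) t)
    (ht : t ∈ Set.Icc (0 : ℝ) 1) (v : E) (c : ℝ) :
    dMc I (fun y => F y.2) x t v c = (c : ℂ) • F' := by
  ext i j
  exact dS_time_snd (hF i j) ht v c

lemma MDM.time_snd {F : ℝ → Matrix ι κ ℂ} {F' : Matrix ι κ ℂ} {x : M} {t : ℝ}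
    (hF : ∀ i j, HasDerivAt (fun t => F t i j) (F' i j) t) :
    MDM (I.prod 𝓘(ℝ, ℝ)) (fun y : M × ℝ => F y.2) (cylinder M) (x, t) := fun i j =>
  MDifferentiableAt.comp_mdifferentiableWithinAt (I' := 𝓘(ℝ, ℝ)) (x, t)
    (hF i j).differentiableAt.mdifferentiableAt mdifferentiableWithinAt_snd

lemma dMc_base {F : M → Matrix ι κ ℂ} (hF : ∀ i j, MDifferentiable I 𝓘(ℝ, ℂ) fun x => F x i j)
    {x : M} {t : ℝ} (ht : t ∈ Set.Icc (0 : ℝ) 1) (v : E) (c : ℝ) :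
    dMc I (fun y => F y.1) x t v c = dMb I F x v := by
  ext i j
  exact dS_time_fst (hF i j) ht v c

lemma MDM.time_fst {F : M → Matrix ι κ ℂ} (hF : ∀ i j, MDifferentiable I 𝓘(ℝ, ℂ) fun x => F x i j)
    {p : M × ℝ} : MDM (I.prod 𝓘(ℝ, ℝ)) (fun y : M × ℝ => F y.1) (cylinder M) p := fun i j =>
  MDifferentiableAt.comp_mdifferentiableWithinAt (I' := I) p (hF i j p.1)
    mdifferentiableWithinAt_fst

lemma dMb_zero (F : M → Matrix ι κ ℂ) (x : M) : dMb I F x 0 = 0 := by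
  ext i j
  exact dS_zero _ _ x

lemma dMb_mul [Fintype κ] {l : Type*} {F : M → Matrix ι κ ℂ} {G : M → Matrix κ l ℂ} {x : M}
    (hF : ∀ i j, MDifferentiable I 𝓘(ℝ, ℂ) fun x => F x i j)
    (hG : ∀ i j, MDifferentiable I 𝓘(ℝ, ℂ) fun x => G x i j) (v : E) :
    dMb I (fun y => F y * G y) x v = dMb I F x v * G x + F x * dMb I G x v :=
  dM_mul (uniqueMDiffWithinAt_univ I) (fun i j => (hF i j x).mdifferentiableWithinAt)
    (fun i j => (hG i j x).mdifferentiableWithinAt) v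

lemma dMb_const (A : Matrix ι κ ℂ) (x : M) (v : E) : dMb I (fun _ => A) x v = 0 :=
  dM_const A _ x v

lemma dMc_mul [Fintype κ] {l : Type*} {F : M × ℝ → Matrix ι κ ℂ} {G : M × ℝ → Matrix κ l ℂ}
    {x : M} {t : ℝ} (hF : MDM (I.prod 𝓘(ℝ, ℝ)) F (cylinder M) (x, t))
    (hG : MDM (I.prod 𝓘(ℝ, ℝ)) G (cylinder M) (x, t)) (ht : t ∈ Set.Icc (0 : ℝ) 1) (v : E) (c : ℝ) :
    dMc I (fun y => F y * G y) x t v c = dMc I F x t v c * G (x, t) + F (x, t) * dMc I G x t v c :=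
  dM_mul (uniqueMDiff_cylinder I (mem_cylinder.2 ht)) hF hG _

/-- Only `U` and `Z` depend on time and only `F` on the point of `M`, so the two components of the
direction `(w, c)` act on separate terms. -/
lemma dMc_sandwich [Fintype ι] {U : ℝ → Matrix κ ι ℂ} {Z : ℝ → Matrix ι κ ℂ}
    {U' : Matrix κ ι ℂ} {Z' : Matrix ι κ ℂ} {F : M → Matrix ι ι ℂ} {x : M} {t : ℝ}
    (hU : ∀ i j, HasDerivAt (fun t => U t i j) (U' i j) t)
    (hZ : ∀ i j, HasDerivAt (fun t => Z t i j) (Z' i j) t)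
    (hF : ∀ i j, MDifferentiable I 𝓘(ℝ, ℂ) fun x => F x i j) (ht : t ∈ Set.Icc (0 : ℝ) 1)
    (w : E) (c : ℝ) :
    dMc I (fun y : M × ℝ => U y.2 * F y.1 * Z y.2) x t w c =
      ((c : ℂ) • U' * F x * Z t + U t * F x * ((c : ℂ) • Z')) + U t * dMb I F x w * Z t := by
  rw [dMc_mul (F := fun y : M × ℝ => U y.2 * F y.1) (G := fun y : M × ℝ => Z y.2)
    (MDM.mul (F := fun y : M × ℝ => U y.2) (G := fun y : M × ℝ => F y.1) (MDM.time_snd hU)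
    (MDM.time_fst hF)) (MDM.time_snd hZ) ht, dMc_mul (F := fun y : M × ℝ => U y.2)
    (G := fun y : M × ℝ => F y.1) (MDM.time_snd hU) (MDM.time_fst hF) ht,
    dMc_time hU ht, dMc_time hZ ht, dMc_base hF ht, Matrix.add_mul]
  abel

/-- The Chern-Simons form vanishes in the presence of involutions that commute with `Γ` and that
commute or anticommute with its derivatives in an odd way. -/
lemma CS_eq_zero_of_involution [Fintype ι] [DecidableEq ι] {Γ : M × ℝ → BUZ} {N : ℕ}
    (hN : ∀ y ∈ cylinder M, (Γ y).InStage (-(N : ℤ)) N) (g : ι → ℤ) (hg : Function.Injective g)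
    (hgN : ∀ i, -(N : ℤ) ≤ g i ∧ g i < N)
    (hc : ∀ a b, (a ∉ Set.range g ∨ b ∉ Set.range g) → ∃ c, ∀ y ∈ cylinder M, (Γ y).entry a b = c)
    (G : M × ℝ → Matrix ι ι ℂ) (hG : ∀ y ∈ cylinder M, blk g (Γ y) = G y)
    (x : M) (c₀ c₁ : ℂ) (hcc : ∀ n : ℕ, c₀ * c₁ ^ (2 * n + 1) = -1)
    (h : ∀ t ∈ Set.Icc (0 : ℝ) 1, ∃ ε : Matrix ι ι ℂ, ε * ε = 1 ∧ ε * G (x, t) = G (x, t) * ε ∧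
      ε * dMc I G x t 0 1 = c₀ • (dMc I G x t 0 1 * ε) ∧
      ∀ v : E, ε * dMc I G x t v 0 = c₁ • (dMc I G x t v 0 * ε))
    (n : ℕ) (v : Fin (2 * n + 1) → TangentSpace I x) : CS I Γ n x v = 0 := by
  refine CS_eq_zero_of hN n x v fun t ht => ?_
  have hx : (x, t) ∈ cylinder M := mem_cylinder.2 ht
  obtain ⟨ε, h1, h2, h3, h4⟩ := h t ht
  rw [chern_eq_chernM g hg N n hgN Γ _ _ hx hc]
  have e : chernM (I.prod 𝓘(ℝ, ℝ)) (n + 1) (fun y => blk g (Γ y)) (cylinder M) (x, t)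
      (cylVec I n x t v) =
      chernM (I.prod 𝓘(ℝ, ℝ)) (n + 1) G (cylinder M) (x, t) (cylVec I n x t v) := by
    rw [chernM, chernM, hG _ hx]
    congr 2
    funext i
    exact dM_congr _ hx hG
  rw [e]
  refine chernM_eq_zero_of _ _ _ _ _ (altTrace_eq_zero (m := 2 * n + 2) _ _ ε h1 h2
    (Fin.cons c₀ fun _ => c₁ : Fin (2 * n + 2) → ℂ) (fun i => ?_) ?_)
  · refine Fin.cases ?_ (fun j => ?_) i
    · exact h3
    · exact h4 (v j)
  · rw [Fin.prod_univ_succ]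
    simpa using hcc n

end Vanish

/-! ### The reflection in the image of an isometry, with `Z` in the role of the adjoint of `U`. -/

section Involution

variable {ι κ : Type*} [Fintype ι] [DecidableEq ι] [Fintype κ]
  {U U' : Matrix κ ι ℂ} {Z Z' : Matrix ι κ ℂ} {D p : Matrix ι ι ℂ}

lemma isometry_mul_left (hZU : Z * U = 1) (hp : D * p = p) (Y : Matrix ι κ ℂ) :
    U * D * Z * (U * p * Y) = U * p * Y := by
  calc U * D * Z * (U * p * Y) = U * (D * (Z * U) * p) * Y := by simp only [Matrix.mul_assoc]
    _ = _ := by rw [hZU, Matrix.mul_one, hp]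

lemma isometry_mul_right (hZU : Z * U = 1) (hp : p * D = p) (Y : Matrix κ ι ℂ) :
    Y * p * Z * (U * D * Z) = Y * p * Z := by
  calc Y * p * Z * (U * D * Z) = Y * (p * (Z * U) * D) * Z := by simp only [Matrix.mul_assoc]
    _ = _ := by rw [hZU, Matrix.mul_one, hp]

lemma involution_mul_self [DecidableEq κ] (hZU : Z * U = 1) (hDD : D * D = D) :
    ((2 : ℂ) • (U * D * Z) - 1) * ((2 : ℂ) • (U * D * Z) - 1) = 1 := by
  have h := isometry_mul_left hZU hDD Z
  rw [Matrix.sub_mul, Matrix.mul_sub, Matrix.smul_mul, Matrix.mul_smul, h, Matrix.mul_one,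
    Matrix.one_mul]
  module

lemma involution_commute [DecidableEq κ] (hZU : Z * U = 1) (hDp : D * p = p) (hpD : p * D = p) :
    ((2 : ℂ) • (U * D * Z) - 1) * (U * p * Z) = U * p * Z * ((2 : ℂ) • (U * D * Z) - 1) := by
  rw [Matrix.sub_mul, Matrix.mul_sub, Matrix.smul_mul, Matrix.mul_smul,
    isometry_mul_left hZU hDp, isometry_mul_right hZU hpD, Matrix.mul_one, Matrix.one_mul]

/-- Horizontality says that the velocity `U'` moves the image of `D` orthogonally to the image of `U
D`. With respect to the eigenspaces of the reflection `2 U D Z - 1` the derivative of `U p Z` is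
therefore off-diagonal. -/
lemma involution_anticommute [DecidableEq κ] (hZU : Z * U = 1) (hDp : D * p = p) (hpD : p * D = p)
    (h : D * (Z * U') * D = 0) (h' : D * (Z' * U) * D = 0) :
    ((2 : ℂ) • (U * D * Z) - 1) * (U' * p * Z + U * p * Z') =
      (-1 : ℂ) • ((U' * p * Z + U * p * Z') * ((2 : ℂ) • (U * D * Z) - 1)) := by
  have e1 : U * D * Z * (U' * p * Z) = 0 := by
    calc U * D * Z * (U' * p * Z) = U * D * Z * (U' * (D * p) * Z) := by rw [hDp]
      _ = U * (D * (Z * U') * D) * p * Z := by simp only [Matrix.mul_assoc]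
      _ = 0 := by rw [h, Matrix.mul_zero, Matrix.zero_mul, Matrix.zero_mul]
  have e2 : U * p * Z' * (U * D * Z) = 0 := by
    calc U * p * Z' * (U * D * Z) = U * (p * D) * Z' * (U * D * Z) := by rw [hpD]
      _ = U * p * (D * (Z' * U) * D) * Z := by simp only [Matrix.mul_assoc]
      _ = 0 := by rw [h', Matrix.mul_zero, Matrix.zero_mul]
  rw [Matrix.sub_mul, Matrix.mul_sub, Matrix.smul_mul, Matrix.mul_smul, Matrix.mul_add,
    Matrix.add_mul, e1, e2, isometry_mul_left hZU hDp, isometry_mul_right hZU hpD, Matrix.mul_one,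
    Matrix.one_mul]
  module

end Involution

/-! ### Vanishing of Chern–Simons forms for horizontal paths of isometries. -/

section Act

variable {E : Type*} [NormedAddCommGroup E] [NormedSpace ℝ E] {H : Type*} [TopologicalSpace H]
  {I : ModelWithCorners ℝ E H} {M : Type*} [TopologicalSpace M] [ChartedSpace H M]

namespace IsoPath

variable {𝓐 : IsoPath}

lemma hasDeriv_row (t : ℝ) (a i : ℤ) :
    HasDerivAt (fun t => 𝓐.row t a i) ((starRingEnd ℂ) (𝓐.dcol t i a)) t := by
  simp only [𝓐.adj]
  exact (𝓐.hasDeriv t i a).star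

lemma smooth_row (a i : ℤ) : ContDiff ℝ ∞ fun t => 𝓐.row t a i := by
  simp only [𝓐.adj]
  exact Complex.conjCLE.contDiff.comp (𝓐.smooth i a)

/-- The reflection in the image under `U` of the span of the `e_i`, `i ∉ B`, commutes with `U P U*`
and `U dP U*` and, by horizontality, anticommutes with the time derivative. As `P` vanishes on the
`e_b` with `b ∈ B`, horizontality is needed only between labels outside `B`; this freedom is what
admits rotations into a free vector. -/
lemma isHomotopy_act {P : M → BUZ} (hP : IsSmooth I P) (B : Set ℤ)
    (hB : ∀ x, ∀ b ∈ B, (P x).op (Finsupp.single b 1) = 0)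
    (hor : ∀ t, ∀ i ∉ B, ∀ j ∉ B, inn (𝓐.col t i) (𝓐.dcol t j) = 0) :
    IsHomotopy I (fun y => 𝓐.act (P y.1) y.2) (fun x => 𝓐.act (P x) 0) (fun x => 𝓐.act (P x) 1) ∧
      ∀ n x v, CS I (fun y => 𝓐.act (P y.1) y.2) n x v = 0 := by
  classical
  obtain ⟨N₀, hN₀⟩ := hP.exists_stage
  obtain ⟨N, hN, hlow⟩ : ∃ N : ℕ, N₀ ≤ N ∧ -(N : ℤ) ≤ 𝓐.low :=
    ⟨max N₀ (-𝓐.low).toNat, le_max_left _ _, by omega⟩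
  have hs : ∀ x, (P x).InStage (-(N : ℤ)) N := fun x => (hN₀ x).mono (by omega) (by omega)
  obtain ⟨N₁, hN₁⟩ := 𝓐.bound N
  obtain ⟨N', hN', hb⟩ : ∃ N' : ℕ, N ≤ N' ∧ ∀ t, ∀ i < (N : ℤ), 𝓐.col t i ∈ below N' :=
    ⟨max N N₁, le_max_left _ _, fun t i hi => mem_below.2 fun a ha =>
      mem_below.1 (hN₁ t i hi) a (by omega)⟩
  have hst : ∀ y : M × ℝ, (𝓐.act (P y.1) y.2).InStage (-(N : ℤ)) N' := fun y =>
    act_inStage (hs y.1) hlow y.2 (hb y.2)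
  have hst' : ∀ y : M × ℝ, (𝓐.act (P y.1) y.2).InStage (-(N' : ℤ)) N' := fun y =>
    (hst y).mono (by omega) le_rfl
  have hsmooth : IsSmoothOn (I.prod 𝓘(ℝ, ℝ)) (fun y : M × ℝ => 𝓐.act (P y.1) y.2) (cylinder M) := by
    refine ⟨⟨N', fun y _ => hst' y⟩, fun a b => ?_⟩
    by_cases hab : -(N : ℤ) ≤ b
    · simp only [act_entry (hs _) hlow _ hab]
      have hc : ∀ i a, ContMDiff (I.prod 𝓘(ℝ, ℝ)) 𝓘(ℝ, ℂ) ∞ fun y : M × ℝ => 𝓐.col y.2 i a :=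
        fun i a => (𝓐.smooth i a).contMDiff.comp contMDiff_snd
      have hr : ∀ i a, ContMDiff (I.prod 𝓘(ℝ, ℝ)) 𝓘(ℝ, ℂ) ∞ fun y : M × ℝ => 𝓐.row y.2 i a :=
        fun i a => (smooth_row i a).contMDiff.comp contMDiff_snd
      have hp : ∀ i j, ContMDiff (I.prod 𝓘(ℝ, ℝ)) 𝓘(ℝ, ℂ) ∞ fun y : M × ℝ => (P y.1).entry i j :=
        fun i j => (hP.contMDiff i j).comp contMDiff_fst
      exact (contMDiff_finsetSum fun j _ => ContMDiff.mul_complex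
        (contMDiff_finsetSum fun i _ => ContMDiff.mul_complex (hc i a) (hp i j))
        (hr b j)).contMDiffOn
    · refine contMDiffOn_const (c := if a = b then (1 : ℂ) else 0) |>.congr fun y _ => ?_
      exact (hst y).entry_low (Or.inr (by omega))
  refine ⟨⟨hsmooth, fun _ => rfl, fun _ => rfl⟩, fun n x v => ?_⟩
  -- The matrix of the isometry is rectangular: `ι` labels the window on which `P` varies, `κ` the
  -- larger window that contains the moved vectors at all times.
  let κ := Finset.Ico (-(N : ℤ)) N'
  let ι := Finset.Ico (-(N : ℤ)) N
  let p : M → Matrix ι ι ℂ := fun x => blk Subtype.val (P x)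
  let D : Matrix ι ι ℂ := Matrix.diagonal fun i => if i.1 ∈ B then 0 else 1
  let U : ℝ → Matrix κ ι ℂ := fun t => Matrix.of fun a i => 𝓐.col t i a
  let U' : ℝ → Matrix κ ι ℂ := fun t => Matrix.of fun a i => 𝓐.dcol t i a
  let Z : ℝ → Matrix ι κ ℂ := fun t => Matrix.of fun i a => 𝓐.row t a i
  let Z' : ℝ → Matrix ι κ ℂ := fun t => Matrix.of fun i a => (starRingEnd ℂ) (𝓐.dcol t i a)
  have hcollow : ∀ t (i : ι) a, a ∉ Finset.Ico (-(N : ℤ)) N' → 𝓐.col t i a = 0 := fun t i a ha => by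
    have hi := Finset.mem_Ico.1 i.2
    rw [Finset.mem_Ico, not_and_or, not_le, not_lt] at ha
    rcases ha with ha | ha
    · exact 𝓐.col_apply_low t (by omega) (by omega)
    · exact mem_below.1 (hb t i hi.2) a ha
  have hinn : ∀ t (i : ι) (y : V), inn (𝓐.col t i) y = ∑ a : κ, 𝓐.row t a i * y a := by
    intro t i y
    rw [inn_eq _ _ (Finset.Ico (-(N : ℤ)) N'), ← Finset.sum_coe_sort]
    · simp only [𝓐.adj]
      rfl
    · intro a ha
      by_contra h
      exact (Finsupp.mem_support_iff.1 ha) (hcollow t i a h)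
  have hZU : ∀ t, Z t * U t = 1 := fun t => by
    ext i j
    rw [Matrix.mul_apply, Matrix.one_apply]
    refine (hinn t i (𝓐.col t j)).symm.trans ((𝓐.orth t i j).trans ?_)
    by_cases hij : i = j
    · rw [hij, if_pos rfl, if_pos rfl]
    · rw [if_neg hij, if_neg fun h => hij (Subtype.ext h)]
  have hZU' : ∀ t, D * (Z t * U' t) * D = 0 := fun t => by
    ext i j
    rw [Matrix.mul_diagonal, Matrix.diagonal_mul, Matrix.mul_apply]
    have h1 := hinn t i (𝓐.dcol t j)
    by_cases hi : i.1 ∈ B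
    · simp [hi]
    by_cases hj : j.1 ∈ B
    · simp [hj]
    rw [hor t i hi j hj] at h1
    simp only [if_neg hi, if_neg hj, one_mul, mul_one]
    exact h1.symm
  -- This is the conjugate transpose of the preceding relation.
  have hZ'U : ∀ t, D * (Z' t * U t) * D = 0 := fun t => by
    have h := congrArg Matrix.conjTranspose (hZU' t)
    have hD : D.conjTranspose = D := by
      rw [Matrix.diagonal_conjTranspose]
      congr 1
      funext i
      by_cases hi : i.1 ∈ B <;> simp [hi]
    have e1 : (Z t).conjTranspose = U t := by
      ext a i
      change (starRingEnd ℂ) (𝓐.row t a i) = 𝓐.col t i a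
      rw [𝓐.adj, Complex.conj_conj]
    have e2 : (U' t).conjTranspose = Z' t := rfl
    rw [Matrix.conjTranspose_mul, Matrix.conjTranspose_mul, Matrix.conjTranspose_mul, hD, e1, e2,
      Matrix.conjTranspose_zero] at h
    exact (Matrix.mul_assoc _ _ _).trans h
  have hDD : D * D = D := by
    rw [Matrix.diagonal_mul_diagonal]
    congr 1
    funext i
    by_cases hi : i.1 ∈ B <;> simp [hi]
  have hpB : ∀ x (i j : ι), (i.1 ∈ B ∨ j.1 ∈ B) → p x i j = 0 := by
    have h1 : ∀ x (i j : ι), j.1 ∈ B → (P x).entry i j = 0 := fun x i j hj => by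
      rw [BUZ.entry, hB x _ hj, Finsupp.zero_apply]
    intro x i j hij
    rcases hij with hi | hj
    · change (P x).entry i j = 0
      rw [← (P x).entry_conj, h1 x j i hi, map_zero]
    · exact h1 x i j hj
  have hpD : ∀ x, p x * D = p x := fun x => by
    ext i j
    rw [Matrix.mul_diagonal]
    by_cases hj : j.1 ∈ B
    · simp [hpB x i j (Or.inr hj)]
    · simp [hj]
  have hDp : ∀ x, D * p x = p x := fun x => by
    ext i j
    rw [Matrix.diagonal_mul]
    by_cases hj : i.1 ∈ B
    · simp [hpB x i j (Or.inl hj)]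
    · simp [hj]
  have hpd : ∀ i j, MDifferentiable I 𝓘(ℝ, ℂ) fun x => p x i j := fun i j =>
    (hP.contMDiff i j).mdifferentiable (by simp)
  have hUd : ∀ t i j, HasDerivAt (fun t => U t i j) (U' t i j) t := fun t i j => 𝓐.hasDeriv t j i
  have hZd : ∀ t i j, HasDerivAt (fun t => Z t i j) (Z' t i j) t := fun t i j => hasDeriv_row t j i
  have hdpD : ∀ w : E, dMb I p x w * D = dMb I p x w := fun w => by
    have h := dMb_mul (G := fun _ => D) (x := x) hpd (fun i j => mdifferentiable_const) w
    rw [dMb_const, Matrix.mul_zero, add_zero] at h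
    exact h.symm.trans (congrArg (fun q => dMb I q x w) (funext hpD))
  have hDdp : ∀ w : E, D * dMb I p x w = dMb I p x w := fun w => by
    have h := dMb_mul (F := fun _ => D) (x := x) (fun i j => mdifferentiable_const) hpd w
    rw [dMb_const, Matrix.zero_mul, zero_add] at h
    exact h.symm.trans (congrArg (fun q => dMb I q x w) (funext hDp))
  have hdG : ∀ t ∈ Set.Icc (0 : ℝ) 1, ∀ (w : E) (c : ℝ),
      dMc I (fun y : M × ℝ => U y.2 * p y.1 * Z y.2) x t w c =
      ((c : ℂ) • U' t * p x * Z t + U t * p x * ((c : ℂ) • Z' t)) +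
        U t * dMb I p x w * Z t :=
    fun t ht w c => dMc_sandwich (hUd t) (hZd t) hpd ht w c
  -- The sign is `-1` for the single time derivative and `1` for all spatial ones.
  refine CS_eq_zero_of_involution (fun y _ => hst' y) (Subtype.val : κ → ℤ) Subtype.val_injective
    (fun i => ?_) (fun a b hab => ?_) (fun y => U y.2 * p y.1 * Z y.2) (fun y _ => ?_) x (-1) 1
    (by simp) (fun t ht => ⟨(2 : ℂ) • (U t * D * Z t) - 1,
      involution_mul_self (hZU t) hDD, involution_commute (hZU t) (hDp x) (hpD x), ?_, fun w => ?_⟩) n v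
  · have := Finset.mem_Ico.1 i.2
    omega
  · have aux : ∀ a, a ∉ Set.range (Subtype.val : κ → ℤ) → a < -N ∨ (N' : ℤ) ≤ a := fun a ha => by
      by_contra h
      exact ha ⟨⟨a, Finset.mem_Ico.2 (by omega)⟩, rfl⟩
    by_cases h : (a < -N ∨ b < -N)
    · exact ⟨_, fun y _ => (hst y).entry_low h⟩
    · exact ⟨0, fun y _ => (hst y).entry_high (by
        rcases hab with hab | hab
        · have := aux a hab
          omega
        · have := aux b hab
          omega)⟩
  · ext a b
    change (𝓐.act (P y.1) y.2).entry a b = _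
    rw [act_entry (hs _) hlow _ (Finset.mem_Ico.1 b.2).1, Matrix.mul_apply, ← Finset.sum_coe_sort]
    refine Finset.sum_congr rfl fun j _ => ?_
    rw [Matrix.mul_apply, ← Finset.sum_coe_sort]
    rfl
  · rw [hdG t ht, dMb_zero, Complex.ofReal_one, one_smul, one_smul, Matrix.mul_zero, Matrix.zero_mul,
      add_zero]
    exact involution_anticommute (hZU t) (hDp x) (hpD x) (hZU' t) (hZ'U t)
  · rw [hdG t ht, Complex.ofReal_zero, zero_smul, zero_smul, Matrix.mul_zero, Matrix.zero_mul,
      Matrix.zero_mul, zero_add, zero_add, one_smul]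
    exact involution_commute (hZU t) (hDdp w) (hdpD w)

end IsoPath

end Act

/-! ### Paths of isometries with two coefficients -/

/-- The path of isometries `e_i ↦ C_i(t) e_i + S_i(t) e_{σ i}`. -/
def twoTerm (σ : Equiv.Perm ℤ) (C S : ℤ → ℝ → ℝ) (hC : ∀ i, ContDiff ℝ ∞ (C i))
    (hS : ∀ i, ContDiff ℝ ∞ (S i)) (unit : ∀ i t, C i t * C i t + S i t * S i t = 1)
    -- Besides the products of equal labels, columns `i` and `j` meet only where `σ j = i` or `σ i =
    -- j`; orthogonality asks that these contributions cancel.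
    (cross : ∀ i j t, (if σ j = i then C i t * S j t else 0) +
      (if σ i = j then S i t * C j t else 0) = 0)
    (low : ℤ) (hlow : ∀ i < low, ∀ t, C i t = 1 ∧ S i t = 0)
    (hσ : ∀ N : ℤ, ∃ N' : ℕ, ∀ i < N, i < N' ∧ σ i < N') : IsoPath where
  col t i := Finsupp.single i (C i t : ℂ) + Finsupp.single (σ i) (S i t : ℂ)
  dcol t i := Finsupp.single i ((deriv (C i) t : ℝ) : ℂ) +
    Finsupp.single (σ i) ((deriv (S i) t : ℝ) : ℂ)
  row t x := Finsupp.single x (C x t : ℂ) + Finsupp.single (σ⁻¹ x) (S (σ⁻¹ x) t : ℂ)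
  adj t x i := by
    simp only [Finsupp.add_apply, Finsupp.single_apply, map_add]
    congr 1
    · by_cases h : x = i
      · simp [h]
      · rw [if_neg h, if_neg (Ne.symm h), map_zero]
    · by_cases h : σ i = x
      · simp [← h]
      · rw [if_neg h, if_neg, map_zero]
        rintro rfl
        exact h (σ.apply_symm_apply x)
  orth t i j := by
    simp only [inn_add_left, inn_single_left, Finsupp.add_apply, Finsupp.single_apply,
      Complex.conj_ofReal, mul_add, mul_ite, mul_zero, σ.injective.eq_iff]
    have h := congrArg (fun r : ℝ => (r : ℂ)) (cross i j t)
    have hu := congrArg (fun r : ℝ => (r : ℂ)) (unit i t)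
    simp only [Complex.ofReal_add, apply_ite (fun r : ℝ => (r : ℂ)), Complex.ofReal_mul,
      Complex.ofReal_zero, Complex.ofReal_one] at h hu
    have e : (j = σ i) = (σ i = j) := propext eq_comm
    simp only [e]
    by_cases hij : i = j
    · subst hij
      simp only [if_true]
      linear_combination h + hu
    · rw [if_neg (Ne.symm hij), if_neg (Ne.symm hij), if_neg hij]
      linear_combination h
  low := low
  col_low t i hi := by simp [(hlow i hi t).1, (hlow i hi t).2]
  bound N := (hσ N).imp fun N' h t i hi =>
    Submodule.add_mem _ (single_mem_below (h i hi).1 _) (single_mem_below (h i hi).2 _)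
  hasDeriv t i x := by
    have hc := (((hC i).differentiable (by simp) t).hasDerivAt).ofReal_comp
    have hs := (((hS i).differentiable (by simp) t).hasDerivAt).ofReal_comp
    simp only [Finsupp.add_apply, Finsupp.single_apply]
    refine HasDerivAt.add ?_ ?_
    · split_ifs
      · exact hc
      · exact hasDerivAt_const t _
    · split_ifs
      · exact hs
      · exact hasDerivAt_const t _
  smooth i x := by
    have hc : ContDiff ℝ ∞ fun t => (C i t : ℂ) := Complex.ofRealCLM.contDiff.comp (hC i)
    have hs : ContDiff ℝ ∞ fun t => (S i t : ℂ) := Complex.ofRealCLM.contDiff.comp (hS i)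
    simp only [Finsupp.add_apply, Finsupp.single_apply]
    refine ContDiff.add ?_ ?_
    · split_ifs
      · exact hc
      · exact contDiff_const
    · split_ifs
      · exact hs
      · exact contDiff_const

/-- For `i = j` the contribution `C C' + S S'` vanishes by differentiating `unit`. Only the terms
with `σ j = i` or `σ i = j` remain, and these are the hypotheses. -/
lemma twoTerm_horizontal {σ : Equiv.Perm ℤ} {C S : ℤ → ℝ → ℝ} (hC hS unit cross low hlow hσ)
    {t : ℝ} {i j : ℤ} (h₁ : σ j = i → C i t * deriv (S j) t = 0)
    (h₂ : σ i = j → S i t * deriv (C j) t = 0) :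
    inn ((twoTerm σ C S hC hS unit cross low hlow hσ).col t i)
      ((twoTerm σ C S hC hS unit cross low hlow hσ).dcol t j) = 0 := by
  have hu : C i t * deriv (C i) t + S i t * deriv (S i) t = 0 := by
    have hc := ((hC i).differentiable (by simp) t).hasDerivAt
    have hs := ((hS i).differentiable (by simp) t).hasDerivAt
    have h1 := (hc.mul hc).add (hs.mul hs)
    have h2 : (fun t => C i t * C i t + S i t * S i t) = fun _ => 1 := funext (unit i)
    have h3 := h1.unique ((hasDerivAt_const t (1 : ℝ)).congr_of_eventuallyEq
      (Filter.Eventually.of_forall (congrFun h2)))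
    linear_combination h3 / 2
  dsimp only [twoTerm]
  simp only [inn_add_left, inn_single_left, Finsupp.add_apply, Finsupp.single_apply,
    Complex.conj_ofReal, mul_add, mul_ite, mul_zero, σ.injective.eq_iff]
  have h : (if σ j = i then C i t * deriv (S j) t else 0) +
      (if σ i = j then S i t * deriv (C j) t else 0) = 0 := by
    split_ifs with h3 h4 h4
    · rw [h₁ h3, h₂ h4, add_zero]
    · rw [h₁ h3, add_zero]
    · rw [h₂ h4, add_zero]
    · rw [add_zero]
  have h := congrArg (fun r : ℝ => (r : ℂ)) h
  have hu := congrArg (fun r : ℝ => (r : ℂ)) hu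
  simp only [Complex.ofReal_add, apply_ite (fun r : ℝ => (r : ℂ)), Complex.ofReal_mul,
    Complex.ofReal_zero] at h hu
  have e : (j = σ i) = (σ i = j) := propext eq_comm
  simp only [e]
  by_cases hij : i = j
  · subst hij
    simp only [if_true]
    linear_combination h + hu
  · rw [if_neg (Ne.symm hij), if_neg (Ne.symm hij)]
    linear_combination h

/-! ### Rotations in a coordinate plane -/

/-- The rotation by the angle `π t / 2` that moves `e_a` to `e_b`. -/
def rotation (a b : ℤ) (hab : a ≠ b) : IsoPath :=
  twoTerm (Equiv.swap a b)
    (fun i t => if i = a ∨ i = b then Real.cos (Real.pi / 2 * t) else 1)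
    (fun i t => if i = a then Real.sin (Real.pi / 2 * t) else
      if i = b then -Real.sin (Real.pi / 2 * t) else 0)
    (fun i => by split_ifs <;> fun_prop)
    (fun i => by split_ifs <;> fun_prop)
    (fun i t => by
      have h := Real.cos_sq_add_sin_sq (Real.pi / 2 * t)
      split_ifs with h1 h2 h3 h4 <;> first | linear_combination h | grind)
    (fun i j t => by
      by_cases hi : i = a
      · subst hi
        rw [Equiv.swap_apply_left]
        by_cases hj : j = b
        · subst hj
          simp [hab.symm, mul_comm]
        · rw [if_neg (Ne.symm hj), if_neg, add_zero]
          rw [Equiv.swap_apply_eq_iff, Equiv.swap_apply_left]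
          exact hj
      by_cases hi' : i = b
      · subst hi'
        rw [Equiv.swap_apply_right]
        by_cases hj : j = a
        · subst hj
          simp [hab.symm, mul_comm]
        · rw [if_neg (Ne.symm hj), if_neg, add_zero]
          rw [Equiv.swap_apply_eq_iff, Equiv.swap_apply_right]
          exact hj
      have e : (Equiv.swap a b j = i) = (j = i) := propext (by
        rw [Equiv.swap_apply_eq_iff, Equiv.swap_apply_of_ne_of_ne hi hi'])
      simp only [Equiv.swap_apply_of_ne_of_ne hi hi', e]
      by_cases hj : j = i
      · simp [hj, hi, hi']
      · rw [if_neg hj, if_neg (Ne.symm hj), add_zero])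
    (min a b)
    (fun i hi t => by
      rw [if_neg (by omega), if_neg (by omega), if_neg (by omega)]
      exact ⟨rfl, rfl⟩)
    (fun N => ⟨(max N (max (a + 1) (b + 1))).toNat, fun i hi => by
      rw [Equiv.swap_apply_def]
      split_ifs <;> omega⟩)

/-- A cross term between different labels would need the pair `{a, b}`, which is excluded once `b`
is avoided. -/
lemma rotation_horizontal {a b : ℤ} (hab : a ≠ b) (t : ℝ) {i j : ℤ} (hi : i ≠ b) (hj : j ≠ b) :
    inn ((rotation a b hab).col t i) ((rotation a b hab).dcol t j) = 0 := by
  have key : ∀ i j, i ≠ b → j ≠ b → Equiv.swap a b j = i → j ≠ a := fun i j hi hj h hja => by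
    rw [hja, Equiv.swap_apply_left] at h
    exact hi h.symm
  have h1 : ∀ i j, i ≠ b → j ≠ b → Equiv.swap a b j = i → (fun t : ℝ => if j = a then
      Real.sin (Real.pi / 2 * t) else if j = b then -Real.sin (Real.pi / 2 * t) else 0) =
      fun _ => 0 := fun i j hi hj h => by
    funext t
    rw [if_neg (key i j hi hj h), if_neg hj]
  refine twoTerm_horizontal _ _ _ _ _ _ _ (fun h => ?_) fun h => ?_
  · rw [h1 i j hi hj h, deriv_const, mul_zero]
  · rw [congrFun (h1 j i hj hi h) t, zero_mul]

lemma rotation_map_zero {a b : ℤ} (hab : a ≠ b) : (rotation a b hab).map 0 = 1 := by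
  refine end_ext fun i => ?_
  rw [IsoPath.map_single]
  simp [rotation, twoTerm]

lemma IsoPath.act_zero_of_map {𝓐 : IsoPath} {t : ℝ} (h : 𝓐.map t = 1) (P : BUZ) :
    𝓐.act P t = P := by
  have h' : 𝓐.adjMap t = 1 := by
    rw [← 𝓐.adjMap_mul_map t, h, mul_one]
  refine BUZ.ext ?_
  change 𝓐.map t * P.op * 𝓐.adjMap t = _
  rw [h, h', one_mul, mul_one]

/-! ### The path of isometries that frees a basis vector -/

/-- The angle of the `i`-th rotation in the shift path. -/
def shiftAngle (K i : ℤ) (t : ℝ) : ℝ :=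
  -- With `r = 2 ^ (i - K + 2)` the `i`-th rotation takes place for `t` between `1/r` and `2/r`,
  -- hence the next label finishes exactly when this one starts. All rotations are over at `t =
  -- 1/2`, and infinitely many accumulate at `t = 0`; this is harmless because each column is smooth
  -- and a given stage involves only finitely many varying ones.
  if i < K then 0 else Real.pi / 2 * Real.smoothTransition (t * 2 ^ ((i - K).toNat + 2) - 1)

lemma contDiff_shiftAngle (K i : ℤ) : ContDiff ℝ ∞ (shiftAngle K i) := by
  unfold shiftAngle
  split_ifs
  · exact contDiff_const
  · exact contDiff_const.mul (Real.smoothTransition.contDiff.comp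
      ((contDiff_id.mul contDiff_const).sub contDiff_const))

lemma hasDerivAt_shiftAngle (K i : ℤ) (t : ℝ) :
    HasDerivAt (shiftAngle K i) (deriv (shiftAngle K i) t) t :=
  ((contDiff_shiftAngle K i).differentiable (by simp) t).hasDerivAt

lemma shiftAngle_mem (K i : ℤ) (t : ℝ) : shiftAngle K i t ∈ Set.Icc 0 (Real.pi / 2) := by
  unfold shiftAngle
  split_ifs
  · exact ⟨le_rfl, by positivity⟩
  · exact ⟨mul_nonneg (by positivity) (Real.smoothTransition.nonneg _),
      mul_le_of_le_one_right (by positivity) (Real.smoothTransition.le_one _)⟩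

/-- The angle stays in `[0, π/2]`, so both of its end values are extrema and the derivative vanishes
there. -/
lemma deriv_shiftAngle_of_zero {K i : ℤ} {t : ℝ} (h : shiftAngle K i t = 0) :
    deriv (shiftAngle K i) t = 0 :=
  IsLocalMin.deriv_eq_zero (Filter.Eventually.of_forall fun s => h ▸ (shiftAngle_mem K i s).1)

lemma deriv_shiftAngle_of_pi_div_two {K i : ℤ} {t : ℝ} (h : shiftAngle K i t = Real.pi / 2) :
    deriv (shiftAngle K i) t = 0 :=
  IsLocalMax.deriv_eq_zero (Filter.Eventually.of_forall fun s => h ▸ (shiftAngle_mem K i s).2)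

/-- At any time, one of two neighbouring rotations is at one of its ends. -/
lemma shiftAngle_succ (K i : ℤ) (t : ℝ) :
    shiftAngle K i t = 0 ∨ shiftAngle K (i + 1) t = Real.pi / 2 := by
  unfold shiftAngle
  by_cases hi : i < K
  · simp [hi]
  rw [if_neg hi, if_neg (by omega)]
  have e : (i + 1 - K).toNat + 2 = ((i - K).toNat + 2) + 1 := by omega
  rw [e, pow_succ (2 : ℝ) ((i - K).toNat + 2)]
  -- The two arguments of the transition function are `t r - 1` and `2 t r - 1`: the first is still
  -- nonpositive when `t r ≤ 1`, and afterwards the second is at least `1`.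
  generalize (2 : ℝ) ^ ((i - K).toNat + 2) = r
  by_cases ht : t * r ≤ 1
  · left
    rw [Real.smoothTransition.zero_of_nonpos (by linarith), mul_zero]
  · right
    rw [Real.smoothTransition.one_of_one_le (by linarith), mul_one]

/-- A path of isometries from the identity to the isometry `e_i ↦ e_i` for `i < K`,
`e_i ↦ e_{i+1}` for `i ≥ K`. -/
def shiftPath (K : ℤ) : IsoPath :=
  twoTerm (Equiv.addRight 1) (fun i t => Real.cos (shiftAngle K i t))
    (fun i t => Real.sin (shiftAngle K i t))
    (fun i => Real.contDiff_cos.comp (contDiff_shiftAngle K i))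
    (fun i => Real.contDiff_sin.comp (contDiff_shiftAngle K i))
    (fun i t => by
      have h := Real.cos_sq_add_sin_sq (shiftAngle K i t)
      linear_combination h)
    (fun i j t => by
      have key : ∀ i, Real.cos (shiftAngle K (i + 1) t) * Real.sin (shiftAngle K i t) = 0 := by
        intro i
        rcases shiftAngle_succ K i t with h | h <;> simp [h]
      have k1 : Equiv.addRight 1 j = i →
          Real.cos (shiftAngle K i t) * Real.sin (shiftAngle K j t) = 0 := by
        rintro rfl
        exact key j
      have k2 : Equiv.addRight 1 i = j →
          Real.sin (shiftAngle K i t) * Real.cos (shiftAngle K j t) = 0 := by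
        rintro rfl
        exact (mul_comm _ _).trans (key i)
      split_ifs with h1 h2 h2
      · rw [k1 h1, k2 h2, add_zero]
      · rw [k1 h1, add_zero]
      · rw [k2 h2, add_zero]
      · rw [add_zero])
    K (fun i hi t => by simp [shiftAngle, hi])
    (fun N => ⟨(N + 1).toNat, fun i hi => by simp only [Equiv.coe_addRight]; omega⟩)

/-- Cross terms only join neighbouring labels. By `shiftAngle_succ` one of the two angles is at an
end, where the relevant sine, cosine or derivative of the angle is zero. No labels have to be
excluded. -/
lemma shiftPath_horizontal (K : ℤ) (t : ℝ) (i j : ℤ) :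
    inn ((shiftPath K).col t i) ((shiftPath K).dcol t j) = 0 := by
  have hs : deriv (fun t => Real.sin (shiftAngle K j t)) t =
      Real.cos (shiftAngle K j t) * deriv (shiftAngle K j) t :=
    (hasDerivAt_shiftAngle K j t).sin.deriv
  have hc : deriv (fun t => Real.cos (shiftAngle K j t)) t =
      -Real.sin (shiftAngle K j t) * deriv (shiftAngle K j) t :=
    (hasDerivAt_shiftAngle K j t).cos.deriv
  have k1 : j + 1 = i → Real.cos (shiftAngle K i t) * (Real.cos (shiftAngle K j t) *
      deriv (shiftAngle K j) t) = 0 := by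
    rintro rfl
    rcases shiftAngle_succ K j t with h | h
    · simp [deriv_shiftAngle_of_zero h]
    · simp [h]
  have k2 : i + 1 = j → Real.sin (shiftAngle K i t) * (-Real.sin (shiftAngle K j t) *
      deriv (shiftAngle K j) t) = 0 := by
    rintro rfl
    rcases shiftAngle_succ K i t with h | h
    · simp [h]
    · simp [deriv_shiftAngle_of_pi_div_two h]
  refine twoTerm_horizontal _ _ _ _ _ _ _ (fun h => ?_) fun h => ?_
  · rw [hs]
    exact k1 h
  · rw [hc]
    exact k2 h

lemma shiftAngle_zero (K i : ℤ) : shiftAngle K i 0 = 0 := by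
  unfold shiftAngle
  rw [Real.smoothTransition.zero_of_nonpos (by norm_num)]
  simp

lemma shiftAngle_one (K i : ℤ) : shiftAngle K i 1 = if i < K then 0 else Real.pi / 2 := by
  unfold shiftAngle
  have h : (1 : ℝ) ≤ 2 ^ (i - K).toNat := one_le_pow₀ (by norm_num)
  rw [Real.smoothTransition.one_of_one_le (by rw [pow_add]; linarith), mul_one]

lemma shiftPath_map_zero (K : ℤ) : (shiftPath K).map 0 = 1 := by
  refine end_ext fun i => ?_
  rw [IsoPath.map_single]
  simp [shiftPath, twoTerm, shiftAngle_zero]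

lemma shiftPath_col_one (K i : ℤ) :
    (shiftPath K).col 1 i = Finsupp.single (if i < K then i else i + 1) 1 := by
  dsimp only [shiftPath, twoTerm]
  rw [shiftAngle_one]
  split_ifs <;> simp

lemma shiftPath_row_one (K i : ℤ) : (shiftPath K).row 1 i =
    if i < K then Finsupp.single i 1 else if i = K then 0 else Finsupp.single (i - 1) 1 := by
  ext j
  rw [(shiftPath K).adj, shiftPath_col_one, Finsupp.single_apply]
  split_ifs with h1 h2 h3 h4 h5 h6 h7 h8 <;>
    first | omega | (rw [Finsupp.single_apply, if_pos (by omega), map_one]) |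
      (rw [Finsupp.single_apply, if_neg (by omega), map_zero]) | simp

/-! ### Exchanging two basis vectors -/

lemma IsoPath.act_op (𝓐 : IsoPath) (P : BUZ) (t : ℝ) :
    (𝓐.act P t).op = 𝓐.map t * P.op * 𝓐.adjMap t := rfl

lemma BUZ.conj_op (σ : Equiv.Perm ℤ) (h) (P : BUZ) :
    (P.conj σ h).op = relabel σ * P.op * relabel σ⁻¹ := rfl

lemma finite_swap (a b : ℤ) : {i | Equiv.swap a b i ≠ i}.Finite := by
  refine (Set.toFinite {a, b}).subset fun i hi => ?_
  by_contra h
  simp only [Set.mem_insert_iff, Set.mem_singleton_iff, not_or] at h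
  exact hi (Equiv.swap_apply_of_ne_of_ne h.1 h.2)

/-- Conjugation with the exchange of two basis vectors. -/
def BUZ.conjSwap (a b : ℤ) (P : BUZ) : BUZ := P.conj (Equiv.swap a b) (finite_swap a b)

lemma BUZ.conj_op_single (σ : Equiv.Perm ℤ) (h) (P : BUZ) (i : ℤ) :
    (P.conj σ h).op (Finsupp.single (σ i) 1) = relabel σ (P.op (Finsupp.single i 1)) := by
  rw [conj_op, Module.End.mul_apply, Module.End.mul_apply, relabel_single]
  change relabel σ (P.op (Finsupp.single (σ.symm (σ i)) 1)) = _
  rw [Equiv.symm_apply_apply]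

lemma BUZ.conjSwap_op_left {a b : ℤ} {P : BUZ} (h : P.op (Finsupp.single b 1) = 0) :
    (P.conjSwap a b).op (Finsupp.single a 1) = 0 := by
  have := P.conj_op_single (Equiv.swap a b) (finite_swap a b) b
  rwa [Equiv.swap_apply_right, h, map_zero] at this

/-- At `t = 1` the rotation differs from the exchange by a sign, as `e_b` goes to `-e_a`. Since `P`
kills `e_b`, and its range has no component along `e_b`, the sign is not seen. -/
lemma rotation_act_one {a b : ℤ} (hab : a ≠ b) {P : BUZ} (h : P.op (Finsupp.single b 1) = 0) :
    (rotation a b hab).act P 1 = P.conjSwap a b := by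
  have hcol : ∀ i, i ≠ b → (rotation a b hab).col 1 i =
      Finsupp.single (Equiv.swap a b i) 1 := fun i hi => by
    by_cases hia : i = a
    · simp [rotation, twoTerm, hia]
    · simp [rotation, twoTerm, hia, hi, Equiv.swap_apply_of_ne_of_ne hia hi]
  have hmap : ∀ x : V, x b = 0 → (rotation a b hab).map 1 x = relabel (Equiv.swap a b) x := by
    intro x hx
    rw [end_apply_eq_sum _ x x.support fun i hi => Finsupp.notMem_support_iff.1 hi,
      end_apply_eq_sum (relabel (Equiv.swap a b)) x x.support fun i hi =>
      Finsupp.notMem_support_iff.1 hi]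
    refine Finset.sum_congr rfl fun i hi => ?_
    rw [IsoPath.map_single, relabel_single, hcol i]
    rintro rfl
    exact (Finsupp.mem_support_iff.1 hi) hx
  have hb : ∀ x, P.op x b = 0 := fun x => by
    have h1 := P.hermitian (Finsupp.single b 1) x
    rw [h, inn_zero_left, inn_single_left] at h1
    simpa using h1.symm
  have hrow : ∀ i, P.op ((rotation a b hab).row 1 i) =
      P.op (Finsupp.single (Equiv.swap a b i) 1) := fun i => by
    by_cases hia : i = a
    · have h1 : (rotation a b hab).row 1 i = -Finsupp.single b 1 := by
        simp [rotation, twoTerm, hia, hab.symm]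
      rw [h1, map_neg, hia, Equiv.swap_apply_left, h, neg_zero]
    · by_cases hib : i = b
      · simp [rotation, twoTerm, hib]
      · simp [rotation, twoTerm, hia, hib, Equiv.swap_apply_of_ne_of_ne hia hib]
  refine BUZ.ext (end_ext fun i => ?_)
  rw [IsoPath.act_op, BUZ.conjSwap, BUZ.conj_op]
  simp only [Module.End.mul_apply]
  rw [IsoPath.adjMap_single, hrow, hmap _ (hb _), relabel_single, Equiv.swap_inv]

lemma shiftPath_act_one_op (K : ℤ) (P : BUZ) :
    ((shiftPath K).act P 1).op (Finsupp.single K 1) = 0 := by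
  rw [IsoPath.act_op]
  simp only [Module.End.mul_apply]
  rw [IsoPath.adjMap_single, shiftPath_row_one, if_neg (by omega), if_pos rfl, map_zero, map_zero]

/-- The final isometry fixes the labels below `K` and maps the others among themselves, so it
commutes with the exchange of two labels below `K`. -/
lemma shiftPath_act_conjSwap {K a b : ℤ} (ha : a < K) (hb : b < K) (P : BUZ) :
    (shiftPath K).act (P.conjSwap a b) 1 = ((shiftPath K).act P 1).conjSwap a b := by
  have hlt : ∀ i, Equiv.swap a b i < K ↔ i < K := fun i => by
    rw [Equiv.swap_apply_def]
    split_ifs <;> omega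
  have hfix : ∀ i, K ≤ i → Equiv.swap a b i = i := fun i hi =>
    Equiv.swap_apply_of_ne_of_ne (by omega) (by omega)
  have h1 : (shiftPath K).map 1 * relabel (Equiv.swap a b) =
      relabel (Equiv.swap a b) * (shiftPath K).map 1 := by
    refine end_ext fun i => ?_
    simp only [Module.End.mul_apply]
    rw [relabel_single, IsoPath.map_single, IsoPath.map_single, shiftPath_col_one,
      shiftPath_col_one, relabel_single]
    simp only [hlt]
    split_ifs with h
    · rfl
    · rw [hfix i (by omega), hfix (i + 1) (by omega)]
  have h2 : relabel (Equiv.swap a b) * (shiftPath K).adjMap 1 =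
      (shiftPath K).adjMap 1 * relabel (Equiv.swap a b) := by
    have e1 := ((shiftPath K).isAdj 1).mul (isAdj_relabel (Equiv.swap a b))
    have e2 := (isAdj_relabel (Equiv.swap a b)).mul ((shiftPath K).isAdj 1)
    rw [Equiv.swap_inv] at e1 e2
    refine LinearMap.ext fun x => eq_of_inn_eq fun z => ?_
    rw [← e1, ← e2, h1]
  refine BUZ.ext ?_
  rw [IsoPath.act_op, BUZ.conjSwap, BUZ.conj_op, BUZ.conjSwap, BUZ.conj_op, IsoPath.act_op,
    Equiv.swap_inv]
  calc (shiftPath K).map 1 * (relabel (Equiv.swap a b) * P.op * relabel (Equiv.swap a b)) *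
        (shiftPath K).adjMap 1
      = ((shiftPath K).map 1 * relabel (Equiv.swap a b)) * P.op *
        (relabel (Equiv.swap a b) * (shiftPath K).adjMap 1) := by simp only [mul_assoc]
    _ = _ := by rw [h1, h2]; simp only [mul_assoc]

/-- The label `K` serves as a parking place: `k` goes to `K`, `l` goes to `k`, and then `K` goes to
`l`, so that `K` itself returns. -/
lemma conjSwap_conjSwap_conjSwap {k l K : ℤ} (hkl : k ≠ l) (hk : k ≠ K) (hl : l ≠ K) (P : BUZ) :
    ((P.conjSwap k K).conjSwap l k).conjSwap K l = P.conjSwap k l := by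
  refine BUZ.ext_entry fun i j => ?_
  simp only [BUZ.conjSwap, BUZ.conj_entry, Equiv.swap_inv]
  have h : ∀ i, Equiv.swap k K (Equiv.swap l k (Equiv.swap K l i)) = Equiv.swap k l i := fun i => by
    simp only [Equiv.swap_apply_def]
    grind
  rw [h, h]

/-- The path from `P` to `τ P τ⁻¹`, where `τ` exchanges `e_k` and `e_l`. -/
def swapPath (k l K : ℤ) (hkl : k ≠ l) (hk : k < K) (hl : l < K) (P : BUZ) : ℝ → BUZ :=
  let P₁ := (shiftPath K).act P 1
  let P₂ := P₁.conjSwap k K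
  let P₃ := P₂.conjSwap l k
  -- The free basis vector is `e_K` for `P₁`, `e_k` for `P₂` and `e_l` for `P₃`; each rotation moves
  -- a vector into the place that is free. The last piece is the shift path of `τ P τ⁻¹` run
  -- backwards.
  catPath ((shiftPath K).act P) (catPath ((rotation k K hk.ne).act P₁)
    (catPath ((rotation l k hkl.symm).act P₂) (catPath ((rotation K l hl.ne').act P₃)
      fun t => (shiftPath K).act (P.conjSwap k l) (1 - t))))

section SwapPath

variable {E : Type*} [NormedAddCommGroup E] [NormedSpace ℝ E] {H : Type*} [TopologicalSpace H]
  {I : ModelWithCorners ℝ E H} {M : Type*} [TopologicalSpace M] [ChartedSpace H M]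

lemma IsSmoothOn.slice {Γ : M × ℝ → BUZ} (h : IsSmoothOn (I.prod 𝓘(ℝ, ℝ)) Γ (cylinder M))
    {t : ℝ} (ht : t ∈ Set.Icc (0 : ℝ) 1) : IsSmooth I fun x => Γ (x, t) :=
  isSmooth_iff.2 ⟨h.1.imp fun _ hN x => hN _ (mem_cylinder.2 ht), fun i j =>
    (h.2 i j).comp_contMDiff (contMDiff_id.prodMk contMDiff_const) fun _ => mem_cylinder.2 ht⟩

lemma IsHomotopy.smooth_right {Γ : M × ℝ → BUZ} {P Q : M → BUZ} (h : IsHomotopy I Γ P Q) :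
    IsSmooth I Q := by
  have := h.1.slice (t := 1) ⟨zero_le_one, le_rfl⟩
  rwa [funext h.2.2] at this

lemma isHomotopy_shiftPath (K : ℤ) {P : M → BUZ} (hP : IsSmooth I P) :
    IsHomotopy I (fun y => (shiftPath K).act (P y.1) y.2) P (fun x => (shiftPath K).act (P x) 1) ∧
      ∀ n x v, CS I (fun y => (shiftPath K).act (P y.1) y.2) n x v = 0 := by
  have h := IsoPath.isHomotopy_act (𝓐 := shiftPath K) hP ∅ (fun _ _ hb => absurd hb id)
    fun t i _ j _ => shiftPath_horizontal K t i j
  simp only [IsoPath.act_zero_of_map (shiftPath_map_zero K)] at h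
  exact h

lemma isHomotopy_rotation {a b : ℤ} (hab : a ≠ b) {P : M → BUZ} (hP : IsSmooth I P)
    (hb : ∀ x, (P x).op (Finsupp.single b 1) = 0) :
    IsHomotopy I (fun y => (rotation a b hab).act (P y.1) y.2) P (fun x => (P x).conjSwap a b) ∧
      ∀ n x v, CS I (fun y => (rotation a b hab).act (P y.1) y.2) n x v = 0 := by
  have h := IsoPath.isHomotopy_act (𝓐 := rotation a b hab) hP {b}
    (fun x c hc => Set.mem_singleton_iff.1 hc ▸ hb x)
    fun t i hi j hj => rotation_horizontal hab t hi hj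
  simp only [IsoPath.act_zero_of_map (rotation_map_zero hab), rotation_act_one hab (hb _)] at h
  exact h

lemma IsSmooth.conj {P : M → BUZ} (hP : IsSmooth I P) (σ : Equiv.Perm ℤ) (h) :
    IsSmooth I fun x => (P x).conj σ h := by
  obtain ⟨N, hN⟩ := hP.exists_stage
  obtain ⟨N', hN'⟩ : ∃ N' : ℕ, N ≤ N' ∧ ∀ i, (i < -(N' : ℤ) ∨ (N' : ℤ) ≤ i) → σ i = i := by
    refine ⟨max N ((h.toFinset.sup Int.natAbs) + 1), le_max_left _ _, fun i hi => ?_⟩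
    by_contra hne
    have := Finset.le_sup (f := Int.natAbs) (h.mem_toFinset.2 hne)
    omega
  have hinv : ∀ i, (i < -(N' : ℤ) ∨ (N' : ℤ) ≤ i) → σ⁻¹ i = i := fun i hi => by
    rw [Equiv.Perm.inv_eq_iff_eq, hN'.2 i hi]
  refine isSmooth_iff.2 ⟨⟨N', fun x => (BUZ.inStage_iff_entry _ _ _).2
    ⟨fun i j hj => ?_, fun i j hj => ?_⟩⟩, fun i j => ?_⟩
  · rw [BUZ.conj_entry, hinv j (Or.inl hj), (hN x).entry_low (Or.inr (by omega))]
    congr 1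
    rw [Equiv.Perm.inv_eq_iff_eq, hN'.2 j (Or.inl hj)]
  · rw [BUZ.conj_entry, hinv j (Or.inr hj), (hN x).entry_high (Or.inr (by omega))]
  · simp only [BUZ.conj_entry]
    exact hP.contMDiff _ _

variable [IsManifold I ∞ M]

lemma isHomotopy_swapPath {k l K : ℤ} (hkl : k ≠ l) (hk : k < K) (hl : l < K) {P : M → BUZ}
    (hP : IsSmooth I P) :
    IsHomotopy I (fun y => swapPath k l K hkl hk hl (P y.1) y.2) P (fun x => (P x).conjSwap k l) ∧
      ∀ n x v, CS I (fun y => swapPath k l K hkl hk hl (P y.1) y.2) n x v = 0 := by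
  have h1 := isHomotopy_shiftPath K hP
  have h2 := isHomotopy_rotation hk.ne h1.1.smooth_right fun _ => shiftPath_act_one_op K _
  have h3 := isHomotopy_rotation hkl.symm h2.1.smooth_right fun _ =>
    BUZ.conjSwap_op_left (shiftPath_act_one_op K _)
  have h4 := isHomotopy_rotation hl.ne' h3.1.smooth_right fun _ =>
    BUZ.conjSwap_op_left (BUZ.conjSwap_op_left (shiftPath_act_one_op K _))
  have h5 := isHomotopy_shiftPath K (hP.conj (Equiv.swap k l) (finite_swap k l))
  have h5' := isHomotopy_symm h5.1
  -- The third rotation ends where the backward shift begins: shifting after the exchange is the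
  -- same as exchanging after the shift.
  have e : (fun x => (shiftPath K).act ((P x).conj (Equiv.swap k l) (finite_swap k l)) 1) =
      fun x => ((((shiftPath K).act (P x) 1).conjSwap k K).conjSwap l k).conjSwap K l :=
    funext fun x => by
      rw [conjSwap_conjSwap_conjSwap hkl hk.ne hl.ne]
      exact shiftPath_act_conjSwap hk hl _
  rw [e] at h5'
  have c4 := isHomotopy_trans h4.1 h5'.1
  have c3 := isHomotopy_trans h3.1 c4.1
  have c2 := isHomotopy_trans h2.1 c3.1
  have c1 := isHomotopy_trans h1.1 c2.1
  refine ⟨c1.1, fun n x v => (c1.2 n x v).trans ?_⟩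
  rw [c2.2, c3.2, c4.2, h5'.2, h1.2, h2.2, h3.2, h4.2, h5.2]
  simp

lemma CSZeroHomotopic.conjSwap {P : M → BUZ} (hP : IsSmooth I P) {k l : ℤ} (hkl : k ≠ l) :
    CSZeroHomotopic I P fun x => (P x).conjSwap k l :=
  ⟨_, isHomotopy_swapPath (K := max k l + 1) hkl (by omega) (by omega) hP⟩

end SwapPath

/-! ### Conjugation with finitely supported permutations -/

section Conj

variable {E : Type*} [NormedAddCommGroup E] [NormedSpace ℝ E] {H : Type*} [TopologicalSpace H]
  {I : ModelWithCorners ℝ E H} {M : Type*} [TopologicalSpace M] [ChartedSpace H M]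

lemma finite_mul {σ τ : Equiv.Perm ℤ} (hσ : {i | σ i ≠ i}.Finite) (hτ : {i | τ i ≠ i}.Finite) :
    {i | (σ * τ) i ≠ i}.Finite := by
  refine (hσ.union hτ).subset fun i hi => ?_
  by_contra h
  simp only [Set.mem_union, Set.mem_ofPred_eq, not_or, not_not] at h
  exact hi (by rw [Equiv.Perm.mul_apply, h.2, h.1])

lemma finite_inv {σ : Equiv.Perm ℤ} (hσ : {i | σ i ≠ i}.Finite) : {i | σ⁻¹ i ≠ i}.Finite := by
  refine hσ.subset fun i hi h => hi ?_
  rw [Equiv.Perm.inv_eq_iff_eq, h]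

/-- The empty manifold is separate since a bound `p ≤ q`, used to build the permutation between the
two sums, follows from the stage condition only at a point. -/
lemma CSZeroHomotopic.of_isEmpty [IsEmpty M] (P Q : M → BUZ) : CSZeroHomotopic I P Q :=
  ⟨fun _ => I0, ⟨⟨⟨0, fun y _ => isEmptyElim y.1⟩, fun _ _ y _ => isEmptyElim y.1⟩,
    fun x => isEmptyElim x, fun x => isEmptyElim x⟩, fun _ x => isEmptyElim x⟩

/-- Transpositions generate the finitely supported permutations, and homotopies with zero form can
be concatenated and reversed. -/
lemma CSZeroHomotopic.conj [IsManifold I ∞ M] {P : M → BUZ} (hP : IsSmooth I P)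
    (σ : Equiv.Perm ℤ) (h : {i | σ i ≠ i}.Finite) :
    CSZeroHomotopic I P fun x => (P x).conj σ h := by
  have hmem : σ ∈ Subgroup.closure {τ : Equiv.Perm ℤ | τ.IsSwap} := by
    rw [mem_closure_isSwap']
    exact h
  -- Finiteness of the support is carried through the induction because the conjugate is defined
  -- only for such permutations; all `P` are treated at once for the product step.
  have key : ∃ h : {i | σ i ≠ i}.Finite, ∀ P : M → BUZ, IsSmooth I P →
      CSZeroHomotopic I P fun x => (P x).conj σ h := by
    clear h
    induction hmem using Subgroup.closure_induction with
    | mem τ hτ =>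
      obtain ⟨k, l, hkl, rfl⟩ := hτ
      exact ⟨finite_swap k l, fun P hP => CSZeroHomotopic.conjSwap hP hkl⟩
    | one =>
      refine ⟨by simp, fun P hP => ?_⟩
      have e : (fun x => (P x).conj 1 (by simp)) = P := funext fun x =>
        BUZ.ext_entry fun i j => by rw [BUZ.conj_entry]; rfl
      rw [e]
      exact CSZeroHomotopic.refl hP
    | mul σ τ _ _ hσ hτ =>
      obtain ⟨h1, h2⟩ := hσ
      obtain ⟨h3, h4⟩ := hτ
      refine ⟨finite_mul h1 h3, fun P hP => ?_⟩
      have e : (fun x => (P x).conj (σ * τ) (finite_mul h1 h3)) =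
          fun x => ((P x).conj τ h3).conj σ h1 := funext fun x =>
        BUZ.ext_entry fun i j => by rw [BUZ.conj_entry, BUZ.conj_entry, BUZ.conj_entry]; rfl
      rw [e]
      exact (h4 P hP).trans (h2 _ (hP.conj τ h3))
    | inv σ _ hσ =>
      obtain ⟨h1, h2⟩ := hσ
      refine ⟨finite_inv h1, fun P hP => ?_⟩
      have h3 := h2 _ (hP.conj σ⁻¹ (finite_inv h1))
      have e : (fun x => ((P x).conj σ⁻¹ (finite_inv h1)).conj σ h1) = P := funext fun x =>
        BUZ.ext_entry fun i j => by rw [BUZ.conj_entry, BUZ.conj_entry]; simp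
      rw [e] at h3
      exact h3.symm
  obtain ⟨_, h2⟩ := key
  exact h2 P hP

end Conj

/-! ### The permutation that relates the shuffle sum and the block sum -/

/-- The rearrangement of the labels of a shuffle sum to those of a block sum. -/
def blockFun (p q m n c : ℤ) : ℤ :=
  -- The label `2i` stands for the label `i` of the first summand, `2j + 1` for the label `j` of the
  -- second. The windows `[p, q)` and `[m, n)` go to `[p + m, q + m)` and `[q + m, q + n)`. Low
  -- labels fill up everything below `p + m`, high ones everything from `q + n` on, and labels
  -- outside `[2 min p m, 2 max q n)` stay in place.
  if c % 2 = 0 then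
    if c / 2 < p then (if c / 2 < m then c else c / 2 + m)
    else if c / 2 < q then c / 2 + m else if c / 2 < n then c / 2 + n else c
  else
    if c / 2 < m then (if c / 2 < p then c else c / 2 + p)
    else if c / 2 < n then c / 2 + q else if c / 2 < q then c / 2 + q else c

/-- The inverse of `blockFun`. -/
def blockInv (p q m n a : ℤ) : ℤ :=
  if a < p + m then
    if p ≤ m then (if a < 2 * p then a else 2 * (a - p) + 1)
    else (if a < 2 * m then a else 2 * (a - m))
  else if a < q + m then 2 * (a - m)
  else if a < q + n then 2 * (a - q) + 1
  else if q ≤ n then (if a < 2 * n then 2 * (a - n) else a)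
  else (if a < 2 * q then 2 * (a - q) + 1 else a)

lemma blockInv_blockFun {p q m n : ℤ} (hpq : p ≤ q) (hmn : m ≤ n) (c : ℤ) :
    blockInv p q m n (blockFun p q m n c) = c := by
  obtain ⟨a, ha⟩ : ∃ a, a = blockFun p q m n c := ⟨_, rfl⟩
  rw [← ha, blockInv]
  unfold blockFun at ha
  split_ifs at ha <;> split_ifs <;> omega

lemma blockFun_blockInv {p q m n : ℤ} (hpq : p ≤ q) (hmn : m ≤ n) (a : ℤ) :
    blockFun p q m n (blockInv p q m n a) = a := by
  obtain ⟨c, hc⟩ : ∃ c, c = blockInv p q m n a := ⟨_, rfl⟩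
  rw [← hc, blockFun]
  unfold blockInv at hc
  split_ifs at hc <;> split_ifs <;> omega

/-- The permutation that rearranges the labels of a shuffle sum to those of a block sum. -/
def blockPerm (p q m n : ℤ) (hpq : p ≤ q) (hmn : m ≤ n) : Equiv.Perm ℤ where
  toFun := blockFun p q m n
  invFun := blockInv p q m n
  left_inv := blockInv_blockFun hpq hmn
  right_inv := blockFun_blockInv hpq hmn

lemma blockPerm_apply {p q m n : ℤ} (hpq : p ≤ q) (hmn : m ≤ n) (c : ℤ) : blockPerm p q m n hpq hmn c =
    if c % 2 = 0 then
      if c / 2 < p then (if c / 2 < m then c else c / 2 + m)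
      else if c / 2 < q then c / 2 + m else if c / 2 < n then c / 2 + n else c
    else
      if c / 2 < m then (if c / 2 < p then c else c / 2 + p)
      else if c / 2 < n then c / 2 + q else if c / 2 < q then c / 2 + q else c := rfl

lemma finite_blockPerm {p q m n : ℤ} (hpq : p ≤ q) (hmn : m ≤ n) : {i | blockPerm p q m n hpq hmn i ≠ i}.Finite := by
  refine (Set.finite_Ico (2 * min p m) (2 * max q n)).subset fun c hc => ?_
  rw [Set.mem_ofPred_eq, blockPerm_apply] at hc
  rw [Set.mem_Ico]
  by_contra h
  refine hc ?_
  split_ifs <;> omega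

lemma blockPerm_even {p q m n : ℤ} (hpq : p ≤ q) (hmn : m ≤ n) {i : ℤ} (h1 : p ≤ i) (h2 : i < q) :
    blockPerm p q m n hpq hmn (2 * i) = i + m := by
  rw [blockPerm_apply]
  split_ifs <;> omega

lemma blockPerm_odd {p q m n : ℤ} (hpq : p ≤ q) (hmn : m ≤ n) {j : ℤ} (h1 : m ≤ j) (h2 : j < n) :
    blockPerm p q m n hpq hmn (2 * j + 1) = j + q := by
  rw [blockPerm_apply]
  split_ifs <;> omega

lemma blockPerm_low {p q m n : ℤ} (hpq : p ≤ q) (hmn : m ≤ n) (c : ℤ) : blockPerm p q m n hpq hmn c < p + m ↔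
    (c % 2 = 0 ∧ c / 2 < p) ∨ (c % 2 = 1 ∧ c / 2 < m) := by
  rw [blockPerm_apply]
  split_ifs <;> omega

/-! ### Ranges -/

/-- The embedding `e_i ↦ e_{2i}`. -/
def evenEmb : Module.End ℂ V := Finsupp.lmapDomain ℂ ℂ fun i => 2 * i

/-- The embedding `e_i ↦ e_{2i+1}`. -/
def oddEmb : Module.End ℂ V := Finsupp.lmapDomain ℂ ℂ fun i => 2 * i + 1

lemma evenEmb_single (i : ℤ) (a : ℂ) : evenEmb (Finsupp.single i a) = Finsupp.single (2 * i) a :=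
  Finsupp.mapDomain_single

lemma oddEmb_single (i : ℤ) (a : ℂ) : oddEmb (Finsupp.single i a) = Finsupp.single (2 * i + 1) a :=
  Finsupp.mapDomain_single

lemma evenEmb_eq (x : V) : evenEmb x = shuffle.symm (x, 0) := by
  rw [LinearEquiv.eq_symm_apply]
  induction x using Finsupp.induction_linear with
  | zero => rw [map_zero, map_zero]; rfl
  | add f g hf hg => rw [map_add, map_add, hf, hg, Prod.mk_add_mk, add_zero]
  | single i a =>
    rw [evenEmb_single]
    refine Prod.ext (Finsupp.ext fun k => ?_) (Finsupp.ext fun k => ?_)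
    · rw [shuffle_fst, Finsupp.single_apply, Finsupp.single_apply]
      simp
    · rw [shuffle_snd, Finsupp.single_apply, if_neg (by omega)]
      rfl

lemma oddEmb_eq (x : V) : oddEmb x = shuffle.symm (0, x) := by
  rw [LinearEquiv.eq_symm_apply]
  induction x using Finsupp.induction_linear with
  | zero => rw [map_zero, map_zero]; rfl
  | add f g hf hg => rw [map_add, map_add, hf, hg, Prod.mk_add_mk, add_zero]
  | single i a =>
    rw [oddEmb_single]
    refine Prod.ext (Finsupp.ext fun k => ?_) (Finsupp.ext fun k => ?_)
    · rw [shuffle_fst, Finsupp.single_apply, if_neg (by omega)]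
      rfl
    · rw [shuffle_snd, Finsupp.single_apply, Finsupp.single_apply]
      simp

lemma BUZ.InStage.range_eq {P : BUZ} {p q : ℤ} (h : P.InStage p q) :
    LinearMap.range P.op = below p ⊔ (LinearMap.range P.op ⊓ between p q) := by
  refine le_antisymm (fun x hx => ?_) (sup_le h.1 inf_le_left)
  have hlow : Finsupp.filter (· < p) x ∈ below p := mem_below.2 fun i hi => by
    rw [Finsupp.filter_apply, if_neg (by omega)]
  refine Submodule.mem_sup.2 ⟨_, hlow, x - Finsupp.filter (· < p) x,
    ⟨Submodule.sub_mem _ hx (h.1 hlow), mem_between.2 fun i hi => ?_⟩, add_sub_cancel _ _⟩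
  rw [Finsupp.sub_apply, Finsupp.filter_apply]
  split_ifs with hip
  · rw [sub_self]
  · rw [sub_zero, mem_below.1 (h.2 hx) i (by omega)]

lemma inf_between_of_range_eq {p q : ℤ} {R A : Submodule ℂ V} (hA : A ≤ between p q)
    (h : R = below p ⊔ A) : R ⊓ between p q = A := by
  rw [h, sup_comm, sup_inf_assoc_of_le _ hA]
  refine sup_eq_left.2 fun x hx => ?_
  have : x = 0 := by
    ext i
    by_cases hi : i < p
    · exact mem_between.1 hx.2 i (Or.inl hi)
    · exact mem_below.1 hx.1 i (by omega)
  rw [this]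
  exact Submodule.zero_mem _

lemma range_boxplus (P Q : BUZ) : LinearMap.range (boxplus P Q).op =
    (LinearMap.range P.op).map evenEmb ⊔ (LinearMap.range Q.op).map oddEmb := by
  have he : ∀ x, (boxplus P Q).op (evenEmb x) = evenEmb (P.op x) := fun x => by
    rw [evenEmb_eq, evenEmb_eq, LinearEquiv.eq_symm_apply]
    refine (shuffle_boxplusOp P.op Q.op _).trans ?_
    rw [LinearEquiv.apply_symm_apply, map_zero]
  have ho : ∀ x, (boxplus P Q).op (oddEmb x) = oddEmb (Q.op x) := fun x => by
    rw [oddEmb_eq, oddEmb_eq, LinearEquiv.eq_symm_apply]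
    refine (shuffle_boxplusOp P.op Q.op _).trans ?_
    rw [LinearEquiv.apply_symm_apply, map_zero]
  refine le_antisymm ?_ (sup_le ?_ ?_)
  · rintro _ ⟨x, rfl⟩
    obtain ⟨⟨y, z⟩, rfl⟩ := shuffle.symm.surjective x
    have e : shuffle.symm (y, z) = evenEmb y + oddEmb z := by
      rw [evenEmb_eq, oddEmb_eq, ← map_add, Prod.mk_add_mk, add_zero, zero_add]
    rw [e, map_add, he, ho]
    exact Submodule.add_mem_sup ⟨_, ⟨_, rfl⟩, rfl⟩ ⟨_, ⟨_, rfl⟩, rfl⟩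
  · rintro _ ⟨_, ⟨x, rfl⟩, rfl⟩
    exact ⟨_, he x⟩
  · rintro _ ⟨_, ⟨x, rfl⟩, rfl⟩
    exact ⟨_, ho x⟩

lemma range_conj (σ : Equiv.Perm ℤ) (h) (P : BUZ) :
    LinearMap.range (P.conj σ h).op = (LinearMap.range P.op).map (relabel σ) := by
  refine le_antisymm ?_ ?_
  · rintro _ ⟨x, rfl⟩
    exact ⟨_, ⟨_, rfl⟩, rfl⟩
  · rintro _ ⟨_, ⟨x, rfl⟩, rfl⟩
    refine ⟨relabel σ x, ?_⟩
    rw [BUZ.conj_op, Module.End.mul_apply, Module.End.mul_apply, ← Module.End.mul_apply (relabel σ⁻¹),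
      relabel_inv_mul, Module.End.one_apply]

lemma map_eq_of_le_between {A B : Module.End ℂ V} {p q : ℤ} {W : Submodule ℂ V}
    (hW : W ≤ between p q)
    (h : ∀ i, p ≤ i → i < q → A (Finsupp.single i 1) = B (Finsupp.single i 1)) :
    W.map A = W.map B := by
  have key : ∀ x ∈ W, A x = B x := fun x hx => by
    have hx' : ∀ i ∉ Finset.Ico p q, x i = 0 := fun i hi =>
      mem_between.1 (hW hx) i (by rw [Finset.mem_Ico] at hi; omega)
    rw [end_apply_eq_sum A x _ hx', end_apply_eq_sum B x _ hx']
    refine Finset.sum_congr rfl fun i hi => ?_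
    rw [Finset.mem_Ico] at hi
    rw [h i hi.1 hi.2]
  ext y
  constructor
  · rintro ⟨x, hx, rfl⟩
    exact ⟨x, hx, (key x hx).symm⟩
  · rintro ⟨x, hx, rfl⟩
    exact ⟨x, hx, key x hx⟩

lemma shift_single (k i : ℤ) (a : ℂ) :
    shift k (Finsupp.single i a) = Finsupp.single (i + k) a := by
  rw [shift, relabel_single]
  rfl

lemma below_eq_span (p : ℤ) : below p = Submodule.span ℂ ((fun i => Finsupp.single i 1) '' Set.Iio p) :=
  Finsupp.supported_eq_span_single _ _

/-- The range of `P ⊞ Q` is the sum of an even and an odd copy. The permutation puts the two low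
parts together to `below (p + m)` and acts on the two windows as the shifts by `m` and `q`. The
conjugated shuffle sum is thus a model of `P ⊕ Q`. -/
lemma range_blockSum {P Q : BUZ} {p q m n : ℤ} (hP : P.InStage p q) (hQ : Q.InStage m n) :
    LinearMap.range ((boxplus P Q).conj (blockPerm p q m n hP.le hQ.le)
      (finite_blockPerm hP.le hQ.le)).op = below (p + m)
        ⊔ (LinearMap.range P.op ⊓ between p q).map (shift m)
        ⊔ (LinearMap.range Q.op ⊓ between m n).map (shift q) := by
  set π := blockPerm p q m n hP.le hQ.le with hπ
  have h1 : (LinearMap.range P.op ⊓ between p q).map (relabel π * evenEmb) =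
      (LinearMap.range P.op ⊓ between p q).map (shift m) := by
    refine map_eq_of_le_between inf_le_right fun i hi hi' => ?_
    rw [Module.End.mul_apply, evenEmb_single, relabel_single, shift_single, hπ,
      blockPerm_even _ _ hi hi']
  have h2 : (LinearMap.range Q.op ⊓ between m n).map (relabel π * oddEmb) =
      (LinearMap.range Q.op ⊓ between m n).map (shift q) := by
    refine map_eq_of_le_between inf_le_right fun i hi hi' => ?_
    rw [Module.End.mul_apply, oddEmb_single, relabel_single, shift_single, hπ,
      blockPerm_odd _ _ hi hi']
  have h3 : (below p).map (relabel π * evenEmb) ⊔ (below m).map (relabel π * oddEmb) =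
      below (p + m) := by
    rw [below_eq_span, below_eq_span, below_eq_span, Submodule.map_span, Submodule.map_span,
      ← Submodule.span_union]
    congr 1
    ext y
    constructor
    · rintro (⟨_, ⟨i, hi, rfl⟩, rfl⟩ | ⟨_, ⟨i, hi, rfl⟩, rfl⟩)
      · rw [Set.mem_Iio] at hi
        refine ⟨π (2 * i), (blockPerm_low _ _ _).2 (Or.inl (by omega)), ?_⟩
        rw [Module.End.mul_apply, evenEmb_single, relabel_single]
      · rw [Set.mem_Iio] at hi
        refine ⟨π (2 * i + 1), (blockPerm_low _ _ _).2 (Or.inr (by omega)), ?_⟩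
        rw [Module.End.mul_apply, oddEmb_single, relabel_single]
    · rintro ⟨a, ha, rfl⟩
      obtain ⟨c, rfl⟩ := π.surjective a
      rw [Set.mem_Iio, hπ, blockPerm_low] at ha
      rcases ha with ⟨hc, hc'⟩ | ⟨hc, hc'⟩
      · refine Or.inl ⟨_, ⟨c / 2, hc', rfl⟩, ?_⟩
        rw [Module.End.mul_apply, evenEmb_single, relabel_single]
        congr 2
        omega
      · refine Or.inr ⟨_, ⟨c / 2, hc', rfl⟩, ?_⟩
        rw [Module.End.mul_apply, oddEmb_single, relabel_single]
        congr 2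
        omega
  have hP' := hP.range_eq
  have hQ' := hQ.range_eq
  rw [range_conj, range_boxplus]
  generalize LinearMap.range P.op ⊓ between p q = VP at *
  generalize LinearMap.range Q.op ⊓ between m n = VQ at *
  rw [hP', hQ']
  have hc : ∀ (A B : Module.End ℂ V) (W : Submodule ℂ V), (W.map B).map A = W.map (A * B) :=
    fun A B W => (Submodule.map_comp B A W).symm
  simp only [Submodule.map_sup, hc]
  rw [h1, h2, ← h3]
  simp only [sup_assoc]
  rw [sup_left_comm (VP.map (shift m))]

/-! ### Block sums and shuffle sums of smooth maps -/

section BlockSum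

variable {E : Type*} [NormedAddCommGroup E] [NormedSpace ℝ E] {H : Type*} [TopologicalSpace H]
  {I : ModelWithCorners ℝ E H} {M : Type*} [TopologicalSpace M] [ChartedSpace H M]

omit [TopologicalSpace M] in
lemma IsBlockSum.of_inStage {P Q : M → BUZ} {p q m n : ℤ} (hP : ∀ x, (P x).InStage p q)
    (hQ : ∀ x, (Q x).InStage m n) : ∃ R, IsBlockSum P Q R ∧ ∀ x, LinearMap.range (R x).op =
      below (p + m) ⊔ (LinearMap.range (P x).op ⊓ between p q).map (shift m)
        ⊔ (LinearMap.range (Q x).op ⊓ between m n).map (shift q) :=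
  ⟨fun x => (boxplus (P x) (Q x)).conj _ (finite_blockPerm (hP x).le (hQ x).le),
    ⟨p, q, m, n, hP, hQ, fun x => range_blockSum (hP x) (hQ x)⟩,
    fun x => range_blockSum (hP x) (hQ x)⟩

omit [TopologicalSpace M] in
-- A Hermitian projection is determined by its range, so `R` must be the model of `range_blockSum`.
-- The bounds are uniform on `M`, hence one permutation serves for all points.
lemma IsBlockSum.exists_conj [Nonempty M] {P Q R : M → BUZ} (h : IsBlockSum P Q R) :
    ∃ (σ : Equiv.Perm ℤ) (hσ : {i | σ i ≠ i}.Finite),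
      R = fun x => (boxplus (P x) (Q x)).conj σ hσ := by
  obtain ⟨p, q, m, n, hP, hQ, hR⟩ := h
  obtain ⟨x₀⟩ := ‹Nonempty M›
  exact ⟨_, finite_blockPerm (hP x₀).le (hQ x₀).le, funext fun x =>
    BUZ.ext_range ((hR x).trans (range_blockSum (hP x) (hQ x)).symm)⟩

lemma IsSmoothOn.boxplus {P Q : M → BUZ} {s : Set M} (hP : IsSmoothOn I P s)
    (hQ : IsSmoothOn I Q s) : IsSmoothOn I (fun x => boxplus (P x) (Q x)) s := by
  obtain ⟨N, hN⟩ := hP.1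
  obtain ⟨N', hN'⟩ := hQ.1
  refine ⟨⟨2 * max N N', fun x hx => (boxplus_inStage (hN x hx) (hN' x hx)).mono
    (by push_cast; omega) (by push_cast; omega)⟩, fun i j => ?_⟩
  simp only [boxplus_entry]
  split_ifs
  · exact hP.2 _ _
  · exact contMDiffOn_const
  · exact contMDiffOn_const
  · exact hQ.2 _ _

lemma IsSmooth.boxplus {P Q : M → BUZ} (hP : IsSmooth I P) (hQ : IsSmooth I Q) :
    IsSmooth I fun x => boxplus (P x) (Q x) := IsSmoothOn.boxplus hP hQ

lemma IsSmooth.of_isEmpty [IsEmpty M] (P : M → BUZ) : IsSmooth I P :=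
  ⟨⟨0, fun x => isEmptyElim x⟩, fun _ _ x => isEmptyElim x⟩

lemma IsBlockSum.isSmooth {P Q R : M → BUZ} (h : IsBlockSum P Q R) (hP : IsSmooth I P)
    (hQ : IsSmooth I Q) : IsSmooth I R := by
  rcases isEmpty_or_nonempty M with hM | hM
  · exact IsSmooth.of_isEmpty R
  · obtain ⟨σ, hσ, rfl⟩ := h.exists_conj
    exact (hP.boxplus hQ).conj σ hσ

lemma IsBlockSum.csZeroHomotopic [IsManifold I ∞ M] {P Q R : M → BUZ} (h : IsBlockSum P Q R)
    (hP : IsSmooth I P) (hQ : IsSmooth I Q) :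
    CSZeroHomotopic I R fun x => KTheory.boxplus (P x) (Q x) := by
  rcases isEmpty_or_nonempty M with hM | hM
  · exact CSZeroHomotopic.of_isEmpty _ _
  · obtain ⟨σ, hσ, rfl⟩ := h.exists_conj
    exact (CSZeroHomotopic.conj (hP.boxplus hQ) σ hσ).symm

/-- The permutation that exchanges `2i` and `2i + 1` for `2i` between `-2N` and `2N`. -/
def exchange (N : ℕ) : Equiv.Perm ℤ where
  toFun c := if -2 * N ≤ c ∧ c < 2 * N then (if c % 2 = 0 then c + 1 else c - 1) else c
  invFun c := if -2 * N ≤ c ∧ c < 2 * N then (if c % 2 = 0 then c + 1 else c - 1) else c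
  left_inv c := by
    dsimp only
    split_ifs <;> omega
  right_inv c := by
    dsimp only
    split_ifs <;> omega

lemma exchange_inv_apply (N : ℕ) (c : ℤ) : (exchange N)⁻¹ c =
    if -2 * N ≤ c ∧ c < 2 * N then (if c % 2 = 0 then c + 1 else c - 1) else c := rfl

lemma finite_exchange (N : ℕ) : {i | exchange N i ≠ i}.Finite := by
  refine (Set.finite_Ico (-2 * N : ℤ) (2 * N)).subset fun c hc => ?_
  by_contra h
  exact hc (if_neg h)

/-- Exchanging all even and odd labels would require infinite support. Outside `[-2N, 2N)` both sums
already have the entries of `I_0`, so a finite exchange suffices. -/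
lemma boxplus_comm_conj {P Q : BUZ} {N : ℕ} (hP : P.InStage (-(N : ℤ)) N)
    (hQ : Q.InStage (-(N : ℤ)) N) :
    boxplus Q P = (boxplus P Q).conj (exchange N) (finite_exchange N) := by
  have h1 := boxplus_inStage hP hQ
  have h2 := boxplus_inStage hQ hP
  rw [min_self, max_self] at h1 h2
  have h3 : ((boxplus P Q).conj (exchange N) (finite_exchange N)).InStage (2 * -(N : ℤ)) (2 * N) := by
    refine (BUZ.inStage_iff_entry _ _ _).2 ⟨fun i j hj => ?_, fun i j hj => ?_⟩
    · have e : (exchange N)⁻¹ j = j := by rw [exchange_inv_apply, if_neg (by omega)]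
      rw [BUZ.conj_entry, e, h1.entry_low (Or.inr hj)]
      congr 1
      rw [Equiv.Perm.inv_eq_iff_eq, ← Equiv.Perm.inv_eq_iff_eq.1 e]
    · have e : (exchange N)⁻¹ j = j := by rw [exchange_inv_apply, if_neg (by omega)]
      rw [BUZ.conj_entry, e, h1.entry_high (Or.inr hj)]
  refine BUZ.ext_entry fun i j => ?_
  by_cases hi : i < 2 * -(N : ℤ) ∨ j < 2 * -(N : ℤ)
  · rw [h2.entry_low hi, h3.entry_low hi]
  by_cases hi' : 2 * (N : ℤ) ≤ i ∨ 2 * (N : ℤ) ≤ j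
  · rw [h2.entry_high hi', h3.entry_high hi']
  have e : ∀ i : ℤ, ¬ i < 2 * -(N : ℤ) → ¬ 2 * (N : ℤ) ≤ i →
      ((exchange N)⁻¹ i) / 2 = i / 2 ∧ ((exchange N)⁻¹ i % 2 = 0 ↔ ¬ i % 2 = 0) := by
    intro i h h'
    rw [exchange_inv_apply, if_pos (by omega)]
    split_ifs <;> omega
  have ei := e i (fun h => hi (Or.inl h)) (fun h => hi' (Or.inl h))
  have ej := e j (fun h => hi (Or.inr h)) (fun h => hi' (Or.inr h))
  rw [BUZ.conj_entry, boxplus_entry, boxplus_entry, ei.1, ej.1]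
  simp only [ei.2, ej.2]
  by_cases h4 : i % 2 = 0 <;> by_cases h5 : j % 2 = 0 <;> simp [h4, h5]

lemma CSZeroHomotopic.boxplus_comm [IsManifold I ∞ M] {P Q : M → BUZ} (hP : IsSmooth I P)
    (hQ : IsSmooth I Q) :
    CSZeroHomotopic I (fun x => KTheory.boxplus (P x) (Q x)) fun x => KTheory.boxplus (Q x) (P x) := by
  obtain ⟨N, hN⟩ := hP.exists_stage
  obtain ⟨N', hN'⟩ := hQ.exists_stage
  have e : (fun x => KTheory.boxplus (Q x) (P x)) = fun x =>
      (KTheory.boxplus (P x) (Q x)).conj (exchange (max N N')) (finite_exchange _) := funext fun x =>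
    boxplus_comm_conj ((hN x).mono (by push_cast; omega) (by push_cast; omega))
      ((hN' x).mono (by push_cast; omega) (by push_cast; omega))
  rw [e]
  exact CSZeroHomotopic.conj (hP.boxplus hQ) _ _

lemma shift_zero : shift 0 = 1 := end_ext fun i => by
  rw [shift_single, add_zero, Module.End.one_apply]

lemma shift_mul_shift (k l : ℤ) : shift k * shift l = shift (k + l) := end_ext fun i => by
  rw [Module.End.mul_apply, shift_single, shift_single, shift_single]
  congr 1
  ring

lemma map_shift_map (W : Submodule ℂ V) (k l : ℤ) :
    (W.map (shift l)).map (shift k) = W.map (shift (k + l)) := by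
  rw [← shift_mul_shift]
  exact (Submodule.map_comp (shift l) (shift k) W).symm

lemma map_shift_between (p q k : ℤ) : (between p q).map (shift k) ≤ between (p + k) (q + k) := by
  rw [Submodule.map_le_iff_le_comap, between_le_iff]
  intro i hi hi'
  rw [Submodule.mem_comap, shift_single, mem_between]
  intro j hj
  rw [Finsupp.single_apply, if_neg (by omega)]

lemma between_mono {p q p' q' : ℤ} (hp : p' ≤ p) (hq : q ≤ q') : between p q ≤ between p' q' :=
  fun _ hx => mem_between.2 fun i hi => mem_between.1 hx i (by omega)

omit [TopologicalSpace M] in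
/-- A map is its own block sum with the constant map `I_0`. -/
lemma isBlockSum_I0 {P : M → BUZ} {p q : ℤ} (hP : ∀ x, (P x).InStage p q) :
    IsBlockSum P (fun _ => I0) P := by
  refine ⟨p, q, 0, 0, hP, fun _ => I0_inStage, fun x => ?_⟩
  have e : LinearMap.range I0.op ⊓ between 0 0 = ⊥ := by
    refine le_bot_iff.1 fun y hy => ?_
    rw [Submodule.mem_bot]
    ext i
    exact mem_between.1 hy.2 i (by omega)
  rw [e, Submodule.map_bot, sup_bot_eq, add_zero, shift_zero]
  exact (hP x).range_eq.trans (congrArg _ (Submodule.map_id _).symm)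

lemma CSZeroHomotopic.boxplus_I0 [IsManifold I ∞ M] {P : M → BUZ} (hP : IsSmooth I P)
    (h0 : IsSmooth I fun _ : M => I0) :
    CSZeroHomotopic I (fun x => KTheory.boxplus (P x) I0) P := by
  obtain ⟨N, hN⟩ := hP.exists_stage
  exact ((isBlockSum_I0 hN).csZeroHomotopic hP h0).symm

omit [TopologicalSpace M] in
/-- Block sums are associative. -/
lemma IsBlockSum.assoc {P Q R : M → BUZ} {N : ℕ} (hP : ∀ x, (P x).InStage (-(N : ℤ)) N)
    (hQ : ∀ x, (Q x).InStage (-(N : ℤ)) N) (hR : ∀ x, (R x).InStage (-(N : ℤ)) N) :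
    ∃ S T Z : M → BUZ, IsBlockSum P Q S ∧ IsBlockSum S R Z ∧ IsBlockSum Q R T ∧
      IsBlockSum P T Z := by
  obtain ⟨S, hS, hS'⟩ := IsBlockSum.of_inStage hP hQ
  obtain ⟨T, hT, hT'⟩ := IsBlockSum.of_inStage hQ hR
  have hw : ∀ (X : BUZ) (k : ℤ), (LinearMap.range X.op ⊓ between (-(N : ℤ)) N).map (shift k) ≤
      between (-N + k) (N + k) := fun X k =>
    (Submodule.map_mono inf_le_right).trans (map_shift_between _ _ _)
  have key : ∀ X Y Z : BUZ, LinearMap.range Z.op = below (-N + -N)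
      ⊔ (LinearMap.range X.op ⊓ between (-(N : ℤ)) N).map (shift (-N))
      ⊔ (LinearMap.range Y.op ⊓ between (-(N : ℤ)) N).map (shift N) →
      Z.InStage (-N + -N) (N + N) ∧ LinearMap.range Z.op ⊓ between (-N + -N) (N + N) =
        (LinearMap.range X.op ⊓ between (-(N : ℤ)) N).map (shift (-N)) ⊔
        (LinearMap.range Y.op ⊓ between (-(N : ℤ)) N).map (shift N) := by
    intro X Y Z h
    rw [sup_assoc] at h
    have hle : (LinearMap.range X.op ⊓ between (-(N : ℤ)) N).map (shift (-N)) ⊔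
        (LinearMap.range Y.op ⊓ between (-(N : ℤ)) N).map (shift N) ≤
        between (-N + -N) (N + N) :=
      sup_le ((hw _ _).trans (between_mono (by omega) (by omega)))
        ((hw _ _).trans (between_mono (by omega) (by omega)))
    refine ⟨⟨?_, ?_⟩, inf_between_of_range_eq hle h⟩
    · rw [h]
      exact le_sup_left
    · rw [h]
      refine sup_le (fun y hy => mem_below.2 fun i hi => mem_below.1 hy i (by omega))
        (hle.trans fun y hy => mem_below.2 fun i hi => mem_between.1 hy i (Or.inr hi))
  have hSs := fun x => key _ _ _ (hS' x)
  have hTs := fun x => key _ _ _ (hT' x)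
  obtain ⟨Z, hZ, hZ'⟩ := IsBlockSum.of_inStage (fun x => (hSs x).1) hR
  -- The intermediate sums are given the bounds `-2N, 2N`. Both iterated sums then consist of `below
  -- (-3N)` and the pieces of `P`, `Q`, `R` shifted by `-2N`, `0`, `2N`.
  refine ⟨S, T, Z, hS, hZ, hT, ⟨_, _, _, _, hP, fun x => (hTs x).1, fun x => ?_⟩⟩
  rw [hZ', (hSs x).2, (hTs x).2, Submodule.map_sup, Submodule.map_sup, map_shift_map,
    map_shift_map, map_shift_map, map_shift_map, ← sup_assoc, ← sup_assoc]
  rw [add_assoc (-(N : ℤ)) (-N) (-N), add_comm (N : ℤ) (-N)]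

end BlockSum

/-! ### Orthogonal complements -/

section Perp

/-- The orthogonal projection onto `ℂ_{-∞}^k`. -/
def flagOp (k : ℤ) : Module.End ℂ V :=
  (below k).subtype ∘ₗ Finsupp.restrictDom ℂ ℂ (Set.Iio k)

lemma flagOp_apply (k : ℤ) (x : V) (i : ℤ) : flagOp k x i = if i < k then x i else 0 := by
  change Finsupp.filter (· ∈ Set.Iio k) x i = _
  simp [Finsupp.filter_apply]

lemma flagOp_single (k i : ℤ) :
    flagOp k (Finsupp.single i 1) = if i < k then Finsupp.single i 1 else 0 := by
  ext j
  rw [flagOp_apply]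
  by_cases h : i = j
  · subst h
    split_ifs <;> simp
  · rw [Finsupp.single_apply, if_neg h, ite_self]
    split_ifs
    · rw [Finsupp.single_apply, if_neg h]
    · rfl

lemma isAdj_flagOp (k : ℤ) : IsAdj (flagOp k) (flagOp k) := isAdj_of_entries fun i j => by
  rw [flagOp_apply, flagOp_apply, Finsupp.single_apply, Finsupp.single_apply]
  by_cases h : i = j
  · subst h
    split_ifs <;> simp
  · simp [h, Ne.symm h]

lemma flagOp_mul_flagOp {k l : ℤ} (h : k ≤ l) : flagOp k * flagOp l = flagOp k :=
  LinearMap.ext fun x => Finsupp.ext fun i => by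
    rw [Module.End.mul_apply, flagOp_apply, flagOp_apply, flagOp_apply]
    split_ifs <;> first | rfl | omega

lemma flagOp_mul_flagOp' {k l : ℤ} (h : k ≤ l) : flagOp l * flagOp k = flagOp k :=
  LinearMap.ext fun x => Finsupp.ext fun i => by
    rw [Module.End.mul_apply, flagOp_apply, flagOp_apply]
    split_ifs <;> first | rfl | omega

/-- The projection onto `ℂ_{-∞}^k` as a point of `BU × ℤ`. -/
def flag (k : ℤ) : BUZ := BUZ.ofStage (flagOp k) (isAdj_flagOp k) (flagOp_mul_flagOp le_rfl) k k
  (fun i hi => by rw [flagOp_single, if_pos hi])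
  (fun i hi => by rw [flagOp_single, if_neg (by omega)])

lemma flag_inStage (k : ℤ) : (flag k).InStage k k := BUZ.ofStage_inStage ..

lemma BUZ.InStage.flagOp_mul {P : BUZ} {p q : ℤ} (h : P.InStage p q) :
    P.op * flagOp p = flagOp p ∧ P.op * flagOp q = P.op :=
  ⟨end_ext fun i => by
    rw [Module.End.mul_apply, flagOp_single]
    split_ifs with hi
    · exact h.op_low hi
    · exact map_zero _, end_ext fun i => by
    rw [Module.End.mul_apply, flagOp_single]
    split_ifs with hi
    · rfl
    · rw [map_zero, h.op_high (not_lt.1 hi)]⟩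

lemma IsAdj.unique {A B B' : Module.End ℂ V} (h : IsAdj A B) (h' : IsAdj A B') : B = B' :=
  LinearMap.ext fun y => eq_of_inn_eq fun z => (h z y).symm.trans (h' z y)

lemma BUZ.InStage.mul_flagOp {P : BUZ} {p q : ℤ} (h : P.InStage p q) :
    flagOp p * P.op = flagOp p ∧ flagOp q * P.op = P.op := by
  have h1 := P.isAdj.mul (isAdj_flagOp p)
  have h2 := P.isAdj.mul (isAdj_flagOp q)
  rw [h.flagOp_mul.1] at h1
  rw [h.flagOp_mul.2] at h2
  exact ⟨h1.unique (isAdj_flagOp p), h2.unique P.isAdj⟩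

lemma end_mul_sub (A B C : Module.End ℂ V) : A * (B - C) = A * B - A * C := mul_sub A B C

lemma end_sub_mul (A B C : Module.End ℂ V) : (A - B) * C = A * C - B * C := sub_mul A B C

/-- The complement of `P` in `ℂ_{-∞}^q`. -/
def BUZ.compl (q : ℤ) (P : BUZ) : Module.End ℂ V := flagOp q - P.op

lemma BUZ.isAdj_compl (q : ℤ) (P : BUZ) : IsAdj (P.compl q) (P.compl q) :=
  (isAdj_flagOp q).sub P.isAdj

namespace BUZ.InStage

variable {P : BUZ} {p q : ℤ} (h : P.InStage p q)

include h

lemma compl_mul_compl : P.compl q * P.compl q = P.compl q := by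
  rw [BUZ.compl, end_sub_mul, end_mul_sub, end_mul_sub, flagOp_mul_flagOp le_rfl, h.flagOp_mul.2,
    h.mul_flagOp.2, P.idem, sub_self (G := V →ₗ[ℂ] V) P.op, sub_zero (G := V →ₗ[ℂ] V)]

lemma op_mul_compl : P.op * P.compl q = 0 := by
  rw [BUZ.compl, end_mul_sub, h.flagOp_mul.2, P.idem, sub_self (G := V →ₗ[ℂ] V)]

lemma compl_mul_op : P.compl q * P.op = 0 := by
  rw [BUZ.compl, end_sub_mul, h.mul_flagOp.2, P.idem, sub_self (G := V →ₗ[ℂ] V)]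

lemma flagOp_mul_compl : flagOp p * P.compl q = 0 := by
  rw [BUZ.compl, end_mul_sub, h.mul_flagOp.1, flagOp_mul_flagOp h.le, sub_self (G := V →ₗ[ℂ] V)]

lemma compl_mul_flagOp : P.compl q * flagOp p = 0 := by
  rw [BUZ.compl, end_sub_mul, h.flagOp_mul.1, flagOp_mul_flagOp' h.le, sub_self (G := V →ₗ[ℂ] V)]

lemma compl_single {i : ℤ} (hi : i < p ∨ q ≤ i) : P.compl q (Finsupp.single i 1) = 0 := by
  have := h.le
  rw [BUZ.compl, LinearMap.sub_apply, flagOp_single]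
  rcases hi with hi | hi
  · rw [if_pos (by omega), h.op_low hi, sub_self]
  · rw [if_neg (by omega), h.op_high hi, sub_self]

end BUZ.InStage

/-- The projection onto `ℂ_{-∞}^p ⊕ V^⊥` for `P` the projection onto `ℂ_{-∞}^p ⊕ V`. -/
def BUZ.flip (P : BUZ) (p q : ℤ) (h : P.InStage p q) : BUZ :=
  BUZ.ofStage (flagOp p + P.compl q) ((isAdj_flagOp p).add (P.isAdj_compl q))
    (by rw [add_mul, mul_add, mul_add, flagOp_mul_flagOp le_rfl, h.flagOp_mul_compl,
      h.compl_mul_flagOp, h.compl_mul_compl, add_zero, zero_add]) p q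
    (fun i hi => by
      rw [LinearMap.add_apply, h.compl_single (Or.inl hi), flagOp_single, if_pos hi, add_zero])
    (fun i hi => by
      rw [LinearMap.add_apply, h.compl_single (Or.inr hi), flagOp_single,
        if_neg (not_lt.2 (h.le.trans hi)), add_zero])

lemma BUZ.flip_inStage {P : BUZ} {p q : ℤ} (h : P.InStage p q) : (P.flip p q h).InStage p q :=
  BUZ.ofStage_inStage ..

lemma BUZ.op_apply_eq_inn (P : BUZ) (w : V) (i : ℤ) :
    P.op w i = inn (P.op (Finsupp.single i 1)) w := by
  rw [P.hermitian, inn_single_left, map_one, one_mul]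

lemma BUZ.InStage.op_mem_between {P : BUZ} {p q : ℤ} (h : P.InStage p q) {w : V}
    (hw : w ∈ between p q) : P.op w ∈ between p q := mem_between.2 fun i hi => by
  rw [P.op_apply_eq_inn]
  rcases hi with hi' | hi'
  · rw [h.op_low hi', inn_single_left, mem_between.1 hw i (Or.inl hi'), mul_zero]
  · rw [h.op_high hi', inn_zero_left]

lemma single_mem_between {p q i : ℤ} (h : p ≤ i) (h' : i < q) (a : ℂ) :
    Finsupp.single i a ∈ between p q := mem_between.2 fun j hj => by
  rw [Finsupp.single_apply, if_neg (by omega)]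

/-- On `ℂ_p^q` the flipped projection is `1 - P`, so its fixed vectors there form the kernel of `P`,
which is the orthogonal complement of the range. -/
lemma BUZ.mem_flip_between {P : BUZ} {p q : ℤ} (h : P.InStage p q) (w : V) :
    w ∈ LinearMap.range (P.flip p q h).op ⊓ between p q ↔ w ∈ between p q ∧
      ∀ v ∈ LinearMap.range P.op ⊓ between p q, inn v w = 0 := by
  rw [Submodule.mem_inf, and_comm]
  refine and_congr_right fun hw => ?_
  have e : (P.flip p q h).op w = w - P.op w := by
    change flagOp p w + (flagOp q w - P.op w) = _
    have h1 : flagOp p w = 0 := Finsupp.ext fun i => by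
      rw [flagOp_apply, Finsupp.zero_apply]
      split_ifs with hi
      · exact mem_between.1 hw i (Or.inl hi)
      · rfl
    have h2 : flagOp q w = w := Finsupp.ext fun i => by
      rw [flagOp_apply]
      split_ifs with hi
      · rfl
      · exact (mem_between.1 hw i (Or.inr (not_lt.1 hi))).symm
    rw [h1, h2, zero_add]
  rw [BUZ.mem_range, e, sub_eq_self]
  refine ⟨fun h0 v hv => ?_, fun h0 => Finsupp.ext fun i => ?_⟩
  · rw [← (P.mem_range v).1 hv.1, P.hermitian, h0, inn_zero_right]
  · rw [Finsupp.zero_apply]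
    by_cases hi : i < p ∨ q ≤ i
    · exact mem_between.1 (h.op_mem_between hw) i hi
    · rw [P.op_apply_eq_inn]
      exact h0 _ ⟨⟨_, rfl⟩, h.op_mem_between (single_mem_between (by omega) (by omega) 1)⟩

lemma isAdj_shift (k : ℤ) : IsAdj (shift k) (shift (-k)) := by
  have e : relabel (Equiv.addRight k)⁻¹ = shift (-k) := LinearMap.ext fun x => Finsupp.ext fun i => by
    rw [shift, relabel_apply, relabel_apply]
    simp
  have h := isAdj_relabel (Equiv.addRight k)
  rwa [e] at h

lemma shift_mul_shift_of_add_eq_zero {k l : ℤ} (h : k + l = 0) : shift k * shift l = 1 := by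
  rw [shift_mul_shift, h, shift_zero]

lemma isAdj_sandwich {J J' A : Module.End ℂ V} (hJ : IsAdj J J') (hA : IsAdj A A) :
    IsAdj (J * A * J') (J * A * J') := by
  have h := (hJ.mul hA).mul hJ.symm
  rwa [← mul_assoc] at h

/-- The orthogonal complement `P^⊥`. -/
def BUZ.perp (P : BUZ) (p q : ℤ) (h : P.InStage p q) : BUZ :=
  BUZ.ofStage (shift (-(p + q)) * (P.flip p q h).op * shift (p + q))
    (by simpa only [neg_neg] using isAdj_sandwich (isAdj_shift (-(p + q))) (P.flip p q h).isAdj)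
    (by
      calc _ = shift (-(p + q)) * (P.flip p q h).op * (shift (p + q) * shift (-(p + q))) *
            (P.flip p q h).op * shift (p + q) := by simp only [mul_assoc]
        _ = _ := by
          rw [shift_mul_shift_of_add_eq_zero (by ring), mul_one, mul_assoc (shift _),
            BUZ.idem]) (-q) (-p)
    (fun i hi => by
      rw [Module.End.mul_apply, Module.End.mul_apply, shift_single,
        (BUZ.flip_inStage h).op_low (by omega), shift_single]
      congr 1
      ring)
    (fun i hi => by
      rw [Module.End.mul_apply, Module.End.mul_apply, shift_single,
        (BUZ.flip_inStage h).op_high (by omega), map_zero])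

lemma BUZ.perp_inStage {P : BUZ} {p q : ℤ} (h : P.InStage p q) :
    (P.perp p q h).InStage (-q) (-p) := BUZ.ofStage_inStage ..

lemma map_shift_below (k l : ℤ) : (below k).map (shift l) = below (k + l) := by
  rw [below_eq_span, below_eq_span, Submodule.map_span, ← Set.image_comp]
  congr 1
  ext x
  simp only [Set.mem_image, Set.mem_Iio, Function.comp_apply, shift_single]
  refine ⟨fun ⟨i, hi, e⟩ => ⟨i + l, by omega, e⟩, fun ⟨i, hi, e⟩ => ⟨i - l, by omega, ?_⟩⟩
  rw [sub_add_cancel, e]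

lemma BUZ.range_perp {P : BUZ} {p q : ℤ} (h : P.InStage p q) :
    LinearMap.range (P.perp p q h).op = below (-q) ⊔
      (LinearMap.range (P.flip p q h).op ⊓ between p q).map (shift (-p - q)) := by
  have e1 : LinearMap.range (P.perp p q h).op =
      (LinearMap.range (P.flip p q h).op).map (shift (-p - q)) := by
    have e2 : (P.perp p q h).op = (shift (-p - q) ∘ₗ (P.flip p q h).op) ∘ₗ shift (p + q) := by
      rw [show -p - q = -(p + q) by ring]
      rfl
    rw [e2, LinearMap.range_comp_of_range_eq_top, LinearMap.range_comp]
    rw [LinearMap.range_eq_top]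
    intro x
    refine ⟨shift (-(p + q)) x, ?_⟩
    rw [← Module.End.mul_apply, shift_mul_shift_of_add_eq_zero (by ring), Module.End.one_apply]
  rw [e1]
  conv_lhs => rw [(BUZ.flip_inStage h).range_eq, Submodule.map_sup, map_shift_below]
  congr 2
  ring

/-- The values of the orthogonal complement of a map are determined by the bounds. -/
lemma IsPerp.exists_eq {M : Type*} {P P' : M → BUZ} (h : IsPerp P P') :
    ∃ (p q : ℤ) (hP : ∀ x, (P x).InStage p q), P' = fun x => (P x).perp p q (hP x) := by
  obtain ⟨p, q, hP, hP'⟩ := h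
  refine ⟨p, q, hP, funext fun x => BUZ.ext_range ?_⟩
  obtain ⟨W, hW, e⟩ := hP' x
  rw [e, BUZ.range_perp]
  congr 2
  ext w
  rw [hW, BUZ.mem_flip_between]

lemma isPerp_perp {M : Type*} {P : M → BUZ} {p q : ℤ} (hP : ∀ x, (P x).InStage p q) :
    IsPerp P fun x => (P x).perp p q (hP x) :=
  ⟨p, q, hP, fun x => ⟨_, BUZ.mem_flip_between (hP x), BUZ.range_perp (hP x)⟩⟩

lemma shift_apply (k : ℤ) (x : V) (i : ℤ) : shift k x i = x (i - k) := by
  rw [shift, relabel_apply]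
  rfl

/-- Up to a constant the entry is minus an entry of `P` with shifted labels, so smoothness passes
from `P` to `P^⊥`. -/
lemma BUZ.perp_entry {P : BUZ} {p q : ℤ} (h : P.InStage p q) (i j : ℤ) :
    (P.perp p q h).entry i j = (flagOp p (Finsupp.single (j + (p + q)) 1) +
      flagOp q (Finsupp.single (j + (p + q)) 1)) (i + (p + q)) -
        P.entry (i + (p + q)) (j + (p + q)) := by
  change shift (-(p + q)) ((P.flip p q h).op (shift (p + q) (Finsupp.single j 1))) i = _
  rw [shift_apply, shift_single, sub_neg_eq_add]
  exact (add_sub_assoc _ _ _).symm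

end Perp

section SmoothPerp

variable {E : Type*} [NormedAddCommGroup E] [NormedSpace ℝ E] {H : Type*} [TopologicalSpace H]
  {I : ModelWithCorners ℝ E H} {M : Type*} [TopologicalSpace M] [ChartedSpace H M]

lemma IsSmooth.perp {P : M → BUZ} (hP : IsSmooth I P) {p q : ℤ}
    (h : ∀ x, (P x).InStage p q) : IsSmooth I fun x => (P x).perp p q (h x) := by
  refine isSmooth_iff.2 ⟨⟨p.natAbs + q.natAbs, fun x => (BUZ.perp_inStage (h x)).mono
    (by omega) (by omega)⟩, fun i j => ?_⟩
  simp only [BUZ.perp_entry]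
  exact contMDiff_const.sub (hP.contMDiff _ _)

omit [TopologicalSpace M] in
-- With `p = q = k` and `m = n = -k` both windows are empty and `p + m = 0`. This identifies the end
-- of the rotation of `P ⊞ P^⊥` with `I_0`.
lemma isBlockSum_flag (k : ℤ) : IsBlockSum (fun _ : M => flag k) (fun _ => flag (-k))
    fun _ => I0 := by
  have e : ∀ (l : ℤ) (W : Submodule ℂ V), W ⊓ between l l = ⊥ := fun l W => by
    refine le_bot_iff.1 fun y hy => ?_
    rw [Submodule.mem_bot]
    ext i
    exact mem_between.1 hy.2 i (by omega)
  refine ⟨k, k, -k, -k, fun _ => flag_inStage k, fun _ => flag_inStage _, fun x => ?_⟩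
  rw [e, e, Submodule.map_bot, Submodule.map_bot, sup_bot_eq, sup_bot_eq, I0_inStage.range_eq, e,
    sup_bot_eq, add_neg_cancel]

end SmoothPerp

/-! ### The rotation that cancels the orthogonal complement -/

section Cancel

/-- The adjoint of `evenEmb`. -/
def evenRes : Module.End ℂ V := LinearMap.fst ℂ V V ∘ₗ shuffle.toLinearMap

/-- The adjoint of `oddEmb`. -/
def oddRes : Module.End ℂ V := LinearMap.snd ℂ V V ∘ₗ shuffle.toLinearMap

lemma evenRes_apply (x : V) (k : ℤ) : evenRes x k = x (2 * k) := shuffle_fst x k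

lemma oddRes_apply (x : V) (k : ℤ) : oddRes x k = x (2 * k + 1) := shuffle_snd x k

lemma isAdj_evenEmb : IsAdj evenEmb evenRes := isAdj_of_entries fun i j => by
  rw [evenEmb_single, evenRes_apply, Finsupp.single_apply, Finsupp.single_apply]
  by_cases h : 2 * i = j
  · rw [if_pos h, if_pos h.symm, map_one]
  · rw [if_neg h, if_neg (Ne.symm h), map_zero]

lemma isAdj_oddEmb : IsAdj oddEmb oddRes := isAdj_of_entries fun i j => by
  rw [oddEmb_single, oddRes_apply, Finsupp.single_apply, Finsupp.single_apply]
  by_cases h : 2 * i + 1 = j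
  · rw [if_pos h, if_pos h.symm, map_one]
  · rw [if_neg h, if_neg (Ne.symm h), map_zero]

lemma evenRes_mul_evenEmb : evenRes * evenEmb = 1 := end_ext fun i => by
  rw [Module.End.mul_apply, evenEmb_eq]
  exact congrArg Prod.fst (shuffle.apply_symm_apply _)

lemma oddRes_mul_evenEmb : oddRes * evenEmb = 0 := end_ext fun i => by
  rw [Module.End.mul_apply, evenEmb_eq]
  exact congrArg Prod.snd (shuffle.apply_symm_apply _)

lemma evenRes_mul_oddEmb : evenRes * oddEmb = 0 := end_ext fun i => by
  rw [Module.End.mul_apply, oddEmb_eq]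
  exact congrArg Prod.fst (shuffle.apply_symm_apply _)

lemma oddRes_mul_oddEmb : oddRes * oddEmb = 1 := end_ext fun i => by
  rw [Module.End.mul_apply, oddEmb_eq]
  exact congrArg Prod.snd (shuffle.apply_symm_apply _)

/-- The odd embedding preceded by a shift, `e_i ↦ e_{2(i - d) + 1}`. -/
def oddEmbS (d : ℤ) : Module.End ℂ V := oddEmb * shift (-d)

/-- The adjoint of `oddEmbS`. -/
def oddResS (d : ℤ) : Module.End ℂ V := shift d * oddRes

lemma isAdj_oddEmbS (d : ℤ) : IsAdj (oddEmbS d) (oddResS d) := by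
  have h := isAdj_oddEmb.mul (isAdj_shift (-d))
  rwa [neg_neg] at h

lemma oddResS_mul_oddEmbS (d : ℤ) : oddResS d * oddEmbS d = 1 := by
  rw [oddResS, oddEmbS, mul_assoc, ← mul_assoc oddRes, oddRes_mul_oddEmb, one_mul,
    shift_mul_shift_of_add_eq_zero (add_neg_cancel d)]

lemma evenRes_mul_oddEmbS (d : ℤ) : evenRes * oddEmbS d = 0 := by
  rw [oddEmbS, ← mul_assoc, evenRes_mul_oddEmb, zero_mul]

lemma oddResS_mul_evenEmb (d : ℤ) : oddResS d * evenEmb = 0 := by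
  rw [oddResS, mul_assoc, oddRes_mul_evenEmb, mul_zero]

lemma IsAdj.smul_ofReal {A B : Module.End ℂ V} (h : IsAdj A B) (c : ℝ) :
    IsAdj ((c : ℂ) • A) ((c : ℂ) • B) := fun x y => by
  rw [LinearMap.smul_apply, LinearMap.smul_apply, inn_smul_left, inn_smul_right, h,
    Complex.conj_ofReal]

/-- The isometry `s J₀ + c J₁`. -/
def tiltEmb (d : ℤ) (s c : ℝ) : Module.End ℂ V := (s : ℂ) • evenEmb + (c : ℂ) • oddEmbS d

/-- The adjoint of `tiltEmb`. -/
def tiltRes (d : ℤ) (s c : ℝ) : Module.End ℂ V := (s : ℂ) • evenRes + (c : ℂ) • oddResS d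

lemma isAdj_tiltEmb (d : ℤ) (s c : ℝ) : IsAdj (tiltEmb d s c) (tiltRes d s c) :=
  (isAdj_evenEmb.smul_ofReal s).add ((isAdj_oddEmbS d).smul_ofReal c)

lemma evenRes_mul_tiltEmb (d : ℤ) (s c : ℝ) : evenRes * tiltEmb d s c = (s : ℂ) • 1 := by
  rw [tiltEmb, mul_add, mul_smul_comm, mul_smul_comm, evenRes_mul_evenEmb, evenRes_mul_oddEmbS,
    smul_zero, add_zero]

lemma oddResS_mul_tiltEmb (d : ℤ) (s c : ℝ) : oddResS d * tiltEmb d s c = (c : ℂ) • 1 := by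
  rw [tiltEmb, mul_add, mul_smul_comm, mul_smul_comm, oddResS_mul_evenEmb, oddResS_mul_oddEmbS,
    smul_zero, zero_add]

lemma tiltRes_mul_evenEmb (d : ℤ) (s c : ℝ) : tiltRes d s c * evenEmb = (s : ℂ) • 1 := by
  rw [tiltRes, add_mul, smul_mul_assoc, smul_mul_assoc, evenRes_mul_evenEmb, oddResS_mul_evenEmb,
    smul_zero, add_zero]

lemma tiltRes_mul_oddEmbS (d : ℤ) (s c : ℝ) : tiltRes d s c * oddEmbS d = (c : ℂ) • 1 := by
  rw [tiltRes, add_mul, smul_mul_assoc, smul_mul_assoc, evenRes_mul_oddEmbS, oddResS_mul_oddEmbS,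
    smul_zero, zero_add]

lemma tiltRes_mul_tiltEmb (d : ℤ) {s c : ℝ} (h : s * s + c * c = 1) :
    tiltRes d s c * tiltEmb d s c = 1 := by
  rw [tiltRes, add_mul, smul_mul_assoc, smul_mul_assoc, evenRes_mul_tiltEmb, oddResS_mul_tiltEmb,
    smul_smul, smul_smul, ← add_smul, ← Complex.ofReal_mul, ← Complex.ofReal_mul,
    ← Complex.ofReal_add, h, Complex.ofReal_one, one_smul]

/-- It evaluates each of the nine products in the square of `tiltOp`, where the inner pair of an
embedding and an adjoint is always a scalar. -/
lemma sandwich_mul {R : Type*} [Ring R] [Algebra ℂ R] {J K A B J' K' : R} (c : ℂ)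
    (h : J' * K = c • 1) : (J * A * J') * (K * B * K') = c • (J * (A * B) * K') := by
  calc (J * A * J') * (K * B * K') = J * A * (J' * K) * B * K' := by simp only [mul_assoc]
    _ = _ := by rw [h, mul_smul_comm, mul_one, smul_mul_assoc, smul_mul_assoc]; simp only [mul_assoc]

/-- The operator `J₀ P J₀* + J₁ χ_p J₁* + K (χ_q - P) K*` with `K = s J₀ + c J₁`. -/
def tiltOp (P : BUZ) (p q : ℤ) (s c : ℝ) : Module.End ℂ V :=
  evenEmb * P.op * evenRes + oddEmbS (p + q) * flagOp p * oddResS (p + q) +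
    tiltEmb (p + q) s c * P.compl q * tiltRes (p + q) s c

lemma isAdj_tiltOp (P : BUZ) (p q : ℤ) (s c : ℝ) : IsAdj (tiltOp P p q s c) (tiltOp P p q s c) :=
  ((isAdj_sandwich isAdj_evenEmb P.isAdj).add
    (isAdj_sandwich (isAdj_oddEmbS _) (isAdj_flagOp p))).add
      (isAdj_sandwich (isAdj_tiltEmb _ s c) (P.isAdj_compl q))

/-- The three summands are mutually orthogonal projections. The image of `K` meets those of `J₀` and
`J₁` nontrivially, but the mixed products vanish because `χ_q - P` annihilates both `P` and `χ_p`,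
and `J₀* J₁ = 0`. -/
lemma tiltOp_idem {P : BUZ} {p q : ℤ} (h : P.InStage p q) {s c : ℝ} (hsc : s * s + c * c = 1) :
    tiltOp P p q s c * tiltOp P p q s c = tiltOp P p q s c := by
  have e00 := sandwich_mul (J := evenEmb) (K' := evenRes) (A := P.op) (B := P.op) 1
    (evenRes_mul_evenEmb.trans (one_smul ℂ _).symm)
  have e01 := sandwich_mul (J := evenEmb) (K' := oddResS (p + q)) (A := P.op) (B := flagOp p) 0
    ((evenRes_mul_oddEmbS (p + q)).trans (zero_smul ℂ _).symm)
  have e02 := sandwich_mul (J := evenEmb) (K' := tiltRes (p + q) s c) (A := P.op)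
    (B := P.compl q) s (evenRes_mul_tiltEmb (p + q) s c)
  have e10 := sandwich_mul (J := oddEmbS (p + q)) (K' := evenRes) (A := flagOp p) (B := P.op) 0
    ((oddResS_mul_evenEmb (p + q)).trans (zero_smul ℂ _).symm)
  have e11 := sandwich_mul (J := oddEmbS (p + q)) (K' := oddResS (p + q)) (A := flagOp p)
    (B := flagOp p) 1 ((oddResS_mul_oddEmbS (p + q)).trans (one_smul ℂ _).symm)
  have e12 := sandwich_mul (J := oddEmbS (p + q)) (K' := tiltRes (p + q) s c) (A := flagOp p)
    (B := P.compl q) c (oddResS_mul_tiltEmb (p + q) s c)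
  have e20 := sandwich_mul (J := tiltEmb (p + q) s c) (K' := evenRes) (A := P.compl q)
    (B := P.op) s (tiltRes_mul_evenEmb (p + q) s c)
  have e21 := sandwich_mul (J := tiltEmb (p + q) s c) (K' := oddResS (p + q)) (A := P.compl q)
    (B := flagOp p) c (tiltRes_mul_oddEmbS (p + q) s c)
  have e22 := sandwich_mul (J := tiltEmb (p + q) s c) (K' := tiltRes (p + q) s c)
    (A := P.compl q) (B := P.compl q) 1
    ((tiltRes_mul_tiltEmb (p + q) hsc).trans (one_smul ℂ _).symm)
  rw [P.idem, one_smul] at e00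
  rw [zero_smul] at e01 e10
  rw [flagOp_mul_flagOp le_rfl, one_smul] at e11
  rw [h.op_mul_compl, mul_zero, zero_mul, smul_zero] at e02
  rw [h.flagOp_mul_compl, mul_zero, zero_mul, smul_zero] at e12
  rw [h.compl_mul_op, mul_zero, zero_mul, smul_zero] at e20
  rw [h.compl_mul_flagOp, mul_zero, zero_mul, smul_zero] at e21
  rw [h.compl_mul_compl, one_smul] at e22
  rw [tiltOp, add_mul, add_mul, mul_add, mul_add, mul_add, mul_add, mul_add, mul_add, e00, e01,
    e02, e10, e11, e12, e20, e21, e22]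
  simp only [add_zero, zero_add]

lemma evenRes_single_even (k : ℤ) : evenRes (Finsupp.single (2 * k) 1) = Finsupp.single k 1 := by
  rw [← evenEmb_single, ← Module.End.mul_apply, evenRes_mul_evenEmb, Module.End.one_apply]

lemma oddResS_single_even (d k : ℤ) : oddResS d (Finsupp.single (2 * k) 1) = 0 := by
  rw [← evenEmb_single, ← Module.End.mul_apply, oddResS_mul_evenEmb, LinearMap.zero_apply]

lemma oddEmbS_single (d k : ℤ) (a : ℂ) :
    oddEmbS d (Finsupp.single k a) = Finsupp.single (2 * (k - d) + 1) a := by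
  rw [oddEmbS, Module.End.mul_apply, shift_single, oddEmb_single, sub_eq_add_neg]

lemma evenRes_single_odd (d k : ℤ) : evenRes (Finsupp.single (2 * (k - d) + 1) 1) = 0 := by
  rw [← oddEmbS_single, ← Module.End.mul_apply, evenRes_mul_oddEmbS, LinearMap.zero_apply]

lemma oddResS_single_odd (d k : ℤ) :
    oddResS d (Finsupp.single (2 * (k - d) + 1) 1) = Finsupp.single k 1 := by
  rw [← oddEmbS_single, ← Module.End.mul_apply, oddResS_mul_oddEmbS, Module.End.one_apply]

lemma tiltOp_even (P : BUZ) (p q : ℤ) (s c : ℝ) (k : ℤ) :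
    tiltOp P p q s c (Finsupp.single (2 * k) 1) = evenEmb (P.op (Finsupp.single k 1)) +
      (s : ℂ) • tiltEmb (p + q) s c (P.compl q (Finsupp.single k 1)) := by
  simp only [tiltOp, LinearMap.add_apply, Module.End.mul_apply, tiltRes, LinearMap.smul_apply,
    evenRes_single_even, oddResS_single_even, map_zero, smul_zero, add_zero, map_smul]

lemma tiltOp_odd (P : BUZ) (p q : ℤ) (s c : ℝ) (k : ℤ) :
    tiltOp P p q s c (Finsupp.single (2 * (k - (p + q)) + 1) 1) =
      oddEmbS (p + q) (flagOp p (Finsupp.single k 1)) +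
      (c : ℂ) • tiltEmb (p + q) s c (P.compl q (Finsupp.single k 1)) := by
  simp only [tiltOp, LinearMap.add_apply, Module.End.mul_apply, tiltRes, LinearMap.smul_apply,
    evenRes_single_odd, oddResS_single_odd, map_zero, smul_zero, zero_add, map_smul]

lemma evenEmb_apply_even (x : V) (k : ℤ) : evenEmb x (2 * k) = x k := by
  rw [← evenRes_apply, ← Module.End.mul_apply, evenRes_mul_evenEmb, Module.End.one_apply]

lemma evenEmb_apply_odd (x : V) (k : ℤ) : evenEmb x (2 * k + 1) = 0 := by
  rw [← oddRes_apply, ← Module.End.mul_apply, oddRes_mul_evenEmb]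
  rfl

lemma oddEmbS_apply_even (d : ℤ) (x : V) (k : ℤ) : oddEmbS d x (2 * k) = 0 := by
  rw [← evenRes_apply, ← Module.End.mul_apply, evenRes_mul_oddEmbS]
  rfl

lemma oddEmbS_apply_odd (d : ℤ) (x : V) (k : ℤ) : oddEmbS d x (2 * (k - d) + 1) = x k := by
  have h : oddResS d (oddEmbS d x) = x := by
    rw [← Module.End.mul_apply, oddResS_mul_oddEmbS, Module.End.one_apply]
  conv_rhs => rw [← h]
  rw [← oddRes_apply, oddResS, Module.End.mul_apply, shift_apply]

lemma even_or_odd_shift (d a : ℤ) : (∃ k, a = 2 * k) ∨ ∃ k, a = 2 * (k - d) + 1 := by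
  rcases Int.even_or_odd' a with ⟨k, h | h⟩
  · exact Or.inl ⟨k, h⟩
  · exact Or.inr ⟨k + d, by omega⟩

lemma tiltOp_low {P : BUZ} {p q : ℤ} (h : P.InStage p q) (s c : ℝ) {i : ℤ}
    (hi : i < 2 * min p (-q)) : tiltOp P p q s c (Finsupp.single i 1) = Finsupp.single i 1 := by
  rcases even_or_odd_shift (p + q) i with ⟨k, rfl | rfl⟩ | ⟨k, rfl | rfl⟩
  · rw [tiltOp_even, h.compl_single (Or.inl (by omega)), h.op_low (by omega), map_zero, smul_zero,
      add_zero, evenEmb_single]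
  · rw [tiltOp_odd, h.compl_single (Or.inl (by omega)), flagOp_single, if_pos (by omega),
      map_zero, smul_zero, add_zero, oddEmbS_single]

lemma tiltOp_high {P : BUZ} {p q : ℤ} (h : P.InStage p q) (s c : ℝ) {i : ℤ}
    (hi : 2 * max q (-p) ≤ i) : tiltOp P p q s c (Finsupp.single i 1) = 0 := by
  have := h.le
  rcases even_or_odd_shift (p + q) i with ⟨k, rfl | rfl⟩ | ⟨k, rfl | rfl⟩
  · rw [tiltOp_even, h.compl_single (Or.inr (by omega)), h.op_high (by omega), map_zero, map_zero,
      smul_zero, add_zero]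
  · rw [tiltOp_odd, h.compl_single (Or.inr (by omega)), flagOp_single, if_neg (by omega),
      map_zero, map_zero, smul_zero, add_zero]

/-- The point of `BU × ℤ` given by `tiltOp`. -/
def tilt (P : BUZ) (p q : ℤ) (h : P.InStage p q) (s c : ℝ) (hsc : s * s + c * c = 1) : BUZ :=
  BUZ.ofStage (tiltOp P p q s c) (isAdj_tiltOp P p q s c) (tiltOp_idem h hsc) (2 * min p (-q))
    (2 * max q (-p)) (fun _ => tiltOp_low h s c) (fun _ => tiltOp_high h s c)

lemma tilt_inStage {P : BUZ} {p q : ℤ} (h : P.InStage p q) (s c : ℝ) (hsc) :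
    (tilt P p q h s c hsc).InStage (2 * min p (-q)) (2 * max q (-p)) := BUZ.ofStage_inStage ..

lemma tiltEmb_apply (d : ℤ) (s c : ℝ) (x : V) (i : ℤ) :
    tiltEmb d s c x i = s * evenEmb x i + c * oddEmbS d x i := rfl

section Entries

variable {P : BUZ} {p q : ℤ} (h : P.InStage p q) (s c : ℝ) (hsc : s * s + c * c = 1) (i j : ℤ)

lemma tilt_entry_even_even : (tilt P p q h s c hsc).entry (2 * i) (2 * j) =
    P.entry i j + s * s * P.compl q (Finsupp.single j 1) i := by
  change tiltOp P p q s c (Finsupp.single (2 * j) 1) (2 * i) = _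
  rw [tiltOp_even, Finsupp.add_apply, Finsupp.smul_apply, tiltEmb_apply, evenEmb_apply_even,
    evenEmb_apply_even, oddEmbS_apply_even, smul_eq_mul, BUZ.entry]
  ring

lemma tilt_entry_odd_even : (tilt P p q h s c hsc).entry (2 * (i - (p + q)) + 1) (2 * j) =
    s * c * P.compl q (Finsupp.single j 1) i := by
  change tiltOp P p q s c (Finsupp.single (2 * j) 1) (2 * (i - (p + q)) + 1) = _
  rw [tiltOp_even, Finsupp.add_apply, Finsupp.smul_apply, tiltEmb_apply, evenEmb_apply_odd,
    evenEmb_apply_odd, oddEmbS_apply_odd, smul_eq_mul]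
  ring

lemma tilt_entry_even_odd : (tilt P p q h s c hsc).entry (2 * i) (2 * (j - (p + q)) + 1) =
    s * c * P.compl q (Finsupp.single j 1) i := by
  change tiltOp P p q s c (Finsupp.single (2 * (j - (p + q)) + 1) 1) (2 * i) = _
  rw [tiltOp_odd, Finsupp.add_apply, Finsupp.smul_apply, tiltEmb_apply, evenEmb_apply_even,
    oddEmbS_apply_even, oddEmbS_apply_even, smul_eq_mul]
  ring

lemma tilt_entry_odd_odd :
    (tilt P p q h s c hsc).entry (2 * (i - (p + q)) + 1) (2 * (j - (p + q)) + 1) =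
      flagOp p (Finsupp.single j 1) i + c * c * P.compl q (Finsupp.single j 1) i := by
  change tiltOp P p q s c (Finsupp.single (2 * (j - (p + q)) + 1) 1) (2 * (i - (p + q)) + 1) = _
  rw [tiltOp_odd, Finsupp.add_apply, Finsupp.smul_apply, tiltEmb_apply, evenEmb_apply_odd,
    oddEmbS_apply_odd, oddEmbS_apply_odd, smul_eq_mul]
  ring

end Entries

/-- The ends of the rotation. -/
lemma tilt_zero_one {P : BUZ} {p q : ℤ} (h : P.InStage p q) (hsc) :
    tilt P p q h 0 1 hsc = boxplus P (P.perp p q h) := by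
  refine BUZ.ext_entry fun a b => ?_
  rcases even_or_odd_shift (p + q) a with ⟨i, rfl⟩ | ⟨i, rfl⟩ <;>
    rcases even_or_odd_shift (p + q) b with ⟨j, rfl⟩ | ⟨j, rfl⟩ <;>
    rw [boxplus_entry]
  · rw [tilt_entry_even_even, if_pos (by omega), if_pos (by omega),
      Int.mul_ediv_cancel_left _ two_ne_zero, Int.mul_ediv_cancel_left _ two_ne_zero]
    simp
  · rw [tilt_entry_even_odd, if_pos (by omega), if_neg (by omega)]
    simp
  · rw [tilt_entry_odd_even, if_neg (by omega), if_pos (by omega)]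
    simp
  · have e : ∀ i : ℤ, (2 * (i - (p + q)) + 1) / 2 + (p + q) = i := fun i => by omega
    rw [tilt_entry_odd_odd, if_neg (by omega), if_neg (by omega), BUZ.perp_entry, e, e,
      BUZ.compl, LinearMap.sub_apply, Finsupp.sub_apply, Finsupp.add_apply, BUZ.entry]
    simp only [Complex.ofReal_one]
    ring

lemma flag_entry (k i j : ℤ) : (flag k).entry i j = flagOp k (Finsupp.single j 1) i := rfl

/-- Here `K = J₀`: in the even labels `P` and `χ_q - P` add up to `χ_q`, and in the odd ones there
remains `χ_p`, moved by `-(p + q)` to the flag at `-q`. -/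
lemma tilt_one_zero {P : BUZ} {p q : ℤ} (h : P.InStage p q) (hsc) :
    tilt P p q h 1 0 hsc = boxplus (flag q) (flag (-q)) := by
  refine BUZ.ext_entry fun a b => ?_
  rcases even_or_odd_shift (p + q) a with ⟨i, rfl⟩ | ⟨i, rfl⟩ <;>
    rcases even_or_odd_shift (p + q) b with ⟨j, rfl⟩ | ⟨j, rfl⟩ <;>
    rw [boxplus_entry]
  · rw [tilt_entry_even_even, if_pos (by omega), if_pos (by omega),
      Int.mul_ediv_cancel_left _ two_ne_zero, Int.mul_ediv_cancel_left _ two_ne_zero, flag_entry,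
      BUZ.compl, LinearMap.sub_apply, Finsupp.sub_apply, BUZ.entry]
    simp
  · rw [tilt_entry_even_odd, if_pos (by omega), if_neg (by omega)]
    simp
  · rw [tilt_entry_odd_even, if_neg (by omega), if_pos (by omega)]
    simp
  · rw [tilt_entry_odd_odd, if_neg (by omega), if_neg (by omega), flag_entry, flagOp_apply,
      flagOp_apply, Finsupp.single_apply, Finsupp.single_apply]
    have e : ∀ i : ℤ, (2 * (i - (p + q)) + 1) / 2 = i - (p + q) := fun i => by omega
    rw [e, e]
    by_cases hij : j = i
    · by_cases hi : i < p
      · rw [if_pos hi, if_pos hij, if_pos (by omega), if_pos (by omega)]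
        simp
      · rw [if_neg hi, if_neg (by omega)]
        simp
    · simp [hij]

end Cancel

/-! ### Smoothness and vanishing Chern–Simons form of the rotation of the complement. -/

section CancelHomotopy

variable {E : Type*} [NormedAddCommGroup E] [NormedSpace ℝ E] {H : Type*} [TopologicalSpace H]
  {I : ModelWithCorners ℝ E H} {M : Type*} [TopologicalSpace M] [ChartedSpace H M]

lemma sin_mul_sin_add_cos_mul_cos (θ : ℝ) :
    Real.sin θ * Real.sin θ + Real.cos θ * Real.cos θ = 1 := by
  rw [← sq, ← sq, Real.sin_sq_add_cos_sq]

/-- The rotation from `P ⊞ P^⊥` to a sum of constant maps. -/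
def tiltPath (P : BUZ) (p q : ℤ) (h : P.InStage p q) (t : ℝ) : BUZ :=
  tilt P p q h (Real.sin (Real.pi / 2 * t)) (Real.cos (Real.pi / 2 * t))
    (sin_mul_sin_add_cos_mul_cos _)

lemma tiltPath_zero {P : BUZ} {p q : ℤ} (h : P.InStage p q) :
    tiltPath P p q h 0 = boxplus P (P.perp p q h) := by
  rw [← tilt_zero_one h (by norm_num)]
  simp only [tiltPath, mul_zero, Real.sin_zero, Real.cos_zero]

lemma tiltPath_one {P : BUZ} {p q : ℤ} (h : P.InStage p q) :
    tiltPath P p q h 1 = boxplus (flag q) (flag (-q)) := by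
  rw [← tilt_one_zero h (by norm_num)]
  simp only [tiltPath, mul_one, Real.sin_pi_div_two, Real.cos_pi_div_two]

lemma tiltPath_inStage {P : BUZ} {p q : ℤ} (h : P.InStage p q) (t : ℝ) :
    (tiltPath P p q h t).InStage (2 * min p (-q)) (2 * max q (-p)) := tilt_inStage h _ _ _

/-- The labels on which the rotation is not constant. -/
def tiltLabel (p q : ℤ) : Finset.Ico p q ⊕ Finset.Ico p q → ℤ :=
  Sum.elim (fun i => 2 * i) fun i => 2 * (i - (p + q)) + 1

lemma tiltLabel_injective (p q : ℤ) : Function.Injective (tiltLabel p q) := by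
  rintro (i | i) (j | j) h <;> simp only [tiltLabel, Sum.elim_inl, Sum.elim_inr] at h
  · exact congrArg _ (Subtype.ext (by omega))
  · omega
  · omega
  · exact congrArg _ (Subtype.ext (by omega))

/-- The column labelled `b` of the rotation is constant unless `b` is one of the labels. -/
lemma tiltPath_entry_const {P : BUZ} {p q : ℤ} (h : P.InStage p q) (t : ℝ) (a : ℤ) {b : ℤ}
    (hb : b ∉ Set.range (tiltLabel p q)) : (tiltPath P p q h t).entry a b =
      if b % 2 = 0 then (if b / 2 < p then (Finsupp.single b (1 : ℂ)) a else 0)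
      else if b / 2 + (p + q) < p then (Finsupp.single b (1 : ℂ)) a else 0 := by
  have hpq := h.le
  rcases even_or_odd_shift (p + q) b with ⟨k, rfl⟩ | ⟨k, rfl⟩
  · have hk : k < p ∨ q ≤ k := by
      by_contra hk
      exact hb ⟨Sum.inl ⟨k, Finset.mem_Ico.2 (by omega)⟩, rfl⟩
    rw [if_pos (by omega), Int.mul_ediv_cancel_left _ two_ne_zero]
    change tiltOp P p q _ _ (Finsupp.single (2 * k) 1) a = _
    rw [tiltOp_even, h.compl_single hk, map_zero, smul_zero, add_zero]
    rcases hk with hk | hk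
    · rw [if_pos hk, h.op_low hk, evenEmb_single]
    · rw [if_neg (by omega), h.op_high hk, map_zero, Finsupp.zero_apply]
  · have hk : k < p ∨ q ≤ k := by
      by_contra hk
      exact hb ⟨Sum.inr ⟨k, Finset.mem_Ico.2 (by omega)⟩, rfl⟩
    have e : (2 * (k - (p + q)) + 1) / 2 + (p + q) = k := by omega
    rw [if_neg (by omega), e]
    change tiltOp P p q _ _ (Finsupp.single (2 * (k - (p + q)) + 1) 1) a = _
    rw [tiltOp_odd, h.compl_single hk, map_zero, smul_zero, add_zero, flagOp_single]
    split_ifs with hk'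
    · rw [oddEmbS_single]
    · rw [map_zero, Finsupp.zero_apply]

lemma contDiff_tilt_sin : ContDiff ℝ ∞ fun t : ℝ => (Real.sin (Real.pi / 2 * t) : ℂ) :=
  Complex.ofRealCLM.contDiff.comp (Real.contDiff_sin.comp (contDiff_const.mul contDiff_id))

lemma contDiff_tilt_cos : ContDiff ℝ ∞ fun t : ℝ => (Real.cos (Real.pi / 2 * t) : ℂ) :=
  Complex.ofRealCLM.contDiff.comp (Real.contDiff_cos.comp (contDiff_const.mul contDiff_id))

lemma isSmoothOn_tiltPath {P : M → BUZ} (hP : IsSmooth I P) {p q : ℤ}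
    (h : ∀ x, (P x).InStage p q) :
    IsSmoothOn (I.prod 𝓘(ℝ, ℝ)) (fun y : M × ℝ => tiltPath (P y.1) p q (h y.1) y.2)
      (cylinder M) := by
  refine ⟨⟨2 * (p.natAbs + q.natAbs), fun y _ => (tiltPath_inStage (h y.1) y.2).mono
    (by omega) (by omega)⟩, fun a b => ContMDiff.contMDiffOn ?_⟩
  have hs : ContMDiff (I.prod 𝓘(ℝ, ℝ)) 𝓘(ℝ, ℂ) ∞
      fun y : M × ℝ => (Real.sin (Real.pi / 2 * y.2) : ℂ) :=
    contDiff_tilt_sin.contMDiff.comp contMDiff_snd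
  have hc : ContMDiff (I.prod 𝓘(ℝ, ℝ)) 𝓘(ℝ, ℂ) ∞
      fun y : M × ℝ => (Real.cos (Real.pi / 2 * y.2) : ℂ) :=
    contDiff_tilt_cos.contMDiff.comp contMDiff_snd
  have hp : ∀ i j, ContMDiff (I.prod 𝓘(ℝ, ℝ)) 𝓘(ℝ, ℂ) ∞ fun y : M × ℝ => (P y.1).entry i j :=
    fun i j => (hP.contMDiff i j).comp contMDiff_fst
  have hq : ∀ i j, ContMDiff (I.prod 𝓘(ℝ, ℝ)) 𝓘(ℝ, ℂ) ∞
      fun y : M × ℝ => (P y.1).compl q (Finsupp.single j 1) i :=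
    fun i j => contMDiff_const.sub (hp i j)
  rcases even_or_odd_shift (p + q) a with ⟨i, rfl⟩ | ⟨i, rfl⟩ <;>
    rcases even_or_odd_shift (p + q) b with ⟨j, rfl⟩ | ⟨j, rfl⟩
  · simp only [tiltPath, tilt_entry_even_even]
    exact (hp i j).add (ContMDiff.mul_complex (ContMDiff.mul_complex hs hs) (hq i j))
  · simp only [tiltPath, tilt_entry_even_odd]
    exact ContMDiff.mul_complex (ContMDiff.mul_complex hs hc) (hq i j)
  · simp only [tiltPath, tilt_entry_odd_even]
    exact ContMDiff.mul_complex (ContMDiff.mul_complex hs hc) (hq i j)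
  · simp only [tiltPath, tilt_entry_odd_odd]
    exact contMDiff_const.add (ContMDiff.mul_complex (ContMDiff.mul_complex hc hc) (hq i j))

lemma blk_mul_blk {P : BUZ} {p q : ℤ} (h : P.InStage p q) :
    blk (Subtype.val : Finset.Ico p q → ℤ) P * blk Subtype.val P = blk Subtype.val P := by
  ext i j
  have hj := Finset.mem_Ico.1 j.2
  have e : P.op (P.op (Finsupp.single j 1)) = P.op (Finsupp.single j 1) := P.idem_apply _
  rw [h.op_eq_sum (x := P.op (Finsupp.single j 1)) fun k hk => (h.entry_low (Or.inl hk)).trans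
    (if_neg (by omega))] at e
  have e' := DFunLike.congr_fun e i.1
  rw [Finsupp.finsetSum_apply, ← Finset.sum_coe_sort] at e'
  rw [Matrix.mul_apply]
  refine Eq.trans (Finset.sum_congr rfl fun k _ => ?_) e'
  exact mul_comm _ _

/-- Differentiating `F² = F` gives `dF F + F dF = dF`. -/
lemma dMb_anticommute {ι : Type*} [Fintype ι] [DecidableEq ι] {F : M → Matrix ι ι ℂ}
    (hF : ∀ i j, MDifferentiable I 𝓘(ℝ, ℂ) fun x => F x i j) (h : ∀ x, F x * F x = F x) (x : M)
    (v : E) : ((2 : ℂ) • F x - 1) * dMb I F x v = -(dMb I F x v * ((2 : ℂ) • F x - 1)) := by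
  have e : dMb I F x v * F x + F x * dMb I F x v = dMb I F x v := by
    rw [← dMb_mul hF hF v]
    exact congrArg (fun q => dMb I q x v) (funext h)
  rw [sub_mul, mul_sub, smul_mul_assoc, mul_smul_comm, one_mul, mul_one]
  rw [neg_sub, sub_eq_sub_iff_add_eq_add, ← smul_add, add_comm (F x * _), e, two_smul]

lemma dMb_one_sub {ι : Type*} [DecidableEq ι] {F : M → Matrix ι ι ℂ}
    (hF : ∀ i j, MDifferentiable I 𝓘(ℝ, ℂ) fun x => F x i j) (x : M) (v : E) :
    dMb I (fun y => 1 - F y) x v = -dMb I F x v := by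
  ext i j
  have hd : MD I (fun y => (1 - F y) i j) Set.univ x :=
    (mdifferentiableWithinAt_const (c := (1 : Matrix ι ι ℂ) i j)).sub
      (hF i j x).mdifferentiableWithinAt
  have h := dS_add (uniqueMDiffWithinAt_univ I) hd (hF i j x).mdifferentiableWithinAt v
  have e : (fun y => (1 - F y) i j + F y i j) = fun _ => (1 : Matrix ι ι ℂ) i j :=
    funext fun y => sub_add_cancel _ _
  exact eq_neg_of_add_eq_zero_left (h.symm.trans
    ((congrArg (fun f => dS I f Set.univ x v) e).trans (dS_const _ _ _ _)))

lemma dMb_fromBlocks {ι κ ι' κ' : Type*} (A : M → Matrix ι κ ℂ) (D : M → Matrix ι' κ' ℂ) (x : M)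
    (v : E) : dMb I (fun y => Matrix.fromBlocks (A y) 0 0 (D y)) x v =
      Matrix.fromBlocks (dMb I A x v) 0 0 (dMb I D x v) := by
  ext (i | i) (j | j)
  · rfl
  · exact dS_const _ _ _ _
  · exact dS_const _ _ _ _
  · rfl

/-- The rotation has scalar blocks, so it commutes with the reflection `2P - 1` placed in both
summands. This reflection therefore commutes with the time derivative, while it anticommutes with
spatial derivatives: the signs are opposite to those of the paths of isometries. -/
lemma isHomotopy_tiltPath {P : M → BUZ} (hP : IsSmooth I P) {p q : ℤ}
    (h : ∀ x, (P x).InStage p q) :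
    IsHomotopy I (fun y : M × ℝ => tiltPath (P y.1) p q (h y.1) y.2)
      (fun x => boxplus (P x) ((P x).perp p q (h x)))
      (fun _ => boxplus (flag q) (flag (-q))) ∧
      ∀ n x v, CS I (fun y : M × ℝ => tiltPath (P y.1) p q (h y.1) y.2) n x v = 0 := by
  refine ⟨⟨isSmoothOn_tiltPath hP h, fun x => tiltPath_zero (h x), fun x => tiltPath_one (h x)⟩,
    fun n x v => ?_⟩
  let ι := Finset.Ico p q
  let F : M → Matrix ι ι ℂ := fun x => blk Subtype.val (P x)
  -- On the window the path has the form `U F2 Z`, where `P` is carried by `J₀` and its complement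
  -- by `s J₀ + c J₁`. The columns of `U` are these two embeddings, and `Z` is the adjoint; `Z U` is
  -- not the identity, so the argument for isometries does not apply.
  let F2 : M → Matrix (ι ⊕ ι) (ι ⊕ ι) ℂ := fun x => Matrix.fromBlocks (F x) 0 0 (1 - F x)
  let s : ℝ → ℂ := fun t => (Real.sin (Real.pi / 2 * t) : ℂ)
  let c : ℝ → ℂ := fun t => (Real.cos (Real.pi / 2 * t) : ℂ)
  let U : ℝ → Matrix (ι ⊕ ι) (ι ⊕ ι) ℂ := fun t => Matrix.fromBlocks 1 (s t • 1) 0 (c t • 1)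
  let Z : ℝ → Matrix (ι ⊕ ι) (ι ⊕ ι) ℂ := fun t => Matrix.fromBlocks 1 0 (s t • 1) (c t • 1)
  have hsd : ∀ t, HasDerivAt s (deriv s t) t := fun t =>
    (contDiff_tilt_sin.differentiable (by simp) t).hasDerivAt
  have hcd : ∀ t, HasDerivAt c (deriv c t) t := fun t =>
    (contDiff_tilt_cos.differentiable (by simp) t).hasDerivAt
  let U' : ℝ → Matrix (ι ⊕ ι) (ι ⊕ ι) ℂ := fun t =>
    Matrix.fromBlocks 0 (deriv s t • 1) 0 (deriv c t • 1)
  let Z' : ℝ → Matrix (ι ⊕ ι) (ι ⊕ ι) ℂ := fun t =>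
    Matrix.fromBlocks 0 0 (deriv s t • 1) (deriv c t • 1)
  have hUd : ∀ t i j, HasDerivAt (fun t => U t i j) (U' t i j) t := by
    rintro t (i | i) (j | j)
    · exact hasDerivAt_const _ _
    · exact (hsd t).mul_const _
    · exact hasDerivAt_const _ _
    · exact (hcd t).mul_const _
  have hZd : ∀ t i j, HasDerivAt (fun t => Z t i j) (Z' t i j) t := by
    rintro t (i | i) (j | j)
    · exact hasDerivAt_const _ _
    · exact hasDerivAt_const _ _
    · exact (hsd t).mul_const _
    · exact (hcd t).mul_const _
  have hFd : ∀ i j, MDifferentiable I 𝓘(ℝ, ℂ) fun x => F x i j := fun i j =>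
    (hP.contMDiff i j).mdifferentiable (by simp)
  have hF2d : ∀ i j, MDifferentiable I 𝓘(ℝ, ℂ) fun x => F2 x i j := by
    rintro (i | i) (j | j)
    · exact hFd i j
    · exact mdifferentiable_const
    · exact mdifferentiable_const
    · exact (mdifferentiable_const (c := (1 : Matrix ι ι ℂ) i j)).sub (hFd i j)
  have hFF : ∀ x, F x * F x = F x := fun x => blk_mul_blk (h x)
  let e : Matrix ι ι ℂ := (2 : ℂ) • F x - 1
  have hee : e * e = 1 := by
    rw [sub_mul, mul_sub, smul_mul_assoc, mul_smul_comm, hFF, one_mul, mul_one]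
    module
  let ε : Matrix (ι ⊕ ι) (ι ⊕ ι) ℂ := Matrix.fromBlocks e 0 0 e
  have hεε : ε * ε = 1 := by
    rw [Matrix.fromBlocks_multiply, hee, ← Matrix.fromBlocks_one]
    simp
  have hεB : ∀ a b c d : ℂ, Commute ε (Matrix.fromBlocks (a • 1) (b • 1) (c • 1) (d • 1)) := by
    intro a b c d
    rw [commute_iff_eq, Matrix.fromBlocks_multiply, Matrix.fromBlocks_multiply]
    simp
  have hεU : ∀ t, Commute ε (U t) := fun t => by simpa using hεB 1 (s t) 0 (c t)
  have hεZ : ∀ t, Commute ε (Z t) := fun t => by simpa using hεB 1 0 (s t) (c t)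
  have hεU' : ∀ t, Commute ε (U' t) := fun t => by simpa using hεB 0 (deriv s t) 0 (deriv c t)
  have hεZ' : ∀ t, Commute ε (Z' t) := fun t => by simpa using hεB 0 0 (deriv s t) (deriv c t)
  have heF : Commute e (F x) :=
    ((Commute.refl (F x)).smul_left (2 : ℂ)).sub_left (Commute.one_left _)
  have hεF : Commute ε (F2 x) := by
    rw [commute_iff_eq, Matrix.fromBlocks_multiply, Matrix.fromBlocks_multiply, heF.eq,
      ((Commute.one_right e).sub_right heF).eq]
    simp
  have hεd : ∀ w : E, ε * dMb I F2 x w = -(dMb I F2 x w * ε) := fun w => by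
    have h1 := dMb_anticommute hFd hFF x w
    rw [dMb_fromBlocks, dMb_one_sub hFd, Matrix.fromBlocks_multiply, Matrix.fromBlocks_multiply,
      Matrix.fromBlocks_neg]
    simp [e, h1]
  refine CS_eq_zero_of_involution (N := 2 * (p.natAbs + q.natAbs))
    (fun y _ => (tiltPath_inStage (h y.1) y.2).mono (by omega) (by omega))
    (tiltLabel p q) (tiltLabel_injective p q) ?_ (fun a b hab => ?_)
    -- The time derivative contributes `1` and the odd number `2n + 1` of spatial derivatives
    -- contributes `-1`.
    (fun y => U y.2 * F2 y.1 * Z y.2) (fun y _ => ?_) x 1 (-1)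
    (fun n => by rw [one_mul, pow_succ, pow_mul]; norm_num)
    (fun t ht => ⟨ε, hεε, (((hεU t).mul_right hεF).mul_right (hεZ t)).eq, ?_, fun w => ?_⟩) n v
  · rintro (i | i) <;> have := Finset.mem_Ico.1 i.2 <;>
      simp only [tiltLabel, Sum.elim_inl, Sum.elim_inr] <;> omega
  · by_cases hb : b ∈ Set.range (tiltLabel p q)
    · have ha := hab.resolve_right (not_not.2 hb)
      exact ⟨_, fun y _ => (BUZ.entry_conj _ _ _).symm.trans
        (congrArg (starRingEnd ℂ) (tiltPath_entry_const (h y.1) y.2 b ha))⟩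
    · exact ⟨_, fun y _ => tiltPath_entry_const (h y.1) y.2 a hb⟩
  · have hq : ∀ i j : ι, (P y.1).compl q (Finsupp.single j.1 1) i = (1 - F y.1) i j := by
      intro i j
      have hj := Finset.mem_Ico.1 j.2
      rw [BUZ.compl, LinearMap.sub_apply, Finsupp.sub_apply, flagOp_single, if_pos hj.2,
        Matrix.sub_apply, Matrix.one_apply, Finsupp.single_apply]
      simp only [Subtype.ext_iff, eq_comm (a := i.1)]
      rfl
    have e1 : U y.2 * F2 y.1 * Z y.2 = Matrix.fromBlocks
        (F y.1 + (s y.2 * s y.2) • (1 - F y.1)) ((s y.2 * c y.2) • (1 - F y.1))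
        ((s y.2 * c y.2) • (1 - F y.1)) ((c y.2 * c y.2) • (1 - F y.1)) := by
      rw [Matrix.fromBlocks_multiply, Matrix.fromBlocks_multiply]
      simp [smul_smul, mul_comm]
    rw [e1]
    ext (i | i) (j | j)
    · exact (tilt_entry_even_even (h y.1) _ _ (sin_mul_sin_add_cos_mul_cos _) _ _).trans (by rw [hq]; rfl)
    · exact (tilt_entry_even_odd (h y.1) _ _ (sin_mul_sin_add_cos_mul_cos _) _ _).trans (by rw [hq]; rfl)
    · exact (tilt_entry_odd_even (h y.1) _ _ (sin_mul_sin_add_cos_mul_cos _) _ _).trans (by rw [hq]; rfl)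
    · refine (tilt_entry_odd_odd (h y.1) _ _ (sin_mul_sin_add_cos_mul_cos _) _ _).trans ?_
      have hj := Finset.mem_Ico.1 j.2
      rw [hq, flagOp_single, if_neg (by omega), Finsupp.zero_apply, zero_add]
      rfl
  · rw [dMc_sandwich (hUd t) (hZd t) hF2d ht, dMb_zero, Complex.ofReal_one, one_smul, one_smul,
      Matrix.mul_zero, Matrix.zero_mul, add_zero, one_smul]
    exact ((((hεU' t).mul_right hεF).mul_right (hεZ t)).add_right
      (((hεU t).mul_right hεF).mul_right (hεZ' t))).eq
  · rw [dMc_sandwich (hUd t) (hZd t) hF2d ht, Complex.ofReal_zero, zero_smul, zero_smul,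
      Matrix.mul_zero, Matrix.zero_mul, Matrix.zero_mul, zero_add, zero_add, neg_one_smul]
    calc ε * (U t * dMb I F2 x w * Z t) = (ε * U t) * dMb I F2 x w * Z t := by
          simp only [mul_assoc]
      _ = U t * (ε * dMb I F2 x w) * Z t := by rw [(hεU t).eq]; simp only [mul_assoc]
      _ = -(U t * dMb I F2 x w * (ε * Z t)) := by
        rw [hεd, mul_neg, neg_mul]
        simp only [mul_assoc]
      _ = _ := by rw [(hεZ t).eq]; simp only [mul_assoc]

/-- `P ⊕ P^⊥` is homotopic to `I_0`, with vanishing Chern-Simons form. -/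
lemma IsPerp.csZeroHomotopic [IsManifold I ∞ M] {P P' : M → BUZ} (h : IsPerp P P')
    (hP : IsSmooth I P) : IsSmooth I P' ∧
      CSZeroHomotopic I (fun x => boxplus (P x) (P' x)) fun _ => I0 := by
  obtain ⟨p, q, hs, rfl⟩ := h.exists_eq
  refine ⟨hP.perp hs, ?_⟩
  have h1 : ∀ k, IsSmooth I fun _ : M => flag k := fun k =>
    isSmooth_iff.2 ⟨⟨k.natAbs, fun _ => (flag_inStage k).mono (by omega) (by omega)⟩,
      fun _ _ => contMDiff_const⟩
  exact CSZeroHomotopic.trans ⟨_, isHomotopy_tiltPath hP hs⟩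
    ((isBlockSum_flag q).csZeroHomotopic (h1 q) (h1 (-q))).symm

end CancelHomotopy

/-! ### Additivity of the Chern-Simons form -/

section Additive

variable {E : Type*} [NormedAddCommGroup E] [NormedSpace ℝ E] {H : Type*} [TopologicalSpace H]
  {I : ModelWithCorners ℝ E H} {M : Type*} [TopologicalSpace M] [ChartedSpace H M]

/-- Listing the even labels before the odd ones makes the shuffle sum and its derivative block
diagonal, and alternating traces of block diagonal matrices add. -/
lemma chern_boxplus {N n : ℕ} {P Q : M → BUZ} {s : Set M} {x : M} (hx : x ∈ s)
    (hP : ∀ y ∈ s, (P y).InStage (-(N : ℤ)) N) (hQ : ∀ y ∈ s, (Q y).InStage (-(N : ℤ)) N)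
    (w : Fin (2 * (n + 1)) → TangentSpace I x) :
    chern I (2 * N) (n + 1) (fun y => boxplus (P y) (Q y)) s x w =
      chern I N (n + 1) P s x w + chern I N (n + 1) Q s x w := by
  let ι := Finset.Ico (-(N : ℤ)) N
  let g : ι ⊕ ι → ℤ := Sum.elim (fun i => 2 * i.1) fun i => 2 * i.1 + 1
  have hst : ∀ y ∈ s, (boxplus (P y) (Q y)).InStage (2 * -(N : ℤ)) (2 * N) := fun y hy => by
    have h := boxplus_inStage (hP y hy) (hQ y hy)
    rwa [min_self, max_self] at h
  have hg : Function.Injective g := by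
    rintro (i | i) (j | j) h <;> simp only [g, Sum.elim_inl, Sum.elim_inr] at h
    · exact congrArg _ (Subtype.ext (by omega))
    · omega
    · omega
    · exact congrArg _ (Subtype.ext (by omega))
  have hg' : ∀ a, a ∉ Set.range g → a < 2 * -(N : ℤ) ∨ 2 * (N : ℤ) ≤ a := fun a ha => by
    by_contra h
    rcases Int.even_or_odd' a with ⟨k, rfl | rfl⟩
    · exact ha ⟨Sum.inl ⟨k, Finset.mem_Ico.2 (by omega)⟩, rfl⟩
    · exact ha ⟨Sum.inr ⟨k, Finset.mem_Ico.2 (by omega)⟩, rfl⟩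
  rw [chern_eq_chernM g hg (2 * N) n ?_ _ s x hx ?_ w]
  · have e : ∀ y, blk g (boxplus (P y) (Q y)) =
        Matrix.fromBlocks (blockAt N (P y)) 0 0 (blockAt N (Q y)) := fun y => by
      have e2 : ∀ i : ℤ, (2 * i) % 2 = 0 ∧ (2 * i) / 2 = i ∧ (2 * i + 1) / 2 = i ∧
        ¬ (2 * i + 1) % 2 = 0 := fun i => by omega
      ext (i | i) (j | j) <;> refine (boxplus_entry _ _ _ _).trans ?_ <;>
        simp only [g, Sum.elim_inl, Sum.elim_inr, e2, if_true, if_false] <;> rfl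
    simp only [e]
    rw [chern_eq, chern_eq, chernM, chernM, chernM, ← mul_add, ← altTrace_fromBlocks]
    congr 2
    funext i
    ext (a | a) (b | b)
    · rfl
    · exact dS_const _ _ _ _
    · exact dS_const _ _ _ _
    · rfl
  · rintro (i | i) <;> have := Finset.mem_Ico.1 i.2 <;>
      simp only [g, Sum.elim_inl, Sum.elim_inr] <;> omega
  · intro a b hab
    by_cases h : a < 2 * -(N : ℤ) ∨ b < 2 * -(N : ℤ)
    · exact ⟨_, fun y hy => (hst y hy).entry_low h⟩
    · refine ⟨0, fun y hy => (hst y hy).entry_high ?_⟩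
      exact hab.imp (fun ha => (hg' a ha).resolve_left fun h' => h (Or.inl h'))
        fun hb => (hg' b hb).resolve_left fun h' => h (Or.inr h')

lemma isHomotopy_boxplus [IsManifold I ∞ M] {Γ Γ' : M × ℝ → BUZ} {P P' Q Q' : M → BUZ}
    (h : IsHomotopy I Γ P P') (h' : IsHomotopy I Γ' Q Q') :
    IsHomotopy I (fun y => boxplus (Γ y) (Γ' y)) (fun x => boxplus (P x) (Q x))
      (fun x => boxplus (P' x) (Q' x)) ∧
      ∀ n x v, CS I (fun y => boxplus (Γ y) (Γ' y)) n x v = CS I Γ n x v + CS I Γ' n x v := by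
  refine ⟨⟨h.1.boxplus h'.1, fun x => congrArg₂ boxplus (h.2.1 x) (h'.2.1 x),
      fun x => congrArg₂ boxplus (h.2.2 x) (h'.2.2 x)⟩,
    fun n x v => ?_⟩
  obtain ⟨N, hN, hN'⟩ := exists_common_stage h.1 h'.1
  have hst : ∀ y ∈ cylinder M, (boxplus (Γ y) (Γ' y)).InStage (-((2 * N : ℕ) : ℤ)) (2 * N : ℕ) :=
    fun y hy => (boxplus_inStage (hN y hy) (hN' y hy)).mono (by omega) (by omega)
  rw [CS_eq_of_stage hst, CS_eq_of_stage hN, CS_eq_of_stage hN', ← intervalIntegral.integral_add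
    ((continuousOn_chern h.1 N n x v).intervalIntegrable_of_Icc zero_le_one)
    ((continuousOn_chern h'.1 N n x v).intervalIntegrable_of_Icc zero_le_one)]
  refine intervalIntegral.integral_congr fun t ht => ?_
  rw [Set.uIcc_of_le zero_le_one] at ht
  exact chern_boxplus (mem_cylinder.2 ht) hN hN' _

lemma CSEquiv.boxplus [IsManifold I ∞ M] {P P' Q Q' : M → BUZ} (h : CSEquiv I P P')
    (h' : CSEquiv I Q Q') : CSEquiv I (fun x => KTheory.boxplus (P x) (Q x))
      fun x => KTheory.boxplus (P' x) (Q' x) := by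
  obtain ⟨Γ, hΓ, e⟩ := h
  obtain ⟨Γ', hΓ', e'⟩ := h'
  obtain ⟨h1, h2⟩ := isHomotopy_boxplus hΓ hΓ'
  refine ⟨_, h1, fun n => ?_⟩
  have h3 := (e n).add (e' n)
  have h4 : CS I (fun y => KTheory.boxplus (Γ y) (Γ' y)) n =
      fun x v => CS I Γ n x v + CS I Γ' n x v := by
    funext x v
    exact h2 n x v
  rwa [h4]

variable (I M) in
lemma isSmooth_I0 : IsSmooth I fun _ : M => I0 :=
  isSmooth_iff.2 ⟨⟨0, fun _ => I0_inStage⟩, fun _ _ => contMDiff_const⟩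

end Additive

/-! ### The abelian group of classes -/

namespace KHat

variable {X Y : CompactMfd.{u}}

lemma sound {P Q : Maps X} (h : CSEquiv X.I P.1 Q.1) : mk P = mk Q := Quot.sound h

/-- The shuffle sum of smooth maps. -/
def _root_.KTheory.Maps.boxplus (P Q : Maps X) : Maps X :=
  ⟨fun x => KTheory.boxplus (P.1 x) (Q.1 x), P.2.boxplus Q.2⟩

instance : Zero (KHat X) := ⟨mk ⟨_, isSmooth_I0 X.I X.M⟩⟩

/-- The shuffle sum is used because it involves no choice of bounds and Chern–Simons forms are
additive for it; `mk_blockSum` then gives the same sum for `⊕`. -/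
instance : Add (KHat X) := ⟨Quot.map₂ Maps.boxplus
  (fun P _ _ h => (CSEquiv.refl P.2).boxplus h) fun _ _ Q h => h.boxplus (CSEquiv.refl Q.2)⟩

lemma mk_blockSum {P Q R : Maps X} (h : IsBlockSum P.1 Q.1 R.1) : mk R = mk P + mk Q :=
  sound (h.csZeroHomotopic P.2 Q.2).csEquiv

protected lemma add_comm (a b : KHat X) : a + b = b + a := by
  obtain ⟨P, rfl⟩ := Quot.exists_rep a
  obtain ⟨Q, rfl⟩ := Quot.exists_rep b
  exact sound (CSZeroHomotopic.boxplus_comm P.2 Q.2).csEquiv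

protected lemma zero_add (a : KHat X) : 0 + a = a := by
  rw [KHat.add_comm]
  obtain ⟨P, rfl⟩ := Quot.exists_rep a
  exact sound (CSZeroHomotopic.boxplus_I0 P.2 (isSmooth_I0 X.I X.M)).csEquiv

/-- The shuffle sum is not strictly associative, since the two bracketings interleave the labels
differently. Classes allow passing to block sums, for which `IsBlockSum.assoc` gives one common `Z`.
-/
protected lemma add_assoc (a b c : KHat X) : a + b + c = a + (b + c) := by
  obtain ⟨P, rfl⟩ := Quot.exists_rep a
  obtain ⟨Q, rfl⟩ := Quot.exists_rep b
  obtain ⟨R, rfl⟩ := Quot.exists_rep c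
  obtain ⟨N, hN⟩ := P.2.exists_stage
  obtain ⟨N', hN'⟩ := Q.2.exists_stage
  obtain ⟨N'', hN''⟩ := R.2.exists_stage
  obtain ⟨S, T, Z, hS, hZ, hT, hZ'⟩ := IsBlockSum.assoc (N := max N (max N' N''))
    (fun x => (hN x).mono (by omega) (by omega)) (fun x => (hN' x).mono (by omega) (by omega))
    (fun x => (hN'' x).mono (by omega) (by omega))
  let S' : Maps X := ⟨S, hS.isSmooth P.2 Q.2⟩
  let T' : Maps X := ⟨T, hT.isSmooth Q.2 R.2⟩
  let Z' : Maps X := ⟨Z, hZ.isSmooth S'.2 R.2⟩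
  calc mk P + mk Q + mk R = mk S' + mk R := by rw [mk_blockSum (R := S') hS]
    _ = mk Z' := (mk_blockSum (R := Z') hZ).symm
    _ = mk P + mk T' := mk_blockSum (R := Z') hZ'
    _ = mk P + (mk Q + mk R) := by rw [mk_blockSum (R := T') hT]

lemma mk_perp_add {P P' : Maps X} (h : IsPerp P.1 P'.1) : mk P' + mk P = 0 := by
  rw [KHat.add_comm]
  exact sound (h.csZeroHomotopic P.2).2.csEquiv

lemma exists_neg (a : KHat X) : ∃ b, b + a = 0 := by
  obtain ⟨P, rfl⟩ := Quot.exists_rep a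
  obtain ⟨N, hN⟩ := P.2.exists_stage
  have h := isPerp_perp hN
  exact ⟨_, mk_perp_add (P' := ⟨_, (h.csZeroHomotopic P.2).1⟩) h⟩

/-- Any chosen inverse will do: that it is the class of `P^⊥`, for all bounds, follows from
uniqueness of inverses and `mk_perp_add`. -/
instance : Neg (KHat X) := ⟨fun a => (exists_neg a).choose⟩

instance : AddCommGroup (KHat X) :=
  { AddGroup.ofLeftAxioms KHat.add_assoc KHat.zero_add fun a => (exists_neg a).choose_spec with
    add_comm := KHat.add_comm }

/-- The pullback of classes. -/
def pullback (f : X ⟶ Y) : KHat Y →+ KHat X where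
  toFun := Quot.map (Maps.pullback f) fun _ _ h => h.comp f.2
  map_zero' := rfl
  map_add' a b := by
    obtain ⟨P, rfl⟩ := Quot.exists_rep a
    obtain ⟨Q, rfl⟩ := Quot.exists_rep b
    rfl

end KHat

/-- The functor `K̂⁰`. -/
def KHatFunctor : CompactMfd.{u}ᵒᵖ ⥤ AddCommGrpCat.{u} where
  obj X := AddCommGrpCat.of (KHat X.unop)
  map f := AddCommGrpCat.ofHom (KHat.pullback f.unop)
  map_id X := by
    ext a
    obtain ⟨P, rfl⟩ := Quot.exists_rep a
    rfl
  map_comp f g := by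
    ext a
    obtain ⟨P, rfl⟩ := Quot.exists_rep a
    rfl

/-- The universal homotopy that exchanges two basis vectors. -/
lemma exists_swapPath {k l : ℤ} (hkl : k ≠ l) : ∃ Γ : BUZ → ℝ → BUZ,
    (∀ P, Γ P 0 = P) ∧ (∀ P, Γ P 1 = P.conjSwap k l) ∧
    ∀ (X : CompactMfd.{u}) (P : X.M → BUZ), IsSmooth X.I P →
      IsHomotopy X.I (fun y => Γ (P y.1) y.2) P (fun x => Γ (P x) 1) ∧
      ∀ n x v, CS X.I (fun y => Γ (P y.1) y.2) n x v = 0 := by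
  obtain ⟨K, hk, hl⟩ : ∃ K, k < K ∧ l < K := ⟨max k l + 1, by omega, by omega⟩
  have h0 : ∀ P, swapPath k l K hkl hk hl P 0 = P := fun P => by
    rw [swapPath]
    simp only [catPath_zero]
    exact IsoPath.act_zero_of_map (shiftPath_map_zero K) P
  have h1 : ∀ P, swapPath k l K hkl hk hl P 1 = P.conjSwap k l := fun P => by
    rw [swapPath]
    simp only [catPath_one, sub_self]
    exact IsoPath.act_zero_of_map (shiftPath_map_zero K) _
  refine ⟨swapPath k l K hkl hk hl, h0, h1, fun X P hP => ?_⟩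
  simp only [h1]
  exact isHomotopy_swapPath hkl hk hl hP

end KTheory

end

/-! ### The theorem, assembled from the preceding parts. -/

theorem mainTheorem8 :
    -- the block sums of smooth maps exist, are smooth, and are commutative and equal to each
    -- other up to homotopies with vanishing CS-form
    (∀ (X : CompactMfd.{u}) (P Q : X.M → BUZ), IsSmooth X.I P → IsSmooth X.I Q →
      (∃ R, IsBlockSum P Q R) ∧
      (∀ R, IsBlockSum P Q R → IsSmooth X.I R) ∧
      IsSmooth X.I (fun x => boxplus (P x) (Q x)) ∧
      (∀ R R', IsBlockSum P Q R → IsBlockSum Q P R' → CSZeroHomotopic X.I R R') ∧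
      CSZeroHomotopic X.I (fun x => boxplus (P x) (Q x)) (fun x => boxplus (Q x) (P x)) ∧
      (∀ R, IsBlockSum P Q R → CSZeroHomotopic X.I R (fun x => boxplus (P x) (Q x))) ∧
      (∀ R, IsBlockSum P Q R → CSEquiv X.I R (fun x => boxplus (P x) (Q x)))) ∧
    -- inverses
    (∀ (X : CompactMfd.{u}) (P : X.M → BUZ), IsSmooth X.I P →
      (∃ P', IsPerp P P') ∧
      ∀ P', IsPerp P P' → IsSmooth X.I P' ∧
        ∀ R, IsBlockSum P P' R → CSZeroHomotopic X.I R (fun _ => I0)) ∧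
    -- transposing two basis vectors is homotopic to the identity of `BU × ℤ`, with CS-form zero
    (∀ k l : ℤ, k ≠ l → ∃ Γ : BUZ → ℝ → BUZ,
      (∀ P, Γ P 0 = P) ∧
      (∀ P, (Γ P 1).op = relabel (Equiv.swap k l) * P.op * relabel (Equiv.swap k l)) ∧
      ∀ (X : CompactMfd.{u}) (P : X.M → BUZ), IsSmooth X.I P →
        IsHomotopy X.I (fun y => Γ (P y.1) y.2) P (fun x => Γ (P x) 1) ∧
        (∀ n x v, CS X.I (fun y => Γ (P y.1) y.2) n x v = 0) ∧
        CSEquiv X.I P (fun x => Γ (P x) 1)) ∧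
    -- CS-equivalence is an equivalence relation, and the classes form a contravariant functor
    -- from compact manifolds to abelian groups, with either sum
    (∀ X : CompactMfd.{u}, Equivalence fun P Q : Maps X => CSEquiv X.I P.1 Q.1) ∧
    ∃ (F : CompactMfd.{u}ᵒᵖ ⥤ AddCommGrpCat.{u})
      (e : ∀ X : CompactMfd.{u}, KHat X ≃ F.obj (Opposite.op X)),
      (∀ (X : CompactMfd.{u}) (P Q R : Maps X), IsBlockSum P.1 Q.1 R.1 →
        e X (KHat.mk R) = e X (KHat.mk P) + e X (KHat.mk Q)) ∧
      (∀ (X : CompactMfd.{u}) (P Q R : Maps X), (∀ x, R.1 x = boxplus (P.1 x) (Q.1 x)) →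
        e X (KHat.mk R) = e X (KHat.mk P) + e X (KHat.mk Q)) ∧
      (∀ (X : CompactMfd.{u}) (P : Maps X), (∀ x, P.1 x = I0) → e X (KHat.mk P) = 0) ∧
      (∀ (X : CompactMfd.{u}) (P P' : Maps X), IsPerp P.1 P'.1 →
        e X (KHat.mk P') = -e X (KHat.mk P)) ∧
      ∀ (X Y : CompactMfd.{u}) (f : X ⟶ Y) (P : Maps Y),
        F.map f.op (e Y (KHat.mk P)) = e X (KHat.mk (P.pullback f)) := by
  refine ⟨fun X P Q hP hQ => ?_, fun X P hP => ?_, fun k l hkl => ?_, fun X => ?_,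
    KHatFunctor, fun X => Equiv.refl (KHat X), fun X P Q R h => KHat.mk_blockSum h,
    fun X P Q R h => ?_, fun X P h => ?_, fun X P P' h => ?_, fun X Y f P => rfl⟩
  · obtain ⟨N, hN⟩ := hP.exists_stage
    obtain ⟨N', hN'⟩ := hQ.exists_stage
    refine ⟨(IsBlockSum.of_inStage hN hN').imp fun _ h => h.1, fun R h => h.isSmooth hP hQ,
      hP.boxplus hQ, fun R R' h h' => ?_, CSZeroHomotopic.boxplus_comm hP hQ,
      fun R h => h.csZeroHomotopic hP hQ, fun R h => (h.csZeroHomotopic hP hQ).csEquiv⟩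
    exact ((h.csZeroHomotopic hP hQ).trans (CSZeroHomotopic.boxplus_comm hP hQ)).trans
      (h'.csZeroHomotopic hQ hP).symm
  · obtain ⟨N, hN⟩ := hP.exists_stage
    refine ⟨⟨_, isPerp_perp hN⟩, fun P' h => ?_⟩
    obtain ⟨h1, h2⟩ := h.csZeroHomotopic hP
    exact ⟨h1, fun R hR => (hR.csZeroHomotopic hP h1).trans h2⟩
  · obtain ⟨Γ, h0, h1, h⟩ := exists_swapPath hkl
    refine ⟨Γ, h0, fun P => ?_, fun X P hP => ⟨(h X P hP).1, (h X P hP).2,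
      CSZeroHomotopic.csEquiv ⟨_, h X P hP⟩⟩⟩
    rw [h1, BUZ.conjSwap, BUZ.conj_op, Equiv.swap_inv]
  · exact ⟨fun P => CSEquiv.refl P.2, CSEquiv.symm, CSEquiv.trans⟩
  · have e : R = P.boxplus Q := Subtype.ext (funext h)
    rw [e]
    rfl
  · have e : P = ⟨_, isSmooth_I0 X.I X.M⟩ := Subtype.ext (funext h)
    rw [e]
    rfl
  · exact eq_neg_of_add_eq_zero_left (KHat.mk_perp_add h)
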